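/- **Setting.** For a symmetric positive definite matrix $V$ write $\|v\|_V^2=\langle v,Vv\rangle$ and $\operatorname{dist}_V(u,U)=\inf_{w\in U}\|u-w\|_V$ (with value $+\infty$ if $U=\emptyset$); $\|X\|$ is the spectral norm of a matrix. Consider $\min_{x\in\mathbb R^n}\max_{y\in\mathbb R^r} f(x)+\varphi(x,y)-g(y)$ with $\varphi(z)=\mathbb E_\xi[\hat\varphi(z,\xi)]$, $z=(x,y)$, $\xi\sim\mathcal P$, and put $$F(z)=(\nabla_x\varphi(z),-\nabla_y\varphi(z)),\quad \hat F(z,\xi)=(\nabla_x\hat\varphi(z,\xi),-\nabla_y\hat\varphi(z,\xi)),\quad A=(\partial f,\partial g),\quad T=A+F .$$ **Assumptions.** Let $\theta\in[0,\infty)$, let $\Gamma_1\in\mathbb R^{n\times n}$, $\Gamma_2\in\mathbb R^{r\times r}$ be symmetric positive definite, and $\Gamma=\operatorname{blockdiag}(\Gamma_1,\Gamma_2)$. 1. (Weak MVI) There are $\rho\in\mathbb R$ and a nonempty set $\mathcal S^\star$ of zeros of $T$ with $\langle v,z-z^\star\rangle\ge\rho\|v\|^2$ for all $z^\star\in\mathcal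 S^\star$, all $z$ and all $v\in Tz$. 2. (Oracle) $\hat\varphi(\cdot,\xi)$ is continuously differentiable and $\hat F$, which may be queried at several points with the same $\xi$, is unbiased: $\mathbb E_\xi[\hat F(z,\xi)]=F(z)$ for all $z$. 3. $f,g$ are proper, lower semicontinuous and convex with values in $(-\infty,+\infty]$. 4. $\varphi$ is continuously differentiable and, for symmetric positive definite $D_{xx},D_{xy},D_{yx},D_{yy}$ and all $z=(x,y)$, $z'=(x',y')$, $$\|\nabla_x\varphi(z')-\nabla_x\varphi(z)\|_{\Gamma_1}^2\le L_{xx}^2\|x'-x\|_{D_{xx}}^2+L_{xy}^2\|y'-y\|_{D_{xy}}^2,$$ $$\|\nabla_y\varphi(z')-\theta\nabla_y\varphi(x',y)-(1-\theta)\nabla_y\varphi(z)\|_{\Gamma_2}^2\le L_{yx}^2\|x'-x\|_{D_{yx}}^2+L_{yy}^2\|y'-y\|_{D_{yy}}^2 .$$ 5. (Stepsizes) $L_{xx}^2D_{xx}+L_{yx}^2D_{yx}\prec\Gamma_1^{-1}$ and $L_{xy}^2D_{xy}+L_{yy}^2D_{yy}\prec\Gamma_2^{-1}$. 6. (Bounded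 variance) $\mathbb E_\xi\|\hat F(z,\xi)-F(z)\|_\Gamma^2\le\sigma_F^2$ for all $z$. 7. (Lipschitz in mean) For symmetric positive definite $D_{\widehat{xz}},D_{\widehat{yz}},D_{\widehat{yx}},D_{\widehat{yy}}$ and all $z=(x,y)$, $z'=(x',y')$, $v,v'\in\mathbb R^n$: $\mathbb E_\xi\|\nabla_x\hat\varphi(z',\xi)-\nabla_x\hat\varphi(z,\xi)\|_{\Gamma_1}^2\le L_{\widehat{xz}}^2\|z'-z\|_{D_{\widehat{xz}}}^2$; if $\theta\ne1$, $\mathbb E_\xi\|\nabla_y\hat\varphi(z',\xi)-\nabla_y\hat\varphi(z,\xi)\|_{\Gamma_2}^2\le L_{\widehat{yz}}^2\|z'-z\|_{D_{\widehat{yz}}}^2$; if $\theta\ne0$, $\mathbb E_\xi\|\nabla_y\hat\varphi(v',y',\xi)-\nabla_y\hat\varphi(v,y,\xi)\|_{\Gamma_2}^2\le L_{\widehat{yx}}^2\|v'-v\|_{D_{\widehat{yx}}}^2+L_{\widehat{yy}}^2\|y'-y\|_{D_{\widehat{yy}}}^2$. **Algorithm (NP-PDEG).** Let $\alpha_k\in(0,1)$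 with $\alpha_k\le\alpha_0$ for all $k$. Start from (possibly random) $z^{-1}=z^0=(x^0,y^0)$ and $\hat z^{-1}=(\hat x^{-1},\hat y^{-1})$, with $\bar x^{-1}=\operatorname{prox}_f^{\Gamma_1^{-1}}(\hat x^{-1})$, where $\operatorname{prox}_f^V(q)=\arg\min_w f(w)+\tfrac12\|w-q\|_V^2$. For $k=0,1,\dots$, with $\xi_k,\xi_k',\bar\xi_k\sim\mathcal P$, all samples being independent of each other and of the initial data, $$\hat x^k=x^k-\Gamma_1\nabla_x\hat\varphi(z^k,\xi_k)+(1-\alpha_k)\big(\hat x^{k-1}-x^{k-1}+\Gamma_1\nabla_x\hat\varphi(z^{k-1},\xi_k)\big),\qquad \bar x^k=\operatorname{prox}_f^{\Gamma_1^{-1}}(\hat x^k),$$ $$\begin{aligned}\hat y^k={}&y^k+\Gamma_2\big(\theta\nabla_y\hat\varphi(\bar x^k,y^k,\xi_k')+(1-\theta)\nabla_y\hat\varphi(z^k,\xi_k)\big)\\&+(1-\alpha_k)\Big(\hat y^{k-1}-y^{k-1}-\Gamma_2\big(\theta\nabla_y\hat\varphi(\bar x^{k-1},y^{k-1},\xi_k')+(1-\theta)\nabla_y\hat\varphi(z^{k-1},\xi_k)\big)\Big),\end{aligned}\qquad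 \bar y^k=\operatorname{prox}_g^{\Gamma_2^{-1}}(\hat y^k),$$ $$x^{k+1}=x^k+\alpha_k\big(\bar x^k-\hat x^k-\Gamma_1\nabla_x\hat\varphi(\bar z^k,\bar\xi_k)\big),\qquad y^{k+1}=y^k+\alpha_k\big(\bar y^k-\hat y^k+\Gamma_2\nabla_y\hat\varphi(\bar z^k,\bar\xi_k)\big),$$ where $z^k=(x^k,y^k)$, $\bar z^k=(\bar x^k,\bar y^k)$, $\hat z^k=(\hat x^k,\hat y^k)$. **Notation.** For $u=(x,y)$ and $\bar z=(\bar x,\bar y)$ let $Q_u(\bar z)=(0,-\theta\nabla_y\varphi(\bar x,y))$, $H_u(z)=\Gamma^{-1}z+Q_u(z)-F(z)$ and $S_u(z;\bar z)=H_u(z)-Q_u(\bar z)$. Let $\bar\gamma$ be the smallest eigenvalue of $\Gamma$ if $\rho\le0$ and the largest one if $\rho>0$. Let $$\hat c_1=L_{\widehat{xz}}^2\|\Gamma D_{\widehat{xz}}\|+2(1-\theta)^2L_{\widehat{yz}}^2\|\Gamma D_{\widehat{yz}}\|+2\theta^2L_{\widehat{yy}}^2\|\Gamma_2D_{\widehat{yy}}\|,\quad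 \hat c_2=2\theta^2L_{\widehat{yx}}^2\|\Gamma_1D_{\widehat{yx}}\|,\quad \hat c_3=L_{\widehat{xz}}^2\|\Gamma D_{\widehat{xz}}\|,$$ $\Theta=(1-\theta)^2+2\theta^2$, and let $L_M=\sqrt t$, where $t\ge0$ is the smallest number with $L_{xx}^2D_{xx}+L_{yx}^2D_{yx}\preceq t\,\Gamma_1^{-1}$ and $L_{xy}^2D_{xy}+L_{yy}^2D_{yy}\preceq t\,\Gamma_2^{-1}$ (so $L_M<1$ by 5). Suppose $1-4\hat c_2\alpha_0>0$, and let $K\in\mathbb N$ and $z^\star\in\mathcal S^\star$. For real $\eta,\mu,e$ put $$C=2(\eta+\alpha_0e)(\Theta+2\hat c_2)+1+2(\hat c_1+2\hat c_2(1+\hat c_3))\eta,$$ $$R(\eta,\mu,e)=\frac{\mathbb E\|z^0-z^\star\|_{\Gamma^{-1}}^2+\eta\,\mathbb E\|\Gamma^{-1}\hat z^{-1}-S_{z^{-1}}(z^{-1};\bar z^{-1})\|_\Gamma^2+C\sigma_F^2\sum_{j=0}^K\alpha_j^2}{\mu\sum_{j=0}^K\alpha_j}$$ (which may be $+\infty$;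 $S_{z^{-1}}(z^{-1};\bar z^{-1})$ depends on $\bar z^{-1}$ only through $\bar x^{-1}$). **Theorem.** (i) (General form.) Let $b,\varepsilon>0$ with $1-\frac1{\varepsilon(1-L_M)^2}\ge0$, let $e=\varepsilon+\frac1b\big(1-\frac1{\varepsilon(1-L_M)^2}\big)$, $\eta\ge\frac{(1+4\hat c_2\alpha_0^2)\,e}{1-4\hat c_2\alpha_0}$, and suppose $$\mu=\tfrac1{1+b}\Big(1-\tfrac1{\varepsilon(1-L_M)^2}\Big)+\tfrac{2\rho}{\bar\gamma}-\alpha_0-2\alpha_0(\hat c_1+2\hat c_2(1+\hat c_3))\eta>0 .$$ Then $\displaystyle\sum_{k=0}^K\frac{\alpha_k}{\sum_{j=0}^K\alpha_j}\,\mathbb E\|\Gamma^{-1}\hat z^k-S_{z^k}(\bar z^k;\bar z^k)\|_\Gamma^2\le R(\eta,\mu,e)$. (ii) Let $e=\frac1{\sqrt{\alpha_0}(1-L_M)^2}+\frac{1-\sqrt{\alpha_0}}{\sqrt{\alpha_0}}$, $\eta\ge\frac{(1+4\hat c_2\alpha_0^2)\,e}{1-4\hat c_2\alpha_0}$, and suppose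 $$\mu=\tfrac{1-\sqrt{\alpha_0}}{1+\sqrt{\alpha_0}}+\tfrac{2\rho}{\bar\gamma}-\alpha_0-2\alpha_0(\hat c_1+2\hat c_2(1+\hat c_3))\eta>0 .$$ Let $k_\star\in\{0,\dots,K\}$ be random with $\mathbb P[k_\star=k]=\alpha_k/\sum_{j=0}^K\alpha_j$, independent of the initial data and of all samples. Then $\mathbb E[\operatorname{dist}_\Gamma(0,T\bar z^{k_\star})^2]\le R(\eta,\mu,e)$. -/

import Mathlib

open MeasureTheory ProbabilityTheory
open scoped ENNReal

noncomputable section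

namespace NPPDEG

/-- `ℝ^ι` with its Euclidean structure. -/
abbrev Vec (ι : Type) := EuclideanSpace ℝ ι

section WeightedNorms

variable {ι : Type} [Fintype ι] [DecidableEq ι]

/-- The matrix-vector product `M v` in Euclidean space. -/
def act (M : Matrix ι ι ℝ) (v : Vec ι) : Vec ι := Matrix.toEuclideanLin M v

/-- `‖v‖_V² = ⟨v, V v⟩`. -/
def wsq (V : Matrix ι ι ℝ) (v : Vec ι) : ℝ := inner ℝ v (act V v)

/-- `‖v‖_V = √⟨v, V v⟩`. -/
def wnorm (V : Matrix ι ι ℝ) (v : Vec ι) : ℝ := Real.sqrt (wsq V v)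

/-- `dist_V(u, U) = inf_{w ∈ U} ‖u - w‖_V`, with value `∞` for the empty set. -/
def wdist (V : Matrix ι ι ℝ) (u : Vec ι) (U : Set (Vec ι)) : ℝ≥0∞ :=
  ⨅ w ∈ U, ENNReal.ofReal (wnorm V (u - w))

/-- The spectral norm of a matrix. -/
def specNorm (M : Matrix ι ι ℝ) : ℝ := ‖Matrix.toEuclideanCLM (𝕜 := ℝ) M‖

/-- Proper, lower semicontinuous and convex extended real-valued functions. -/
structure ProperLscConvex (f : Vec ι → EReal) : Prop where
  ne_bot : ∀ x, f x ≠ ⊥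
  exists_ne_top : ∃ x, f x ≠ ⊤
  lsc : LowerSemicontinuous f
  convex_epi : Convex ℝ {p : Vec ι × ℝ | f p.1 ≤ (p.2 : EReal)}

/-- The convex subdifferential `∂f(x)`. -/
def subdiff (f : Vec ι → EReal) (x : Vec ι) : Set (Vec ι) :=
  {v | ∀ w, f x + ((inner ℝ v (w - x) : ℝ) : EReal) ≤ f w}

/-- `p = prox_f^V(q)`, that is, `p` minimizes `w ↦ f w + ½ ‖w - q‖_V²`. -/
def IsProx (f : Vec ι → EReal) (V : Matrix ι ι ℝ) (q p : Vec ι) : Prop :=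
  ∀ w, f p + ((wsq V (p - q) / 2 : ℝ) : EReal) ≤ f w + ((wsq V (w - q) / 2 : ℝ) : EReal)

end WeightedNorms

section Pairs

variable {n r : ℕ}

/-- `z = (x, y)`. -/
def pair (x : Vec (Fin n)) (y : Vec (Fin r)) : Vec (Fin n ⊕ Fin r) :=
  WithLp.toLp 2 (Sum.elim x y)

/-- The component `x` of `z = (x, y)`. -/
def fstV (z : Vec (Fin n ⊕ Fin r)) : Vec (Fin n) := WithLp.toLp 2 (fun i => z (Sum.inl i))

/-- The component `y` of `z = (x, y)`. -/
def sndV (z : Vec (Fin n ⊕ Fin r)) : Vec (Fin r) := WithLp.toLp 2 (fun j => z (Sum.inr j))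

/-- The partial gradient `∇_x φ(z)`. -/
def gradX (φ : Vec (Fin n ⊕ Fin r) → ℝ) (z : Vec (Fin n ⊕ Fin r)) : Vec (Fin n) :=
  gradient (fun x => φ (pair x (sndV z))) (fstV z)

/-- The partial gradient `∇_y φ(z)`. -/
def gradY (φ : Vec (Fin n ⊕ Fin r) → ℝ) (z : Vec (Fin n ⊕ Fin r)) : Vec (Fin r) :=
  gradient (fun y => φ (pair (fstV z) y)) (sndV z)

/-- `F(z) = (∇_x φ(z), -∇_y φ(z))`; with `φ̂(·, ξ)` in place of `φ` this is `F̂(z, ξ)`. -/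
def opF (φ : Vec (Fin n ⊕ Fin r) → ℝ) (z : Vec (Fin n ⊕ Fin r)) : Vec (Fin n ⊕ Fin r) :=
  pair (gradX φ z) (-gradY φ z)

/-- `T z = A z + F z` with `A = (∂f, ∂g)`. -/
def opT (f : Vec (Fin n) → EReal) (g : Vec (Fin r) → EReal) (φ : Vec (Fin n ⊕ Fin r) → ℝ)
    (z : Vec (Fin n ⊕ Fin r)) : Set (Vec (Fin n ⊕ Fin r)) :=
  {v | ∃ a ∈ subdiff f (fstV z), ∃ b ∈ subdiff g (sndV z), v = pair a b + opF φ z}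

/-- The weak Minty variational inequality on a nonempty set `S` of zeros of `T`. -/
structure WeakMVI (T : Vec (Fin n ⊕ Fin r) → Set (Vec (Fin n ⊕ Fin r)))
    (S : Set (Vec (Fin n ⊕ Fin r))) (ρ : ℝ) : Prop where
  nonempty : S.Nonempty
  zeros : ∀ zs ∈ S, (0 : Vec (Fin n ⊕ Fin r)) ∈ T zs
  minty : ∀ zs ∈ S, ∀ z, ∀ v ∈ T z, ρ * ‖v‖ ^ 2 ≤ inner ℝ v (z - zs)

end Pairs

/-- The parameter `θ`, the stepsize matrices `Γ₁, Γ₂`, the noise level `σ_F`, and the moduli and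
matrices of the Lipschitz-type conditions (`Lh`, `Dh` are those of the stochastic oracle). -/
structure Constants (n r : ℕ) where
  θ : ℝ
  Γ₁ : Matrix (Fin n) (Fin n) ℝ
  Γ₂ : Matrix (Fin r) (Fin r) ℝ
  σ : ℝ
  Lxx : ℝ
  Lxy : ℝ
  Lyx : ℝ
  Lyy : ℝ
  Dxx : Matrix (Fin n) (Fin n) ℝ
  Dxy : Matrix (Fin r) (Fin r) ℝ
  Dyx : Matrix (Fin n) (Fin n) ℝ
  Dyy : Matrix (Fin r) (Fin r) ℝ
  Lhxz : ℝ
  Lhyz : ℝ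
  Lhyx : ℝ
  Lhyy : ℝ
  Dhxz : Matrix (Fin n ⊕ Fin r) (Fin n ⊕ Fin r) ℝ
  Dhyz : Matrix (Fin n ⊕ Fin r) (Fin n ⊕ Fin r) ℝ
  Dhyx : Matrix (Fin n) (Fin n) ℝ
  Dhyy : Matrix (Fin r) (Fin r) ℝ

namespace Constants

variable {n r : ℕ} (c : Constants n r)

/-- `Γ = blockdiag(Γ₁, Γ₂)`. -/
def Γ : Matrix (Fin n ⊕ Fin r) (Fin n ⊕ Fin r) ℝ := Matrix.fromBlocks c.Γ₁ 0 0 c.Γ₂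

/-- `ĉ₁`. -/
def c1 : ℝ := c.Lhxz ^ 2 * specNorm (c.Γ * c.Dhxz)
  + 2 * (1 - c.θ) ^ 2 * c.Lhyz ^ 2 * specNorm (c.Γ * c.Dhyz)
  + 2 * c.θ ^ 2 * c.Lhyy ^ 2 * specNorm (c.Γ₂ * c.Dhyy)

/-- `ĉ₂`. -/
def c2 : ℝ := 2 * c.θ ^ 2 * c.Lhyx ^ 2 * specNorm (c.Γ₁ * c.Dhyx)

/-- `ĉ₃`. -/
def c3 : ℝ := c.Lhxz ^ 2 * specNorm (c.Γ * c.Dhxz)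

/-- `L_M²`: the smallest `t ≥ 0` with `L_xx² D_xx + L_yx² D_yx ⪯ t Γ₁⁻¹` and
`L_xy² D_xy + L_yy² D_yy ⪯ t Γ₂⁻¹`. -/
def LMsq : ℝ := sInf {t : ℝ | 0 ≤ t ∧
  (t • c.Γ₁⁻¹ - (c.Lxx ^ 2 • c.Dxx + c.Lyx ^ 2 • c.Dyx)).PosSemidef ∧
  (t • c.Γ₂⁻¹ - (c.Lxy ^ 2 • c.Dxy + c.Lyy ^ 2 • c.Dyy)).PosSemidef}

/-- `L_M`. -/
def LM : ℝ := Real.sqrt c.LMsq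

/-- `γ̄`: the smallest eigenvalue of `Γ` if `ρ ≤ 0`, the largest one if `ρ > 0`. -/
def gbar (ρ : ℝ) : ℝ := if ρ ≤ 0 then sInf (spectrum ℝ c.Γ) else sSup (spectrum ℝ c.Γ)

/-- `Θ = (1 - θ)² + 2θ²`. -/
def Theta : ℝ := (1 - c.θ) ^ 2 + 2 * c.θ ^ 2

/-- The nonlinear part `Q_u(z̄) = (0, -θ ∇_y φ(x̄, y))` of the preconditioner, `u = (x, y)`. -/
def opQ (φ : Vec (Fin n ⊕ Fin r) → ℝ) (u zb : Vec (Fin n ⊕ Fin r)) : Vec (Fin n ⊕ Fin r) :=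
  pair 0 (-(c.θ • gradY φ (pair (fstV zb) (sndV u))))

/-- `H_u(z) = Γ⁻¹ z + Q_u(z) - F(z)`. -/
def opH (φ : Vec (Fin n ⊕ Fin r) → ℝ) (u z : Vec (Fin n ⊕ Fin r)) : Vec (Fin n ⊕ Fin r) :=
  act c.Γ⁻¹ z + c.opQ φ u z - opF φ z

/-- `S_u(z; z̄) = H_u(z) - Q_u(z̄)`. -/
def opS (φ : Vec (Fin n ⊕ Fin r) → ℝ) (u z zb : Vec (Fin n ⊕ Fin r)) : Vec (Fin n ⊕ Fin r) :=
  c.opH φ u z - c.opQ φ u zb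

end Constants

/-- `φ(z) = E_ξ[φ̂(z, ξ)]`. -/
def meanFn {n r : ℕ} {Ξ : Type*} [MeasurableSpace Ξ] (P : Measure Ξ)
    (φh : Vec (Fin n ⊕ Fin r) → Ξ → ℝ) (z : Vec (Fin n ⊕ Fin r)) : ℝ := ∫ ξ, φh z ξ ∂P

/-- The oracle: `φ̂(z, ·)` is a random variable with mean `φ(z)`, and `F̂(z, ·)` is an unbiased
estimate of `F(z)`. -/
structure Oracle {n r : ℕ} {Ξ : Type*} [MeasurableSpace Ξ] (P : Measure Ξ)
    (φh : Vec (Fin n ⊕ Fin r) → Ξ → ℝ) : Prop where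
  measurable : ∀ z, Measurable (φh z)
  integrable : ∀ z, Integrable (φh z) P
  unbiased : ∀ z, Integrable (fun ξ => opF (fun w => φh w ξ) z) P ∧
    ∫ ξ, opF (fun w => φh w ξ) z ∂P = opF (meanFn P φh) z

/-- The assumptions on the minimax problem, the stepsize matrices and the oracle. -/
structure Assumptions {n r : ℕ} {Ξ : Type*} [MeasurableSpace Ξ] (P : Measure Ξ)
    (f : Vec (Fin n) → EReal) (g : Vec (Fin r) → EReal)
    (φh : Vec (Fin n ⊕ Fin r) → Ξ → ℝ) (c : Constants n r) : Prop where
  theta_nonneg : 0 ≤ c.θ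
  Γ₁_pos : c.Γ₁.PosDef
  Γ₂_pos : c.Γ₂.PosDef
  f_conv : ProperLscConvex f
  g_conv : ProperLscConvex g
  D_pos : c.Dxx.PosDef ∧ c.Dxy.PosDef ∧ c.Dyx.PosDef ∧ c.Dyy.PosDef
  Dh_pos : c.Dhxz.PosDef ∧ c.Dhyz.PosDef ∧ c.Dhyx.PosDef ∧ c.Dhyy.PosDef
  phi_C1 : ContDiff ℝ 1 (meanFn P φh)
  lip_x : ∀ x y x' y',
    wsq c.Γ₁ (gradX (meanFn P φh) (pair x' y') - gradX (meanFn P φh) (pair x y))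
      ≤ c.Lxx ^ 2 * wsq c.Dxx (x' - x) + c.Lxy ^ 2 * wsq c.Dxy (y' - y)
  lip_y : ∀ x y x' y',
    wsq c.Γ₂ (gradY (meanFn P φh) (pair x' y') - c.θ • gradY (meanFn P φh) (pair x' y)
        - (1 - c.θ) • gradY (meanFn P φh) (pair x y))
      ≤ c.Lyx ^ 2 * wsq c.Dyx (x' - x) + c.Lyy ^ 2 * wsq c.Dyy (y' - y)
  stepsize_x : (c.Γ₁⁻¹ - (c.Lxx ^ 2 • c.Dxx + c.Lyx ^ 2 • c.Dyx)).PosDef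
  stepsize_y : (c.Γ₂⁻¹ - (c.Lxy ^ 2 • c.Dxy + c.Lyy ^ 2 • c.Dyy)).PosDef
  variance : ∀ z, ∫⁻ ξ, ENNReal.ofReal
      (wsq c.Γ (opF (fun w => φh w ξ) z - opF (meanFn P φh) z)) ∂P ≤ ENNReal.ofReal (c.σ ^ 2)
  phih_C1 : ∀ ξ, ContDiff ℝ 1 (fun z => φh z ξ)
  mean_lip_x : ∀ z z', ∫⁻ ξ, ENNReal.ofReal
      (wsq c.Γ₁ (gradX (fun w => φh w ξ) z' - gradX (fun w => φh w ξ) z)) ∂P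
      ≤ ENNReal.ofReal (c.Lhxz ^ 2 * wsq c.Dhxz (z' - z))
  mean_lip_y : c.θ ≠ 1 → ∀ z z', ∫⁻ ξ, ENNReal.ofReal
      (wsq c.Γ₂ (gradY (fun w => φh w ξ) z' - gradY (fun w => φh w ξ) z)) ∂P
      ≤ ENNReal.ofReal (c.Lhyz ^ 2 * wsq c.Dhyz (z' - z))
  mean_lip_y' : c.θ ≠ 0 → ∀ v y v' y', ∫⁻ ξ, ENNReal.ofReal
      (wsq c.Γ₂ (gradY (fun w => φh w ξ) (pair v' y') - gradY (fun w => φh w ξ) (pair v y))) ∂P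
      ≤ ENNReal.ofReal (c.Lhyx ^ 2 * wsq c.Dhyx (v' - v) + c.Lhyy ^ 2 * wsq c.Dhyy (y' - y))

/-- One run of NP-PDEG. The samples are `ξ 0 k = ξ_k`, `ξ 1 k = ξ_k'`, `ξ 2 k = ξ̄_k`; the iterates
are indexed by `ℤ` and used from index `-1` on. -/
structure IsRun {n r : ℕ} {Ξ : Type*} (f : Vec (Fin n) → EReal) (g : Vec (Fin r) → EReal)
    (φh : Vec (Fin n ⊕ Fin r) → Ξ → ℝ) (c : Constants n r) (α : ℕ → ℝ) (ξ : Fin 3 → ℕ → Ξ)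
    (x xh xb : ℤ → Vec (Fin n)) (y yh yb : ℤ → Vec (Fin r)) : Prop where
  init_x : x (-1) = x 0
  init_y : y (-1) = y 0
  init_xb : IsProx f c.Γ₁⁻¹ (xh (-1)) (xb (-1))
  step_xh : ∀ k : ℕ, xh k = x k - act c.Γ₁ (gradX (fun w => φh w (ξ 0 k)) (pair (x k) (y k)))
    + (1 - α k) • (xh (k - 1) - x (k - 1)
      + act c.Γ₁ (gradX (fun w => φh w (ξ 0 k)) (pair (x (k - 1)) (y (k - 1)))))
  step_xb : ∀ k : ℕ, IsProx f c.Γ₁⁻¹ (xh k) (xb k)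
  step_yh : ∀ k : ℕ, yh k = y k
    + act c.Γ₂ (c.θ • gradY (fun w => φh w (ξ 1 k)) (pair (xb k) (y k))
      + (1 - c.θ) • gradY (fun w => φh w (ξ 0 k)) (pair (x k) (y k)))
    + (1 - α k) • (yh (k - 1) - y (k - 1)
      - act c.Γ₂ (c.θ • gradY (fun w => φh w (ξ 1 k)) (pair (xb (k - 1)) (y (k - 1)))
        + (1 - c.θ) • gradY (fun w => φh w (ξ 0 k)) (pair (x (k - 1)) (y (k - 1)))))
  step_yb : ∀ k : ℕ, IsProx g c.Γ₂⁻¹ (yh k) (yb k)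
  step_x : ∀ k : ℕ, x (k + 1) = x k + α k •
    (xb k - xh k - act c.Γ₁ (gradX (fun w => φh w (ξ 2 k)) (pair (xb k) (yb k))))
  step_y : ∀ k : ℕ, y (k + 1) = y k + α k •
    (yb k - yh k + act c.Γ₂ (gradY (fun w => φh w (ξ 2 k)) (pair (xb k) (yb k))))

/-- All samples are independent with law `P` and independent of the (possibly random) initial
data `init`, and the random index `κ` is independent of the initial data and the samples. -/
structure Sampling {Ω Ξ I : Type*} [MeasurableSpace Ω] [MeasurableSpace Ξ] [MeasurableSpace I]
    (μ : Measure Ω) (P : Measure Ξ) (ξ : Fin 3 → ℕ → Ω → Ξ) (init : Ω → I) (κ : Ω → ℕ) :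
    Prop where
  measurable_sample : ∀ i k, Measurable (ξ i k)
  measurable_init : Measurable init
  measurable_index : Measurable κ
  law : ∀ i k, μ.map (ξ i k) = P
  iIndep : iIndepFun (fun p : Fin 3 × ℕ => ξ p.1 p.2) μ
  indep_init : IndepFun init (fun ω (p : Fin 3 × ℕ) => ξ p.1 p.2 ω) μ
  indep_index : IndepFun κ (fun ω => (init ω, fun p : Fin 3 × ℕ => ξ p.1 p.2 ω)) μ

end NPPDEG

end

/-!
Write `v^k = Γ⁻¹ ẑ^k - S_{z^k}(z̄^k; z̄^k)` for the residual and
`ε^k = Γ⁻¹ ẑ^k - S_{z^k}(z^k; z̄^k)` for the error of the bias-corrected estimate `ẑ^k`. The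
optimality conditions of the two proximal steps say that `v^k ∈ T z̄^k` (`resid_mem_opT`), so both
bounds reduce to bounding the weighted average of `𝔼 ‖v^k‖_Γ²`; at the random index, independence
turns the expectation into that average (`lintegral_wdist_index_le`).

Up to noise of variance at most `σ_F²`, the update is `z^{k+1} = z^k - α_k Γ v^k`. Expanding
`‖z^{k+1} - z⋆‖²` in the norm of `Γ⁻¹` leaves `⟨v^k, z^k - z⋆⟩`, which splits into
`⟨v^k, z̄^k - z⋆⟩`, bounded by the weak Minty inequality, and `⟨v^k, z^k - z̄^k⟩`. Since
`v^k - ε^k = H_{z^k}(z^k) - H_{z^k}(z̄^k)`, and `Γ⁻¹ - H_{z^k}` satisfies a Lipschitz bound with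
constant `L_M < 1` between `z^k` and `z̄^k`, the second product is bounded below in terms of
`‖v^k‖_Γ²` and `‖ε^k‖_Γ²` (`wsq_step_le`, `meanDist_succ_le`).

The error obeys `ε^k = (1 - α_k) ε^{k-1} + (fresh noise)`. The fresh noise splits into `α_k` times
a centred oracle error and `1 - α_k` times a centred difference of oracle values at consecutive
iterates, which Lipschitz continuity in mean controls by `‖z^k - z^{k-1}‖²` and
`‖x̄^k - x̄^{k-1}‖²`; nonexpansiveness of the proximal map trades the latter for errors and
movements again (`meanErr_le`). The movement is itself `α_k²` times a residual plus noise
(`meanMove_succ_le`). With `c' = ĉ₁ + 2ĉ₂(1 + ĉ₃)` the three recursions combine into the decrease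
of `𝔼 ‖z^k - z⋆‖² + (η/2) 𝔼 ‖ε^{k-1}‖² + 2ηc' 𝔼 ‖z^k - z^{k-1}‖²` (`lyapunov_step`). The two
parts of the fresh noise are separated by Young's inequality with weights `4/3` and `4`; together
with the weight `η/2`, rather than `η`, of the error, this makes the constants fit for every `θ`.

All expectations are taken in `[0, ∞]`, so that no integrability of the iterates is needed. What is
needed is that every iterate is measurable with respect to the initial data and the earlier samples,
in order to integrate out a fresh sample first (`Sampling.lintegral_fresh`). Measurability of `x̄^k`
and `ȳ^k` comes from nonexpansiveness of the proximal maps (`exists_measurable_prox`).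
-/

noncomputable section

namespace NPPDEG

/-! ### Quadratic forms `‖v‖_V²` -/

section WeightedForms

variable {ι : Type} [Fintype ι] [DecidableEq ι]

@[simp] lemma act_add (M : Matrix ι ι ℝ) (u v : Vec ι) : act M (u + v) = act M u + act M v :=
  map_add _ u v

@[simp] lemma act_sub (M : Matrix ι ι ℝ) (u v : Vec ι) : act M (u - v) = act M u - act M v :=
  map_sub _ u v

@[simp] lemma act_neg (M : Matrix ι ι ℝ) (u : Vec ι) : act M (-u) = -act M u := map_neg _ u

@[simp] lemma act_zero (M : Matrix ι ι ℝ) : act M (0 : Vec ι) = 0 := map_zero _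

@[simp] lemma act_smul (M : Matrix ι ι ℝ) (t : ℝ) (u : Vec ι) : act M (t • u) = t • act M u :=
  map_smul _ t u

lemma ofLp_act (M : Matrix ι ι ℝ) (u : Vec ι) : (act M u).ofLp = M.mulVec u.ofLp := rfl

lemma act_mul (M N : Matrix ι ι ℝ) (u : Vec ι) : act (M * N) u = act M (act N u) := by
  apply WithLp.ofLp_injective
  simp [ofLp_act, Matrix.mulVec_mulVec]

lemma act_one (u : Vec ι) : act (1 : Matrix ι ι ℝ) u = u := by
  apply WithLp.ofLp_injective
  simp [ofLp_act]

lemma act_matrix_add (M N : Matrix ι ι ℝ) (u : Vec ι) : act (M + N) u = act M u + act N u := by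
  apply WithLp.ofLp_injective
  simp [ofLp_act, Matrix.add_mulVec]

lemma act_matrix_sub (M N : Matrix ι ι ℝ) (u : Vec ι) : act (M - N) u = act M u - act N u := by
  apply WithLp.ofLp_injective
  simp [ofLp_act, Matrix.sub_mulVec]

lemma act_matrix_smul (t : ℝ) (M : Matrix ι ι ℝ) (u : Vec ι) : act (t • M) u = t • act M u := by
  apply WithLp.ofLp_injective
  simp [ofLp_act, Matrix.smul_mulVec]

lemma continuous_act (M : Matrix ι ι ℝ) : Continuous (act M) :=
  (Matrix.toEuclideanLin M).continuous_of_finiteDimensional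

lemma continuous_wsq (V : Matrix ι ι ℝ) : Continuous (wsq V) :=
  continuous_id.inner (continuous_act V)

@[fun_prop] lemma measurable_act (M : Matrix ι ι ℝ) : Measurable (act M) :=
  (continuous_act M).measurable

@[fun_prop] lemma measurable_wsq (V : Matrix ι ι ℝ) : Measurable (wsq V) :=
  (continuous_wsq V).measurable

lemma act_inv_act {V : Matrix ι ι ℝ} (hV : V.PosDef) (u : Vec ι) : act V⁻¹ (act V u) = u := by
  rw [← act_mul, Matrix.nonsing_inv_mul _ ((Matrix.isUnit_iff_isUnit_det _).1 hV.isUnit), act_one]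

lemma act_act_inv {V : Matrix ι ι ℝ} (hV : V.PosDef) (u : Vec ι) : act V (act V⁻¹ u) = u := by
  rw [← act_mul, Matrix.mul_nonsing_inv _ ((Matrix.isUnit_iff_isUnit_det _).1 hV.isUnit), act_one]

lemma inner_act_left {V : Matrix ι ι ℝ} (hV : V.IsHermitian) (u v : Vec ι) :
    inner ℝ (act V u) v = inner ℝ u (act V v) :=
  (Matrix.isSymmetric_toEuclideanLin_iff.2 hV) u v

lemma inner_act_comm {V : Matrix ι ι ℝ} (hV : V.IsHermitian) (u v : Vec ι) :
    inner ℝ u (act V v) = inner ℝ v (act V u) := by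
  rw [← inner_act_left hV, real_inner_comm]

lemma wsq_eq_dotProduct (V : Matrix ι ι ℝ) (v : Vec ι) :
    wsq V v = star v.ofLp ⬝ᵥ V.mulVec v.ofLp := by
  simp [wsq, EuclideanSpace.inner_eq_star_dotProduct, ofLp_act, dotProduct_comm]

lemma wsq_nonneg {V : Matrix ι ι ℝ} (hV : V.PosSemidef) (v : Vec ι) : 0 ≤ wsq V v := by
  rw [wsq_eq_dotProduct]
  exact (Matrix.posSemidef_iff_dotProduct_mulVec.1 hV).2 _

lemma wsq_pos {V : Matrix ι ι ℝ} (hV : V.PosDef) {v : Vec ι} (hv : v ≠ 0) : 0 < wsq V v := by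
  rw [wsq_eq_dotProduct]
  exact (Matrix.posDef_iff_dotProduct_mulVec.1 hV).2
    (fun h => hv (WithLp.ofLp_injective 2 h))

@[simp] lemma wsq_zero (V : Matrix ι ι ℝ) : wsq V (0 : Vec ι) = 0 := by simp [wsq]

lemma eq_zero_of_wsq_nonpos {V : Matrix ι ι ℝ} (hV : V.PosDef) {v : Vec ι} (h : wsq V v ≤ 0) :
    v = 0 := by
  by_contra hv
  exact absurd (wsq_pos hV hv) (not_lt.2 h)

lemma wsq_smul (V : Matrix ι ι ℝ) (t : ℝ) (v : Vec ι) : wsq V (t • v) = t ^ 2 * wsq V v := by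
  simp only [wsq, act_smul, inner_smul_left, inner_smul_right]
  simp only [conj_trivial]
  ring

@[simp] lemma wsq_neg (V : Matrix ι ι ℝ) (v : Vec ι) : wsq V (-v) = wsq V v := by
  simp [wsq]

lemma wsq_sub_comm (V : Matrix ι ι ℝ) (u v : Vec ι) : wsq V (u - v) = wsq V (v - u) := by
  rw [← wsq_neg, neg_sub]

lemma wsq_add {V : Matrix ι ι ℝ} (hV : V.IsHermitian) (u v : Vec ι) :
    wsq V (u + v) = wsq V u + 2 * inner ℝ u (act V v) + wsq V v := by
  simp only [wsq, act_add, inner_add_left, inner_add_right]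
  rw [inner_act_comm hV v u]
  ring

lemma wsq_sub {V : Matrix ι ι ℝ} (hV : V.IsHermitian) (u v : Vec ι) :
    wsq V (u - v) = wsq V u - 2 * inner ℝ u (act V v) + wsq V v := by
  rw [sub_eq_add_neg, wsq_add hV, wsq_neg, act_neg, inner_neg_right]
  ring

lemma wsq_matrix_add (A B : Matrix ι ι ℝ) (v : Vec ι) : wsq (A + B) v = wsq A v + wsq B v := by
  simp [wsq, act_matrix_add, inner_add_right]

lemma wsq_matrix_sub (A B : Matrix ι ι ℝ) (v : Vec ι) : wsq (A - B) v = wsq A v - wsq B v := by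
  simp [wsq, act_matrix_sub, inner_sub_right]

lemma wsq_matrix_smul (t : ℝ) (A : Matrix ι ι ℝ) (v : Vec ι) : wsq (t • A) v = t * wsq A v := by
  simp [wsq, act_matrix_smul, inner_smul_right]

lemma wsq_inv_act {V : Matrix ι ι ℝ} (hV : V.PosDef) (v : Vec ι) :
    wsq V⁻¹ (act V v) = wsq V v := by
  rw [wsq, act_inv_act hV, inner_act_left hV.1, wsq]

lemma wsq_act_inv {V : Matrix ι ι ℝ} (hV : V.PosDef) (v : Vec ι) :
    wsq V (act V⁻¹ v) = wsq V⁻¹ v := by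
  rw [wsq, act_act_inv hV, inner_act_left hV.inv.1, wsq]

/-- Young's inequality `2⟨u, V v⟩ ≤ t ‖u‖_V² + t⁻¹ ‖v‖_V²`. -/
lemma two_inner_act_le {V : Matrix ι ι ℝ} (hV : V.PosSemidef) (u v : Vec ι) {t : ℝ} (ht : 0 < t) :
    2 * inner ℝ u (act V v) ≤ t * wsq V u + 1 / t * wsq V v := by
  have h := wsq_nonneg hV (t • u - v)
  rw [wsq_sub hV.1, wsq_smul, inner_smul_left] at h
  simp only [conj_trivial] at h
  have h2 : 0 ≤ (1 / t) * (t ^ 2 * wsq V u - 2 * (t * inner ℝ u (act V v)) + wsq V v) :=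
    mul_nonneg (by positivity) h
  have h3 : (1 / t) * (t ^ 2 * wsq V u - 2 * (t * inner ℝ u (act V v)) + wsq V v)
      = t * wsq V u - 2 * inner ℝ u (act V v) + 1 / t * wsq V v := by
    field_simp
  linarith

lemma wsq_add_le {V : Matrix ι ι ℝ} (hV : V.PosSemidef) (u v : Vec ι) {t : ℝ} (ht : 0 < t) :
    wsq V (u + v) ≤ (1 + t) * wsq V u + (1 + 1 / t) * wsq V v := by
  rw [wsq_add hV.1]
  linarith [two_inner_act_le hV u v ht]

/-! ### Spectral bounds -/

lemma wsq_eq_sum_eigenvalues {A : Matrix ι ι ℝ} (hA : A.IsHermitian) (v : Vec ι) :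
    wsq A v = ∑ i, hA.eigenvalues i * (inner ℝ (hA.eigenvectorBasis i) v) ^ 2 := by
  have key : ∀ i, inner ℝ (hA.eigenvectorBasis i) (act A v)
      = hA.eigenvalues i * inner ℝ (hA.eigenvectorBasis i) v := by
    intro i
    have : act A (hA.eigenvectorBasis i) = hA.eigenvalues i • hA.eigenvectorBasis i := by
      apply WithLp.ofLp_injective
      rw [ofLp_act, hA.mulVec_eigenvectorBasis]
      rfl
    rw [← inner_act_left hA, this, inner_smul_left]
    simp
  rw [wsq, ← hA.eigenvectorBasis.sum_inner_mul_inner v (act A v)]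
  refine Finset.sum_congr rfl fun i _ => ?_
  rw [key, real_inner_comm]
  ring

lemma norm_sq_eq_sum_eigenvectorBasis {A : Matrix ι ι ℝ} (hA : A.IsHermitian) (v : Vec ι) :
    ‖v‖ ^ 2 = ∑ i, (inner ℝ (hA.eigenvectorBasis i) v) ^ 2 := by
  rw [← real_inner_self_eq_norm_sq, ← hA.eigenvectorBasis.sum_inner_mul_inner v v]
  refine Finset.sum_congr rfl fun i _ => ?_
  rw [real_inner_comm]
  ring

lemma wsq_le_of_eigenvalues_le {A : Matrix ι ι ℝ} (hA : A.IsHermitian) {t : ℝ}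
    (h : ∀ i, hA.eigenvalues i ≤ t) (v : Vec ι) : wsq A v ≤ t * ‖v‖ ^ 2 := by
  rw [wsq_eq_sum_eigenvalues hA, norm_sq_eq_sum_eigenvectorBasis hA, Finset.mul_sum]
  exact Finset.sum_le_sum fun i _ => mul_le_mul_of_nonneg_right (h i) (sq_nonneg _)

lemma le_wsq_of_le_eigenvalues {A : Matrix ι ι ℝ} (hA : A.IsHermitian) {t : ℝ}
    (h : ∀ i, t ≤ hA.eigenvalues i) (v : Vec ι) : t * ‖v‖ ^ 2 ≤ wsq A v := by
  rw [wsq_eq_sum_eigenvalues hA, norm_sq_eq_sum_eigenvectorBasis hA, Finset.mul_sum]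
  exact Finset.sum_le_sum fun i _ => mul_le_mul_of_nonneg_right (h i) (sq_nonneg _)

lemma exists_pos_mul_norm_sq_le_wsq {A : Matrix ι ι ℝ} (hA : A.PosDef) :
    ∃ t : ℝ, 0 < t ∧ ∀ v : Vec ι, t * ‖v‖ ^ 2 ≤ wsq A v := by
  rcases isEmpty_or_nonempty ι with h | h
  · exact ⟨1, one_pos, fun v => by simp [Subsingleton.elim v 0]⟩
  · obtain ⟨i, hi⟩ := Finite.exists_min hA.1.eigenvalues
    exact ⟨_, hA.eigenvalues_pos i, le_wsq_of_le_eigenvalues hA.1 hi⟩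

lemma exists_pos_wsq_le_mul_norm_sq {A : Matrix ι ι ℝ} (hA : A.IsHermitian) :
    ∃ t : ℝ, 0 < t ∧ ∀ v : Vec ι, wsq A v ≤ t * ‖v‖ ^ 2 := by
  rcases isEmpty_or_nonempty ι with h | h
  · exact ⟨1, one_pos, fun v => by simp [Subsingleton.elim v 0]⟩
  · obtain ⟨i, hi⟩ := Finite.exists_max hA.eigenvalues
    refine ⟨max (hA.eigenvalues i) 1, by positivity, fun v => ?_⟩
    exact wsq_le_of_eigenvalues_le hA (fun j => (hi j).trans (le_max_left _ _)) v

lemma specNorm_nonneg (M : Matrix ι ι ℝ) : 0 ≤ specNorm M := norm_nonneg _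

/-- `D ⪯ ‖Γ D‖ Γ⁻¹`: with `Γ = Bᵀ B`, the eigenvalues of the symmetric matrix `B D Bᵀ` are
eigenvalues of `Γ D`, hence bounded by its spectral norm. -/
lemma wsq_le_specNorm_mul {G D : Matrix ι ι ℝ} (hG : G.PosDef) (hD : D.IsHermitian) (u : Vec ι) :
    wsq D u ≤ specNorm (G * D) * wsq G⁻¹ u := by
  obtain ⟨B, hB⟩ : ∃ B : Matrix ι ι ℝ, G = B.conjTranspose * B := by
    open scoped MatrixOrder in
    exact CStarAlgebra.nonneg_iff_eq_star_mul_self.1 hG.posSemidef.nonneg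
  have hu : IsUnit (B.conjTranspose * B) := hB ▸ hG.isUnit
  have hdet : IsUnit B.conjTranspose.det := by
    have := (Matrix.isUnit_iff_isUnit_det _).1 hu
    rw [Matrix.det_mul] at this
    exact isUnit_of_mul_isUnit_left this
  set Bt := B.conjTranspose with hBt
  have hA : (B * D * Bt).IsHermitian := Matrix.isHermitian_mul_mul_conjTranspose B hD
  have adj : ∀ p q : Vec ι, inner ℝ (act Bt p) q = inner ℝ p (act B q) := by
    intro p q
    simp only [EuclideanSpace.inner_eq_star_dotProduct, ofLp_act, hBt, star_trivial,
      Matrix.conjTranspose_eq_transpose_of_trivial]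
    rw [dotProduct_comm, Matrix.mulVec_transpose, ← Matrix.dotProduct_mulVec, dotProduct_comm]
  have hGact : ∀ p, act G p = act Bt (act B p) := fun p => by rw [hB, act_mul]
  have hBinv : ∀ q, act Bt⁻¹ (act Bt q) = q := fun q => by
    rw [← act_mul, Matrix.nonsing_inv_mul _ hdet, act_one]
  -- `Bᵀ` maps an eigenvector `p` of `B D Bᵀ` to an eigenvector of `Γ D` for the same eigenvalue
  have hev : ∀ i, hA.eigenvalues i ≤ specNorm (G * D) := by
    intro i
    set p := hA.eigenvectorBasis i with hp
    have h1 : act (B * D * Bt) p = hA.eigenvalues i • p := by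
      apply WithLp.ofLp_injective
      rw [ofLp_act, hA.mulVec_eigenvectorBasis]
      rfl
    have hne : act Bt p ≠ 0 := by
      intro h0
      have := hBinv p
      rw [h0, act_zero] at this
      have hn : ‖p‖ = 1 := hA.eigenvectorBasis.orthonormal.1 i
      rw [← this, norm_zero] at hn
      exact zero_ne_one hn
    have h2 : act (G * D) (act Bt p) = hA.eigenvalues i • act Bt p := by
      rw [act_mul, hGact, ← act_smul, ← h1, act_mul, act_mul]
    have h3 : ‖act (G * D) (act Bt p)‖ ≤ specNorm (G * D) * ‖act Bt p‖ :=
      (Matrix.toEuclideanCLM (𝕜 := ℝ) (G * D)).le_opNorm (act Bt p)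
    rw [h2, norm_smul] at h3
    exact (le_abs_self _).trans (le_of_mul_le_mul_right h3 (norm_pos_iff.2 hne))
  set p := act Bt⁻¹ u with hpdef
  have hup : u = act Bt p := by
    rw [hpdef, ← act_mul, Matrix.mul_nonsing_inv _ hdet, act_one]
  have e1 : wsq D u = wsq (B * D * Bt) p := by
    rw [wsq, hup, adj, wsq, act_mul, act_mul]
  have e2 : wsq G⁻¹ u = ‖p‖ ^ 2 := by
    have hGi : act G (act G⁻¹ u) = u := act_act_inv hG u
    have : act Bt (act B (act G⁻¹ u)) = act Bt p := by rw [← hGact, hGi, hup]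
    have h5 : act B (act G⁻¹ u) = p := by
      have := congrArg (act Bt⁻¹) this
      rwa [hBinv, hBinv] at this
    rw [wsq]
    nth_rewrite 1 [hup]
    rw [adj, h5, real_inner_self_eq_norm_sq]
  rw [e1, e2]
  exact wsq_le_of_eigenvalues_le hA hev p

lemma exists_pos_smul_wsq_le {A B : Matrix ι ι ℝ} (hA : A.PosDef) (hB : B.IsHermitian) :
    ∃ t : ℝ, 0 < t ∧ ∀ v : Vec ι, t * wsq B v ≤ wsq A v := by
  obtain ⟨a, ha, hA'⟩ := exists_pos_mul_norm_sq_le_wsq hA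
  obtain ⟨b, hb, hB'⟩ := exists_pos_wsq_le_mul_norm_sq hB
  refine ⟨a / b, by positivity, fun v => ?_⟩
  calc a / b * wsq B v ≤ a / b * (b * ‖v‖ ^ 2) :=
        mul_le_mul_of_nonneg_left (hB' v) (by positivity)
    _ = a * ‖v‖ ^ 2 := by field_simp
    _ ≤ _ := hA' v

lemma posSemidef_of_wsq_nonneg {A : Matrix ι ι ℝ} (hA : A.IsHermitian)
    (h : ∀ v : Vec ι, 0 ≤ wsq A v) : A.PosSemidef := by
  refine Matrix.posSemidef_iff_dotProduct_mulVec.2 ⟨hA, fun x => ?_⟩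
  have := h (WithLp.toLp 2 x)
  rwa [wsq_eq_dotProduct] at this

/-- If `u = w + m` with `‖m‖_V ≤ L ‖u‖_V` and `L < 1`, then `(1 - L) ‖u‖_V ≤ ‖w‖_V`. -/
lemma sq_mul_wsq_le_of_contraction {V : Matrix ι ι ℝ} (hV : V.PosDef) {L : ℝ} (hL : 0 ≤ L)
    (hL1 : L < 1) (w m : Vec ι) (h : wsq V m ≤ L ^ 2 * wsq V (w + m)) :
    (1 - L) ^ 2 * wsq V (w + m) ≤ wsq V w := by
  rcases hL.eq_or_lt with h0 | h0
  · rw [← h0] at h ⊢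
    have : m = 0 := eq_zero_of_wsq_nonpos hV (by simpa using h)
    simp [this]
  · have hpos : 0 < 1 - L := by linarith
    have hy := wsq_add_le hV.posSemidef w m (t := L / (1 - L)) (by positivity)
    have e1 : 1 + L / (1 - L) = 1 / (1 - L) := by field_simp; ring
    have e2 : 1 + 1 / (L / (1 - L)) = 1 / L := by field_simp; ring
    rw [e1, e2] at hy
    have h3 : 1 / L * wsq V m ≤ L * wsq V (w + m) := by
      calc 1 / L * wsq V m ≤ 1 / L * (L ^ 2 * wsq V (w + m)) :=
            mul_le_mul_of_nonneg_left h (by positivity)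
        _ = L * wsq V (w + m) := by field_simp
    have h4 : (1 - L) * wsq V (w + m) ≤ 1 / (1 - L) * wsq V w := by linarith
    calc (1 - L) ^ 2 * wsq V (w + m) = (1 - L) * ((1 - L) * wsq V (w + m)) := by ring
      _ ≤ (1 - L) * (1 / (1 - L) * wsq V w) := mul_le_mul_of_nonneg_left h4 hpos.le
      _ = wsq V w := by field_simp

end WeightedForms

/-! ### Pairs and block-diagonal weights -/

section PairLemmas

variable {n r : ℕ}

@[simp] lemma fstV_pair (a : Vec (Fin n)) (b : Vec (Fin r)) : fstV (pair a b) = a := rfl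

@[simp] lemma sndV_pair (a : Vec (Fin n)) (b : Vec (Fin r)) : sndV (pair a b) = b := rfl

@[simp] lemma pair_fstV_sndV (z : Vec (Fin n ⊕ Fin r)) : pair (fstV z) (sndV z) = z := by
  ext i
  cases i <;> rfl

lemma pair_add (a a' : Vec (Fin n)) (b b' : Vec (Fin r)) :
    pair a b + pair a' b' = pair (a + a') (b + b') := by
  ext i
  cases i <;> rfl

lemma pair_sub (a a' : Vec (Fin n)) (b b' : Vec (Fin r)) :
    pair a b - pair a' b' = pair (a - a') (b - b') := by
  ext i
  cases i <;> rfl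

lemma smul_pair (t : ℝ) (a : Vec (Fin n)) (b : Vec (Fin r)) :
    t • pair a b = pair (t • a) (t • b) := by
  ext i
  cases i <;> rfl

lemma inner_pair (a a' : Vec (Fin n)) (b b' : Vec (Fin r)) :
    inner ℝ (pair a b) (pair a' b') = inner ℝ a a' + inner ℝ b b' := by
  simp [PiLp.inner_apply, pair, Fintype.sum_sum_type]

/-- The projection `(x, y) ↦ x` as a continuous linear map. -/
def fstCLM : Vec (Fin n ⊕ Fin r) →L[ℝ] Vec (Fin n) :=
  LinearMap.toContinuousLinearMap
    { toFun := fstV, map_add' := fun _ _ => rfl, map_smul' := fun _ _ => rfl }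

/-- The projection `(x, y) ↦ y` as a continuous linear map. -/
def sndCLM : Vec (Fin n ⊕ Fin r) →L[ℝ] Vec (Fin r) :=
  LinearMap.toContinuousLinearMap
    { toFun := sndV, map_add' := fun _ _ => rfl, map_smul' := fun _ _ => rfl }

/-- The inclusion `x ↦ (x, 0)` as a continuous linear map. -/
def inlCLM : Vec (Fin n) →L[ℝ] Vec (Fin n ⊕ Fin r) :=
  LinearMap.toContinuousLinearMap
    { toFun := fun x => pair x 0
      map_add' := fun _ _ => by rw [pair_add, add_zero]
      map_smul' := fun _ _ => by simp [smul_pair] }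

/-- The inclusion `y ↦ (0, y)` as a continuous linear map. -/
def inrCLM : Vec (Fin r) →L[ℝ] Vec (Fin n ⊕ Fin r) :=
  LinearMap.toContinuousLinearMap
    { toFun := fun y => pair 0 y
      map_add' := fun _ _ => by rw [pair_add, add_zero]
      map_smul' := fun _ _ => by simp [smul_pair] }

lemma sndCLM_apply (z : Vec (Fin n ⊕ Fin r)) : sndCLM z = sndV z := rfl

lemma inlCLM_apply (x : Vec (Fin n)) : (inlCLM x : Vec (Fin n ⊕ Fin r)) = pair x 0 := rfl

lemma inrCLM_apply (y : Vec (Fin r)) : (inrCLM y : Vec (Fin n ⊕ Fin r)) = pair 0 y := rfl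

lemma pair_eq_inl_add_inr (a : Vec (Fin n)) (b : Vec (Fin r)) :
    pair a b = inlCLM a + inrCLM b := by
  simp [inlCLM_apply, inrCLM_apply, pair_add]

lemma continuous_pair : Continuous (fun p : Vec (Fin n) × Vec (Fin r) => pair p.1 p.2) := by
  simp only [pair_eq_inl_add_inr]
  fun_prop

@[fun_prop] lemma _root_.Measurable.vecPair {Ω : Type*} {_ : MeasurableSpace Ω}
    {u : Ω → Vec (Fin n)} {v : Ω → Vec (Fin r)} (hu : Measurable u) (hv : Measurable v) :
    Measurable (fun ω => pair (u ω) (v ω)) :=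
  continuous_pair.measurable.comp (hu.prodMk hv)

@[fun_prop] lemma measurable_fstV : Measurable (fstV : Vec (Fin n ⊕ Fin r) → Vec (Fin n)) :=
  fstCLM.continuous.measurable

@[fun_prop] lemma measurable_sndV : Measurable (sndV : Vec (Fin n ⊕ Fin r) → Vec (Fin r)) :=
  sndCLM.continuous.measurable

lemma act_blockDiag (A : Matrix (Fin n) (Fin n) ℝ) (B : Matrix (Fin r) (Fin r) ℝ)
    (a : Vec (Fin n)) (b : Vec (Fin r)) :
    act (Matrix.fromBlocks A 0 0 B) (pair a b) = pair (act A a) (act B b) := by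
  apply WithLp.ofLp_injective
  rw [ofLp_act, pair, Matrix.fromBlocks_mulVec]
  funext i
  cases i <;> simp [pair, ofLp_act, Function.comp_def]

lemma wsq_blockDiag (A : Matrix (Fin n) (Fin n) ℝ) (B : Matrix (Fin r) (Fin r) ℝ)
    (a : Vec (Fin n)) (b : Vec (Fin r)) :
    wsq (Matrix.fromBlocks A 0 0 B) (pair a b) = wsq A a + wsq B b := by
  rw [wsq, act_blockDiag, inner_pair, wsq, wsq]

end PairLemmas

namespace Constants

variable {n r : ℕ} {c : Constants n r}

lemma Γ_posDef (h₁ : c.Γ₁.PosDef) (h₂ : c.Γ₂.PosDef) : c.Γ.PosDef := by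
  refine Matrix.posDef_iff_dotProduct_mulVec.2
    ⟨Matrix.IsHermitian.fromBlocks h₁.1 (by simp) h₂.1, fun v hv => ?_⟩
  set z : Vec (Fin n ⊕ Fin r) := WithLp.toLp 2 v with hz
  have hz0 : z ≠ 0 := fun h => hv ((WithLp.toLp_eq_zero 2).1 h)
  have e : star v ⬝ᵥ c.Γ.mulVec v = wsq c.Γ z := (wsq_eq_dotProduct c.Γ z).symm
  rw [e, ← pair_fstV_sndV z, Γ, wsq_blockDiag]
  have n1 := wsq_nonneg h₁.posSemidef (fstV z)
  have n2 := wsq_nonneg h₂.posSemidef (sndV z)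
  by_cases h : fstV z = 0
  · have h' : sndV z ≠ 0 := by
      intro h'
      apply hz0
      rw [← pair_fstV_sndV z, h, h']
      ext i
      cases i <;> rfl
    linarith [wsq_pos h₂ h']
  · linarith [wsq_pos h₁ h]

lemma Γ_inv (h₁ : c.Γ₁.PosDef) (h₂ : c.Γ₂.PosDef) :
    c.Γ⁻¹ = Matrix.fromBlocks c.Γ₁⁻¹ 0 0 c.Γ₂⁻¹ := by
  apply Matrix.inv_eq_right_inv
  rw [Γ, Matrix.fromBlocks_multiply,
    Matrix.mul_nonsing_inv _ ((Matrix.isUnit_iff_isUnit_det _).1 h₁.isUnit),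
    Matrix.mul_nonsing_inv _ ((Matrix.isUnit_iff_isUnit_det _).1 h₂.isUnit)]
  simp [Matrix.fromBlocks_one]

lemma act_Γ_pair (a : Vec (Fin n)) (b : Vec (Fin r)) :
    act c.Γ (pair a b) = pair (act c.Γ₁ a) (act c.Γ₂ b) := act_blockDiag _ _ _ _

lemma wsq_Γ_pair (a : Vec (Fin n)) (b : Vec (Fin r)) :
    wsq c.Γ (pair a b) = wsq c.Γ₁ a + wsq c.Γ₂ b := wsq_blockDiag _ _ _ _

lemma act_Γ_inv_pair (h₁ : c.Γ₁.PosDef) (h₂ : c.Γ₂.PosDef) (a : Vec (Fin n)) (b : Vec (Fin r)) :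
    act c.Γ⁻¹ (pair a b) = pair (act c.Γ₁⁻¹ a) (act c.Γ₂⁻¹ b) := by
  rw [Γ_inv h₁ h₂, act_blockDiag]

lemma wsq_Γ_inv_pair (h₁ : c.Γ₁.PosDef) (h₂ : c.Γ₂.PosDef) (a : Vec (Fin n)) (b : Vec (Fin r)) :
    wsq c.Γ⁻¹ (pair a b) = wsq c.Γ₁⁻¹ a + wsq c.Γ₂⁻¹ b := by
  rw [Γ_inv h₁ h₂, wsq_blockDiag]

lemma c1_nonneg : 0 ≤ c.c1 := by
  have := specNorm_nonneg (c.Γ * c.Dhxz)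
  have := specNorm_nonneg (c.Γ * c.Dhyz)
  have := specNorm_nonneg (c.Γ₂ * c.Dhyy)
  rw [c1]
  positivity

lemma c2_nonneg : 0 ≤ c.c2 := by
  have := specNorm_nonneg (c.Γ₁ * c.Dhyx)
  rw [c2]
  positivity

lemma c3_nonneg : 0 ≤ c.c3 := by
  have := specNorm_nonneg (c.Γ * c.Dhxz)
  rw [c3]
  positivity

lemma Theta_nonneg : 0 ≤ c.Theta := by
  rw [Theta]
  positivity

/-- `ρ ‖v‖² ≥ (ρ / γ̄) ‖v‖_Γ²`, for either sign of `ρ`. -/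
lemma div_gbar_mul_wsq_le (hΓ : c.Γ.PosDef) (ρ : ℝ) (v : Vec (Fin n ⊕ Fin r)) :
    ρ / c.gbar ρ * wsq c.Γ v ≤ ρ * ‖v‖ ^ 2 := by
  rcases isEmpty_or_nonempty (Fin n ⊕ Fin r) with h | h
  · simp [Subsingleton.elim v 0]
  · obtain ⟨i, hi⟩ := Finite.exists_min hΓ.1.eigenvalues
    obtain ⟨j, hj⟩ := Finite.exists_max hΓ.1.eigenvalues
    have hspec := hΓ.1.spectrum_real_eq_range_eigenvalues
    rcases le_or_gt ρ 0 with hρ | hρ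
    · have hg : c.gbar ρ = hΓ.1.eigenvalues i := by
        rw [gbar, if_pos hρ, hspec]
        exact IsLeast.csInf_eq ⟨⟨i, rfl⟩, by rintro _ ⟨k, rfl⟩; exact hi k⟩
      have hpos := hΓ.eigenvalues_pos i
      have h1 := le_wsq_of_le_eigenvalues hΓ.1 hi v
      rw [hg]
      calc ρ / hΓ.1.eigenvalues i * wsq c.Γ v
          ≤ ρ / hΓ.1.eigenvalues i * (hΓ.1.eigenvalues i * ‖v‖ ^ 2) :=
            mul_le_mul_of_nonpos_left h1 (div_nonpos_of_nonpos_of_nonneg hρ hpos.le)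
        _ = ρ * ‖v‖ ^ 2 := by field_simp
    · have hg : c.gbar ρ = hΓ.1.eigenvalues j := by
        rw [gbar, if_neg (not_le.2 hρ), hspec]
        exact IsGreatest.csSup_eq ⟨⟨j, rfl⟩, by rintro _ ⟨k, rfl⟩; exact hj k⟩
      have hpos := hΓ.eigenvalues_pos j
      have h1 := wsq_le_of_eigenvalues_le hΓ.1 hj v
      rw [hg]
      calc ρ / hΓ.1.eigenvalues j * wsq c.Γ v
          ≤ ρ / hΓ.1.eigenvalues j * (hΓ.1.eigenvalues j * ‖v‖ ^ 2) :=
            mul_le_mul_of_nonneg_left h1 (div_nonneg hρ.le hpos.le)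
        _ = ρ * ‖v‖ ^ 2 := by field_simp

lemma exists_lt_one_posSemidef {m : ℕ} {V E : Matrix (Fin m) (Fin m) ℝ} (hV : V.PosDef)
    (hE : E.IsHermitian) (h : (V - E).PosDef) :
    ∃ s : ℝ, s < 1 ∧ ∀ t, s ≤ t → (t • V - E).PosSemidef := by
  obtain ⟨d, hd, hd'⟩ := exists_pos_smul_wsq_le h hV.1
  refine ⟨1 - d, by linarith, fun t ht => posSemidef_of_wsq_nonneg ?_ fun v => ?_⟩
  · exact (hV.1.smul (by simp [IsSelfAdjoint])).sub hE
  · have h1 := hd' v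
    have h2 := wsq_nonneg hV.posSemidef v
    rw [wsq_matrix_sub] at h1
    rw [wsq_matrix_sub, wsq_matrix_smul]
    nlinarith

/-- The set of numbers `t` in the definition of `L_M²`. -/
def lmSet (c : Constants n r) : Set ℝ := {t : ℝ | 0 ≤ t ∧
  (t • c.Γ₁⁻¹ - (c.Lxx ^ 2 • c.Dxx + c.Lyx ^ 2 • c.Dyx)).PosSemidef ∧
  (t • c.Γ₂⁻¹ - (c.Lxy ^ 2 • c.Dxy + c.Lyy ^ 2 • c.Dyy)).PosSemidef}

lemma isHermitian_sq_smul_add {m : ℕ} {A B : Matrix (Fin m) (Fin m) ℝ} (hA : A.IsHermitian)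
    (hB : B.IsHermitian) (s t : ℝ) : (s ^ 2 • A + t ^ 2 • B).IsHermitian :=
  (hA.smul (by simp [IsSelfAdjoint])).add (hB.smul (by simp [IsSelfAdjoint]))

/-- The strict stepsize conditions give an admissible `t < 1` in the definition of `L_M²`. -/
lemma exists_mem_lmSet_lt_one (h₁ : c.Γ₁.PosDef) (h₂ : c.Γ₂.PosDef)
    (hD : c.Dxx.PosDef ∧ c.Dxy.PosDef ∧ c.Dyx.PosDef ∧ c.Dyy.PosDef)
    (hx : (c.Γ₁⁻¹ - (c.Lxx ^ 2 • c.Dxx + c.Lyx ^ 2 • c.Dyx)).PosDef)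
    (hy : (c.Γ₂⁻¹ - (c.Lxy ^ 2 • c.Dxy + c.Lyy ^ 2 • c.Dyy)).PosDef) :
    ∃ t ∈ c.lmSet, t < 1 := by
  obtain ⟨s, hs, hs'⟩ := exists_lt_one_posSemidef h₁.inv
    (isHermitian_sq_smul_add hD.1.1 hD.2.2.1.1 _ _) hx
  obtain ⟨t, ht, ht'⟩ := exists_lt_one_posSemidef h₂.inv
    (isHermitian_sq_smul_add hD.2.1.1 hD.2.2.2.1 _ _) hy
  refine ⟨max 0 (max s t), ⟨le_max_left _ _, hs' _ ?_, ht' _ ?_⟩, ?_⟩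
  · exact (le_max_left _ _).trans (le_max_right _ _)
  · exact (le_max_right _ _).trans (le_max_right _ _)
  · exact max_lt one_pos (max_lt hs ht)

lemma LMsq_nonneg : 0 ≤ c.LMsq := Real.sInf_nonneg fun _ ht => ht.1

lemma LM_nonneg : 0 ≤ c.LM := Real.sqrt_nonneg _

lemma LM_sq : c.LM ^ 2 = c.LMsq := Real.sq_sqrt LMsq_nonneg

lemma LM_lt_one (h : ∃ t ∈ c.lmSet, t < 1) : c.LM < 1 := by
  obtain ⟨t, ht, ht1⟩ := h
  have hb : BddBelow c.lmSet := ⟨0, fun _ hs => hs.1⟩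
  rw [LM, Real.sqrt_lt' one_pos, one_pow]
  exact (csInf_le hb ht).trans_lt ht1

lemma le_LMsq_mul {e w : ℝ} (hne : c.lmSet.Nonempty) (hw : 0 ≤ w)
    (h : ∀ t ∈ c.lmSet, e ≤ t * w) : e ≤ c.LMsq * w := by
  rcases hw.eq_or_lt with h0 | h0
  · obtain ⟨t, ht⟩ := hne
    simpa [← h0] using h t ht
  · rw [← div_le_iff₀ h0]
    exact le_csInf hne fun t ht => (div_le_iff₀ h0).2 (h t ht)

lemma stepsize_wsq_le (h₁ : c.Γ₁.PosDef) (hne : c.lmSet.Nonempty) (a : Vec (Fin n)) :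
    c.Lxx ^ 2 * wsq c.Dxx a + c.Lyx ^ 2 * wsq c.Dyx a ≤ c.LM ^ 2 * wsq c.Γ₁⁻¹ a := by
  rw [LM_sq]
  refine le_LMsq_mul hne (wsq_nonneg h₁.inv.posSemidef a) fun t ht => ?_
  have := wsq_nonneg ht.2.1 a
  simp only [wsq_matrix_sub, wsq_matrix_smul, wsq_matrix_add] at this
  linarith

lemma stepsize_wsq_le' (h₂ : c.Γ₂.PosDef) (hne : c.lmSet.Nonempty) (b : Vec (Fin r)) :
    c.Lxy ^ 2 * wsq c.Dxy b + c.Lyy ^ 2 * wsq c.Dyy b ≤ c.LM ^ 2 * wsq c.Γ₂⁻¹ b := by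
  rw [LM_sq]
  refine le_LMsq_mul hne (wsq_nonneg h₂.inv.posSemidef b) fun t ht => ?_
  have := wsq_nonneg ht.2.2 b
  simp only [wsq_matrix_sub, wsq_matrix_smul, wsq_matrix_add] at this
  linarith

end Constants

/-! ### Partial gradients: regularity, measurability and means -/

section Gradients

variable {n r : ℕ}

lemma gradX_eq_fstV_gradient {φ : Vec (Fin n ⊕ Fin r) → ℝ} {z : Vec (Fin n ⊕ Fin r)}
    (h : DifferentiableAt ℝ φ z) : gradX φ z = fstV (gradient φ z) := by
  have hz : fstV z = fstV z := rfl
  have h1 : HasFDerivAt (fun x : Vec (Fin n) => pair x (sndV z)) (inlCLM) (fstV z) := by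
    simp only [pair_eq_inl_add_inr]
    exact (ContinuousLinearMap.hasFDerivAt _).add_const _
  have h2 : HasFDerivAt φ (fderiv ℝ φ z) (pair (fstV z) (sndV z)) := by
    rw [pair_fstV_sndV]
    exact h.hasFDerivAt
  have h3 := (h2.comp (fstV z) h1).fderiv
  refine ext_inner_right ℝ fun v => ?_
  rw [gradX, ← InnerProductSpace.toDual_apply_apply, toDual_gradient]
  have e : inner ℝ (fstV (gradient φ z)) v = inner ℝ (gradient φ z) (pair v 0) := by
    rw [← pair_fstV_sndV (gradient φ z), inner_pair]
    simp
  rw [e, ← InnerProductSpace.toDual_apply_apply, toDual_gradient]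
  exact DFunLike.congr_fun h3 v

lemma gradY_eq_sndV_gradient {φ : Vec (Fin n ⊕ Fin r) → ℝ} {z : Vec (Fin n ⊕ Fin r)}
    (h : DifferentiableAt ℝ φ z) : gradY φ z = sndV (gradient φ z) := by
  have h1 : HasFDerivAt (fun y : Vec (Fin r) => pair (fstV z) y) (inrCLM) (sndV z) := by
    simp only [pair_eq_inl_add_inr]
    exact (ContinuousLinearMap.hasFDerivAt _).const_add _
  have h2 : HasFDerivAt φ (fderiv ℝ φ z) (pair (fstV z) (sndV z)) := by
    rw [pair_fstV_sndV]
    exact h.hasFDerivAt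
  have h3 := (h2.comp (sndV z) h1).fderiv
  refine ext_inner_right ℝ fun v => ?_
  rw [gradY, ← InnerProductSpace.toDual_apply_apply, toDual_gradient]
  have e : inner ℝ (sndV (gradient φ z)) v = inner ℝ (gradient φ z) (pair 0 v) := by
    rw [← pair_fstV_sndV (gradient φ z), inner_pair]
    simp
  rw [e, ← InnerProductSpace.toDual_apply_apply, toDual_gradient]
  exact DFunLike.congr_fun h3 v

lemma continuous_gradient {φ : Vec (Fin n ⊕ Fin r) → ℝ} (h : ContDiff ℝ 1 φ) :
    Continuous (gradient φ) :=
  (InnerProductSpace.toDual ℝ _).symm.continuous.comp (h.continuous_fderiv one_ne_zero)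

lemma continuous_gradX {φ : Vec (Fin n ⊕ Fin r) → ℝ} (h : ContDiff ℝ 1 φ) :
    Continuous (gradX φ) := by
  have : gradX φ = fun z => fstCLM (gradient φ z) :=
    funext fun z => gradX_eq_fstV_gradient (h.differentiable one_ne_zero z)
  rw [this]
  exact fstCLM.continuous.comp (continuous_gradient h)

lemma continuous_gradY {φ : Vec (Fin n ⊕ Fin r) → ℝ} (h : ContDiff ℝ 1 φ) :
    Continuous (gradY φ) := by
  have : gradY φ = fun z => sndCLM (gradient φ z) :=
    funext fun z => gradY_eq_sndV_gradient (h.differentiable one_ne_zero z)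
  rw [this]
  exact sndCLM.continuous.comp (continuous_gradient h)

variable {Ξ : Type*} [MeasurableSpace Ξ]

/-- The gradient of a random differentiable function is a random variable, each coordinate being
a limit of difference quotients. -/
lemma measurable_gradient_sample {φh : Vec (Fin n ⊕ Fin r) → Ξ → ℝ} (hm : ∀ z, Measurable (φh z))
    (hd : ∀ s, ContDiff ℝ 1 (fun z => φh z s)) (z : Vec (Fin n ⊕ Fin r)) :
    Measurable (fun s => gradient (fun w => φh w s) z) := by
  have hcoord : ∀ i, Measurable (fun s => (gradient (fun w => φh w s) z).ofLp i) := by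
    intro i
    set b : Vec (Fin n ⊕ Fin r) := EuclideanSpace.single i 1 with hb
    refine measurable_of_tendsto_metrizable
      (f := fun (k : ℕ) s => (k : ℝ) • (φh (z + (k : ℝ)⁻¹ • b) s - φh z s)) (fun k => ?_) ?_
    · exact ((hm (z + (k : ℝ)⁻¹ • b)).sub (hm z)).const_smul (k : ℝ)
    · refine tendsto_pi_nhds.2 fun s => ?_
      have h1 := ((hd s).differentiable one_ne_zero z).hasFDerivAt.lim_real b
      have h2 := h1.comp tendsto_natCast_atTop_atTop
      have e : (gradient (fun w => φh w s) z).ofLp i = fderiv ℝ (fun w => φh w s) z b := by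
        rw [← toDual_gradient, InnerProductSpace.toDual_apply_apply, hb,
          EuclideanSpace.inner_single_right]
        simp
      rw [e]
      exact h2
  exact (WithLp.measurable_toLp 2 _).comp (measurable_pi_lambda _ hcoord)

lemma measurable_gradX_uncurry {φh : Vec (Fin n ⊕ Fin r) → Ξ → ℝ} (hm : ∀ z, Measurable (φh z))
    (hd : ∀ s, ContDiff ℝ 1 (fun z => φh z s)) :
    Measurable (fun p : Vec (Fin n ⊕ Fin r) × Ξ => gradX (fun w => φh w p.2) p.1) := by
  refine measurable_uncurry_of_continuous_of_measurable
    (u := fun z s => gradX (fun w => φh w s) z) (fun s => continuous_gradX (hd s)) fun z => ?_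
  simp only [fun s => gradX_eq_fstV_gradient ((hd s).differentiable one_ne_zero z)]
  exact measurable_fstV.comp (measurable_gradient_sample hm hd z)

lemma measurable_gradY_uncurry {φh : Vec (Fin n ⊕ Fin r) → Ξ → ℝ} (hm : ∀ z, Measurable (φh z))
    (hd : ∀ s, ContDiff ℝ 1 (fun z => φh z s)) :
    Measurable (fun p : Vec (Fin n ⊕ Fin r) × Ξ => gradY (fun w => φh w p.2) p.1) := by
  refine measurable_uncurry_of_continuous_of_measurable
    (u := fun z s => gradY (fun w => φh w s) z) (fun s => continuous_gradY (hd s)) fun z => ?_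
  simp only [fun s => gradY_eq_sndV_gradient ((hd s).differentiable one_ne_zero z)]
  exact measurable_sndV.comp (measurable_gradient_sample hm hd z)

variable {P : Measure Ξ} {φh : Vec (Fin n ⊕ Fin r) → Ξ → ℝ}

lemma Oracle.integrable_gradX (h : Oracle P φh) (z : Vec (Fin n ⊕ Fin r)) :
    Integrable (fun s => gradX (fun w => φh w s) z) P :=
  fstCLM.integrable_comp (h.unbiased z).1

lemma Oracle.integral_gradX (h : Oracle P φh) (z : Vec (Fin n ⊕ Fin r)) :
    ∫ s, gradX (fun w => φh w s) z ∂P = gradX (meanFn P φh) z := by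
  have := (fstCLM (n := n) (r := r)).integral_comp_comm (h.unbiased z).1
  rw [(h.unbiased z).2] at this
  exact this

lemma Oracle.integrable_gradY (h : Oracle P φh) (z : Vec (Fin n ⊕ Fin r)) :
    Integrable (fun s => gradY (fun w => φh w s) z) P := by
  have := (sndCLM.integrable_comp (h.unbiased z).1).neg
  refine this.congr (Filter.Eventually.of_forall fun s => ?_)
  simp [sndCLM_apply, opF]

lemma Oracle.integral_gradY (h : Oracle P φh) (z : Vec (Fin n ⊕ Fin r)) :
    ∫ s, gradY (fun w => φh w s) z ∂P = gradY (meanFn P φh) z := by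
  have := (sndCLM (n := n) (r := r)).integral_comp_comm (h.unbiased z).1
  rw [(h.unbiased z).2] at this
  simp only [sndCLM_apply, opF, sndV_pair, integral_neg] at this
  exact neg_injective this

end Gradients

/-! ### Second moments in a weighted norm -/

section SecondMoments

variable {ι : Type} [Fintype ι] [DecidableEq ι]

/-- `‖v‖_V²` as an extended nonnegative real. -/
def nsq (V : Matrix ι ι ℝ) (v : Vec ι) : ℝ≥0∞ := ENNReal.ofReal (wsq V v)

@[fun_prop] lemma measurable_nsq (V : Matrix ι ι ℝ) : Measurable (nsq V) :=
  (measurable_wsq V).ennreal_ofReal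

lemma nsq_smul (V : Matrix ι ι ℝ) (t : ℝ) (v : Vec ι) :
    nsq V (t • v) = ENNReal.ofReal (t ^ 2) * nsq V v := by
  rw [nsq, wsq_smul, ENNReal.ofReal_mul (sq_nonneg t), nsq]

lemma nsq_add_le {V : Matrix ι ι ℝ} (hV : V.PosSemidef) (u v : Vec ι) {t : ℝ} (ht : 0 < t) :
    nsq V (u + v) ≤ ENNReal.ofReal (1 + t) * nsq V u + ENNReal.ofReal (1 + 1 / t) * nsq V v := by
  have h1 := wsq_nonneg hV u
  have h2 := wsq_nonneg hV v
  rw [nsq, nsq, nsq, ← ENNReal.ofReal_mul (by positivity), ← ENNReal.ofReal_mul (by positivity),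
    ← ENNReal.ofReal_add (by positivity) (by positivity)]
  exact ENNReal.ofReal_le_ofReal (wsq_add_le hV u v ht)

variable {Ξ : Type*} [MeasurableSpace Ξ] {P : Measure Ξ}

lemma aemeasurable_nsq {N : Ξ → Vec ι} (hN : Integrable N P) (V : Matrix ι ι ℝ) :
    AEMeasurable (fun s => nsq V (N s)) P :=
  (measurable_nsq V).comp_aemeasurable hN.1.aemeasurable

lemma integrable_wsq {V : Matrix ι ι ℝ} (hV : V.PosSemidef) {N : Ξ → Vec ι} (hN : Integrable N P)
    (h : ∫⁻ s, nsq V (N s) ∂P ≠ ∞) : Integrable (fun s => wsq V (N s)) P :=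
  ⟨(continuous_wsq V).comp_aestronglyMeasurable hN.1,
    (hasFiniteIntegral_iff_ofReal (Filter.Eventually.of_forall fun _ => wsq_nonneg hV _)).2
      (lt_top_iff_ne_top.2 h)⟩

lemma integral_inner_act {V : Matrix ι ι ℝ} {N : Ξ → Vec ι} (hN : Integrable N P) (a : Vec ι) :
    Integrable (fun s => inner ℝ a (act V (N s))) P ∧
      ∫ s, inner ℝ a (act V (N s)) ∂P = inner ℝ a (act V (∫ s, N s ∂P)) := by
  set L : Vec ι →L[ℝ] ℝ := (innerSL ℝ a).comp (Matrix.toEuclideanCLM (𝕜 := ℝ) V) with hL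
  have e : ∀ v, L v = inner ℝ a (act V v) := fun v => rfl
  simp only [← e]
  exact ⟨L.integrable_comp hN, L.integral_comp_comm hN⟩

variable [IsProbabilityMeasure P]

/-- The cross term of a fixed vector with centred noise has mean zero. -/
lemma lintegral_nsq_add_le {V : Matrix ι ι ℝ} (hV : V.PosSemidef) {N : Ξ → Vec ι}
    (hN : Integrable N P) (h0 : ∫ s, N s ∂P = 0) (a : Vec ι) :
    ∫⁻ s, nsq V (a + N s) ∂P ≤ nsq V a + ∫⁻ s, nsq V (N s) ∂P := by
  -- with an infinite second moment the bound is trivial; otherwise all terms are integrable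
  by_cases h : ∫⁻ s, nsq V (N s) ∂P = ∞
  · simp [h]
  have hi := integrable_wsq hV hN h
  obtain ⟨hc, hc'⟩ := integral_inner_act (V := V) hN a
  have hint : Integrable (fun s => wsq V (a + N s)) P := by
    simp only [wsq_add hV.1]
    exact ((integrable_const _).add (hc.const_mul 2)).add hi
  simp only [nsq]
  rw [← ofReal_integral_eq_lintegral_ofReal hint
      (Filter.Eventually.of_forall fun _ => wsq_nonneg hV _),
    ← ofReal_integral_eq_lintegral_ofReal hi
      (Filter.Eventually.of_forall fun _ => wsq_nonneg hV _),
    ← ENNReal.ofReal_add (wsq_nonneg hV a) (integral_nonneg fun _ => wsq_nonneg hV _)]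
  apply ENNReal.ofReal_le_ofReal
  simp only [wsq_add hV.1]
  have i1 : Integrable (fun s => wsq V a + 2 * inner ℝ a (act V (N s))) P :=
    (integrable_const _).add (hc.const_mul 2)
  rw [integral_add i1 hi,
    integral_add (integrable_const _) (hc.const_mul 2), integral_const_mul, hc', h0]
  simp

/-- The variance is at most the second moment. -/
lemma lintegral_nsq_sub_mean_le {V : Matrix ι ι ℝ} (hV : V.PosSemidef) {N : Ξ → Vec ι}
    (hN : Integrable N P) :
    ∫⁻ s, nsq V (N s - ∫ t, N t ∂P) ∂P ≤ ∫⁻ s, nsq V (N s) ∂P := by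
  by_cases h : ∫⁻ s, nsq V (N s) ∂P = ∞
  · simp [h]
  set m := ∫ t, N t ∂P with hm
  have hi := integrable_wsq hV hN h
  obtain ⟨hc, hc'⟩ := integral_inner_act (V := V) hN m
  have e : ∀ s, wsq V (N s - m) = wsq V (N s) - 2 * inner ℝ m (act V (N s)) + wsq V m := fun s => by
    rw [wsq_sub hV.1, inner_act_comm hV.1]
  have hint : Integrable (fun s => wsq V (N s - m)) P := by
    simp only [e]
    exact (hi.sub (hc.const_mul 2)).add (integrable_const _)
  simp only [nsq]
  rw [← ofReal_integral_eq_lintegral_ofReal hint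
      (Filter.Eventually.of_forall fun _ => wsq_nonneg hV _),
    ← ofReal_integral_eq_lintegral_ofReal hi
      (Filter.Eventually.of_forall fun _ => wsq_nonneg hV _)]
  apply ENNReal.ofReal_le_ofReal
  simp only [e]
  have i1 : Integrable (fun s => wsq V (N s) - 2 * inner ℝ m (act V (N s))) P :=
    hi.sub (hc.const_mul 2)
  rw [integral_add i1 (integrable_const _),
    integral_sub hi (hc.const_mul 2), integral_const_mul, hc', ← hm]
  have := wsq_nonneg hV m
  rw [wsq] at this
  simp [wsq]
  linarith

/-- For estimates `G₁, G₀` of two means made with the same sample, the combined noise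
`α N₁ + (1 - α)(N₁ - N₀)` of the bias-corrected estimator, `Nᵢ = Gᵢ - 𝔼 Gᵢ`. The weights
`4/3` and `4` in Young's inequality are the ones for which the final constants fit. -/
lemma lintegral_nsq_correction_le {V : Matrix ι ι ℝ} (hV : V.PosSemidef) {G₁ G₀ : Ξ → Vec ι}
    (h₁ : Integrable G₁ P) (h₀ : Integrable G₀ P) {m₁ m₀ : Vec ι} (hm₁ : ∫ s, G₁ s ∂P = m₁)
    (hm₀ : ∫ s, G₀ s ∂P = m₀) (a : ℝ) :
    ∫⁻ s, nsq V ((G₁ s - m₁) - (1 - a) • (G₀ s - m₀)) ∂P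
      ≤ ENNReal.ofReal (4 / 3 * a ^ 2) * ∫⁻ s, nsq V (G₁ s - m₁) ∂P
        + ENNReal.ofReal (4 * (1 - a) ^ 2) * ∫⁻ s, nsq V (G₁ s - G₀ s) ∂P := by
  have hvar := lintegral_nsq_sub_mean_le hV (h₁.sub h₀)
  have hmean : ∫ t, (G₁ - G₀) t ∂P = m₁ - m₀ := by
    rw [← hm₁, ← hm₀]
    exact integral_sub h₁ h₀
  rw [hmean] at hvar
  simp only [Pi.sub_apply] at hvar
  have hint1 : Integrable (fun s => G₁ s - m₁) P := h₁.sub (integrable_const _)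
  have hint2 : Integrable (fun s => G₁ s - G₀ s - (m₁ - m₀)) P :=
    (h₁.sub h₀).sub (integrable_const _)
  calc ∫⁻ s, nsq V ((G₁ s - m₁) - (1 - a) • (G₀ s - m₀)) ∂P
      ≤ ∫⁻ s, (ENNReal.ofReal (4 / 3 * a ^ 2) * nsq V (G₁ s - m₁)
        + ENNReal.ofReal (4 * (1 - a) ^ 2) * nsq V (G₁ s - G₀ s - (m₁ - m₀))) ∂P := by
        refine lintegral_mono fun s => ?_
        have e : (G₁ s - m₁) - (1 - a) • (G₀ s - m₀)
            = a • (G₁ s - m₁) + (1 - a) • (G₁ s - G₀ s - (m₁ - m₀)) := by module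
        rw [e]
        refine (nsq_add_le hV _ _ (t := 1 / 3) (by norm_num)).trans (le_of_eq ?_)
        rw [nsq_smul, nsq_smul, ← mul_assoc, ← mul_assoc, ← ENNReal.ofReal_mul (by norm_num),
          ← ENNReal.ofReal_mul (by norm_num)]
        norm_num
    _ = ENNReal.ofReal (4 / 3 * a ^ 2) * ∫⁻ s, nsq V (G₁ s - m₁) ∂P
        + ENNReal.ofReal (4 * (1 - a) ^ 2) * ∫⁻ s, nsq V (G₁ s - G₀ s - (m₁ - m₀)) ∂P := by
        rw [lintegral_add_left' ((aemeasurable_nsq hint1 V).const_mul _),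
          lintegral_const_mul'' _ (aemeasurable_nsq hint1 V),
          lintegral_const_mul'' _ (aemeasurable_nsq hint2 V)]
    _ ≤ _ := by gcongr

end SecondMoments

/-! ### Proximal points -/

section Prox

variable {ι : Type} [Fintype ι] [DecidableEq ι] {f : Vec ι → EReal} {V : Matrix ι ι ℝ}

lemma IsProx.ne_top (hf : ProperLscConvex f) {q p : Vec ι} (h : IsProx f V q p) : f p ≠ ⊤ := by
  obtain ⟨w, hw⟩ := hf.exists_ne_top
  intro hp
  have := h w
  rw [hp, EReal.top_add_coe, top_le_iff] at this
  lift f w to ℝ using ⟨hw, hf.ne_bot w⟩ with b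
  exact EReal.coe_ne_top _ (by exact_mod_cast this)

/-- The optimality condition `V (q - p) ∈ ∂f(p)` of a proximal point, from the first-order
expansion of the objective along segments issuing from `p`. -/
lemma IsProx.mem_subdiff (hf : ProperLscConvex f) (hV : V.PosDef) {q p : Vec ι}
    (h : IsProx f V q p) : act V (q - p) ∈ subdiff f p := by
  intro w
  by_cases hw : f w = ⊤
  · rw [hw]
    exact le_top
  have hp := h.ne_top hf
  obtain ⟨a, ha⟩ : ∃ a : ℝ, f p = a := ⟨_, (EReal.coe_toReal hp (hf.ne_bot p)).symm⟩
  obtain ⟨b, hb⟩ : ∃ b : ℝ, f w = b := ⟨_, (EReal.coe_toReal hw (hf.ne_bot w)).symm⟩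
  set X := a + inner ℝ (act V (q - p)) (w - p) - b with hX
  set Y := wsq V (w - p) / 2 with hY
  have hY0 : 0 ≤ Y := div_nonneg (wsq_nonneg hV.posSemidef _) two_pos.le
  have key : ∀ t : ℝ, 0 < t → t ≤ 1 → X ≤ t * Y := by
    intro t ht ht1
    have hc := hf.convex_epi (show (p, a) ∈ {p : Vec ι × ℝ | f p.1 ≤ (p.2 : EReal)} from ha.le)
      (show (w, b) ∈ {p : Vec ι × ℝ | f p.1 ≤ (p.2 : EReal)} from hb.le)
      (sub_nonneg.2 ht1) ht.le (by ring : (1 - t) + t = 1)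
    simp only [Set.mem_ofPred_eq, Prod.fst_add, Prod.smul_fst, Prod.snd_add, Prod.smul_snd,
      smul_eq_mul] at hc
    have h1 := (h ((1 - t) • p + t • w)).trans (add_le_add hc le_rfl)
    rw [ha] at h1
    have h2 : a + wsq V (p - q) / 2
        ≤ (1 - t) * a + t * b + wsq V ((1 - t) • p + t • w - q) / 2 := by exact_mod_cast h1
    have e : (1 - t) • p + t • w - q = t • (w - p) - (q - p) := by module
    rw [e, wsq_sub_comm V p q, wsq_sub hV.1 (t • (w - p)), wsq_smul, inner_smul_left,
      real_inner_comm] at h2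
    simp only [conj_trivial] at h2
    have h3 : t * X ≤ t * (t * Y) := by
      rw [hX, hY]
      linarith
    exact le_of_mul_le_mul_left h3 ht
  have hX0 : X ≤ 0 := by
    by_contra hpos
    push Not at hpos
    -- this `t` satisfies `t Y < X`, whatever `Y ≥ 0` is
    have h1 := key (X / (X + Y)) (by positivity) ((div_le_one (by positivity)).2 (by linarith))
    rw [div_mul_eq_mul_div, le_div_iff₀ (by positivity)] at h1
    nlinarith
  rw [ha, hb]
  exact_mod_cast (by linarith : a + inner ℝ (act V (q - p)) (w - p) ≤ b)

/-- Proximal maps are nonexpansive. -/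
lemma IsProx.wsq_sub_le (hf : ProperLscConvex f) (hV : V.PosDef) {q p q' p' : Vec ι}
    (h : IsProx f V q p) (h' : IsProx f V q' p') : wsq V (p - p') ≤ wsq V (q - q') := by
  have h1 := h.mem_subdiff hf hV p'
  have h2 := h'.mem_subdiff hf hV p
  obtain ⟨a, ha⟩ : ∃ a : ℝ, f p = a :=
    ⟨_, (EReal.coe_toReal (h.ne_top hf) (hf.ne_bot p)).symm⟩
  obtain ⟨b, hb⟩ : ∃ b : ℝ, f p' = b :=
    ⟨_, (EReal.coe_toReal (h'.ne_top hf) (hf.ne_bot p')).symm⟩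
  rw [ha, hb] at h1 h2
  have h1' : a + inner ℝ (act V (q - p)) (p' - p) ≤ b := by exact_mod_cast h1
  have h2' : b + inner ℝ (act V (q' - p')) (p - p') ≤ a := by exact_mod_cast h2
  have e1 : inner ℝ (act V (q - p)) (p' - p) = -inner ℝ (act V (q - p)) (p - p') := by
    rw [← inner_neg_right, neg_sub]
  have e2 : inner ℝ (p - p') (act V (q - q')) = wsq V (p - p')
      + inner ℝ (act V (q - p)) (p - p') - inner ℝ (act V (q' - p')) (p - p') := by
    rw [wsq, real_inner_comm (p - p') (act V (q - p)), real_inner_comm (p - p') (act V (q' - p')),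
      ← inner_add_right, ← inner_sub_right, ← act_add, ← act_sub]
    congr 2
    abel
  have h3 := two_inner_act_le hV.posSemidef (p - p') (q - q') one_pos
  linarith

/-- A proximal map agrees, wherever proximal points exist, with an everywhere defined measurable
function: it is Lipschitz on its domain, hence has a Lipschitz extension. -/
lemma exists_measurable_prox (hf : ProperLscConvex f) (hV : V.PosDef) :
    ∃ G : Vec ι → Vec ι, Measurable G ∧ ∀ q p, IsProx f V q p → p = G q := by
  classical
  obtain ⟨a, ha, ha'⟩ := exists_pos_mul_norm_sq_le_wsq hV
  obtain ⟨b, hb, hb'⟩ := exists_pos_wsq_le_mul_norm_sq hV.1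
  set s : Set (Vec ι) := {q | ∃ p, IsProx f V q p} with hs
  -- proximal points exist for all `q`, but only uniqueness is needed; off `s` the value is `0`
  set g : Vec ι → Vec ι := fun q => if h : ∃ p, IsProx f V q p then h.choose else 0 with hg
  have hgs : ∀ q ∈ s, IsProx f V q (g q) := by
    intro q hq
    have hq' : ∃ p, IsProx f V q p := hq
    simp only [hg, dif_pos hq']
    exact hq'.choose_spec
  have hlip : LipschitzOnWith (Real.toNNReal (√(b / a))) g s := by
    refine LipschitzOnWith.of_dist_le_mul fun q hq q' hq' => ?_
    have h1 := (hgs q hq).wsq_sub_le hf hV (hgs q' hq')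
    have h2 := (ha' _).trans (h1.trans (hb' _))
    rw [Real.coe_toNNReal _ (Real.sqrt_nonneg _), dist_eq_norm, dist_eq_norm]
    refine le_of_sq_le_sq ?_ (by positivity)
    rw [mul_pow, Real.sq_sqrt (by positivity), div_mul_eq_mul_div, le_div_iff₀ ha]
    linarith
  obtain ⟨G, hG, hGs⟩ := hlip.extend_finite_dimension
  refine ⟨G, hG.continuous.measurable, fun q p hp => ?_⟩
  have hq : q ∈ s := ⟨p, hp⟩
  rw [← hGs hq]
  have h0 := hp.wsq_sub_le hf hV (hgs q hq)
  rw [sub_self, wsq_zero] at h0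
  exact sub_eq_zero.1 (eq_zero_of_wsq_nonpos hV h0)

end Prox

/-! ### The deterministic descent inequality -/

section Descent

/-- With `v = δ + w` and `u = w + m`, where `m` is an `L`-contraction of `u`: the term `⟨w, V u⟩` is
at least `½ ‖w‖²`, the error term `⟨δ, V u⟩` is absorbed by Young's inequality and
`(1 - L) ‖u‖ ≤ ‖w‖`, and `‖w‖` is compared to `‖v‖` by Young's inequality. -/
lemma two_inner_ge {ι : Type} [Fintype ι] [DecidableEq ι] {V : Matrix ι ι ℝ} (hV : V.PosDef)
    {L b ε : ℝ} (hL : 0 ≤ L) (hL1 : L < 1) (hb : 0 < b) (hε : 0 < ε)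
    (hκ : 0 ≤ 1 - 1 / (ε * (1 - L) ^ 2)) (δ w m : Vec ι)
    (h : wsq V m ≤ L ^ 2 * wsq V (w + m)) :
    1 / (1 + b) * (1 - 1 / (ε * (1 - L) ^ 2)) * wsq V (δ + w)
        - (ε + 1 / b * (1 - 1 / (ε * (1 - L) ^ 2))) * wsq V δ
      ≤ 2 * inner ℝ (δ + w) (act V (w + m)) := by
  set k := 1 / (ε * (1 - L) ^ 2) with hk
  have hpos : 0 < 1 - L := by linarith
  have n1 := wsq_nonneg hV.posSemidef (w + m)
  have n2 := wsq_nonneg hV.posSemidef w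
  have h1 : wsq V w ≤ 2 * inner ℝ w (act V (w + m)) := by
    have e : wsq V m = wsq V (w + m) - 2 * inner ℝ w (act V (w + m)) + wsq V w := by
      conv_lhs => rw [show m = (w + m) - w by abel]
      rw [wsq_sub hV.1, inner_act_comm hV.1]
    have h' : wsq V m ≤ wsq V (w + m) :=
      h.trans (mul_le_of_le_one_left n1 (pow_le_one₀ hL hL1.le))
    linarith
  have h2 : -(ε * wsq V δ) - k * wsq V w ≤ 2 * inner ℝ δ (act V (w + m)) := by
    have h3 := two_inner_act_le hV.posSemidef (-δ) (w + m) hε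
    rw [wsq_neg, inner_neg_left] at h3
    have h4 : 1 / ε * wsq V (w + m) ≤ k * wsq V w := by
      calc 1 / ε * wsq V (w + m) = k * ((1 - L) ^ 2 * wsq V (w + m)) := by
            rw [hk]
            field_simp
        _ ≤ k * wsq V w := mul_le_mul_of_nonneg_left
            (sq_mul_wsq_le_of_contraction hV hL hL1 w m h) (by positivity)
    linarith
  have h5 : (1 - k) * (1 / (1 + b) * wsq V (δ + w) - 1 / b * wsq V δ) ≤ (1 - k) * wsq V w := by
    refine mul_le_mul_of_nonneg_left ?_ hκ
    have h6 := wsq_add_le hV.posSemidef w δ hb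
    rw [add_comm w δ] at h6
    have h7 := mul_le_mul_of_nonneg_left h6 (by positivity : 0 ≤ 1 / (1 + b))
    have e : 1 / (1 + b) * ((1 + b) * wsq V w + (1 + 1 / b) * wsq V δ)
        = wsq V w + 1 / b * wsq V δ := by
      field_simp
      ring
    linarith
  rw [inner_add_left]
  linarith

variable {n r : ℕ} {Ξ : Type*} [MeasurableSpace Ξ] {P : Measure Ξ} {f : Vec (Fin n) → EReal}
  {g : Vec (Fin r) → EReal} {φh : Vec (Fin n ⊕ Fin r) → Ξ → ℝ} {c : Constants n r}

namespace Assumptions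

lemma Γ_pos (h : Assumptions P f g φh c) : c.Γ.PosDef := Constants.Γ_posDef h.Γ₁_pos h.Γ₂_pos

lemma exists_mem_lmSet_lt_one (h : Assumptions P f g φh c) : ∃ t ∈ c.lmSet, t < 1 :=
  Constants.exists_mem_lmSet_lt_one h.Γ₁_pos h.Γ₂_pos h.D_pos h.stepsize_x h.stepsize_y

lemma LM_lt_one (h : Assumptions P f g φh c) : c.LM < 1 :=
  Constants.LM_lt_one h.exists_mem_lmSet_lt_one

end Assumptions

/-- The nonlinear part `F - Q_u` of `H_u` is `L_M`-Lipschitz between `z̄` and `z`. -/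
lemma wsq_nonlinear_part_le (h : Assumptions P f g φh c) (z zb : Vec (Fin n ⊕ Fin r)) :
    wsq c.Γ ((opF (meanFn P φh) z - c.opQ (meanFn P φh) z z)
        - (opF (meanFn P φh) zb - c.opQ (meanFn P φh) z zb))
      ≤ c.LM ^ 2 * wsq c.Γ⁻¹ (z - zb) := by
  obtain ⟨t, ht, -⟩ := h.exists_mem_lmSet_lt_one
  have hne : c.lmSet.Nonempty := ⟨t, ht⟩
  set φ := meanFn P φh
  have hx := h.lip_x (fstV z) (sndV z) (fstV zb) (sndV zb)
  have hy := h.lip_y (fstV z) (sndV z) (fstV zb) (sndV zb)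
  simp only [pair_fstV_sndV] at hx hy
  have e : (opF φ z - c.opQ φ z z) - (opF φ zb - c.opQ φ z zb)
      = pair (-(gradX φ zb - gradX φ z)) (gradY φ zb - c.θ • gradY φ (pair (fstV zb) (sndV z))
        - (1 - c.θ) • gradY φ z) := by
    simp only [opF, Constants.opQ, pair_sub, pair_fstV_sndV]
    congr 1 <;> module
  have e2 : z - zb = pair (-(fstV zb - fstV z)) (-(sndV zb - sndV z)) := by
    rw [neg_sub, neg_sub, ← pair_sub, pair_fstV_sndV, pair_fstV_sndV]
  rw [e, e2, Constants.wsq_Γ_pair, Constants.wsq_Γ_inv_pair h.Γ₁_pos h.Γ₂_pos, wsq_neg, wsq_neg,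
    wsq_neg]
  have h1 := Constants.stepsize_wsq_le h.Γ₁_pos hne (fstV zb - fstV z)
  have h2 := Constants.stepsize_wsq_le' h.Γ₂_pos hne (sndV zb - sndV z)
  linarith

/-- The descent inequality along the mean of one step: `v = Γ⁻¹ ẑ - S_z(z̄; z̄)` belongs to `T z̄`,
and the estimation error `δ = Γ⁻¹ ẑ - S_z(z; z̄)` enters with the factor
`a e`, `e = ε + (1 - 1 / (ε (1 - L_M)²)) / b`. -/
lemma wsq_step_le (h : Assumptions P f g φh c) {S : Set (Vec (Fin n ⊕ Fin r))} {ρ : ℝ}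
    (hminty : WeakMVI (opT f g (meanFn P φh)) S ρ) {zs : Vec (Fin n ⊕ Fin r)} (hzs : zs ∈ S)
    {b ε a : ℝ} (hb : 0 < b) (hε : 0 < ε) (hκ : 0 ≤ 1 - 1 / (ε * (1 - c.LM) ^ 2)) (ha : 0 ≤ a)
    {z zh zb v δ : Vec (Fin n ⊕ Fin r)}
    (hδ : δ = act c.Γ⁻¹ zh - c.opS (meanFn P φh) z z zb)
    (hv : v = act c.Γ⁻¹ zh - c.opS (meanFn P φh) z zb zb)
    (hvT : v ∈ opT f g (meanFn P φh) zb) :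
    wsq c.Γ⁻¹ (z - zs - a • act c.Γ v)
        + a * (1 / (1 + b) * (1 - 1 / (ε * (1 - c.LM) ^ 2)) + 2 * ρ / c.gbar ρ - a) * wsq c.Γ v
      ≤ wsq c.Γ⁻¹ (z - zs)
        + a * (ε + 1 / b * (1 - 1 / (ε * (1 - c.LM) ^ 2))) * wsq c.Γ δ := by
  have hΓ := h.Γ_pos
  set φ := meanFn P φh with hφ
  -- `v - δ = H_z(z) - H_z(z̄) = w`, and `m` is what `w` lacks of `Γ⁻¹ (z - z̄)`
  set m := (opF φ z - c.opQ φ z z) - (opF φ zb - c.opQ φ z zb) with hm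
  set w := act c.Γ⁻¹ (z - zb) - m with hw
  have hwm : w + m = act c.Γ⁻¹ (z - zb) := by rw [hw]; abel
  have hvw : v = δ + w := by
    rw [hv, hδ, hw, hm]
    simp only [Constants.opS, Constants.opH, act_sub]
    abel
  have hlip : wsq c.Γ m ≤ c.LM ^ 2 * wsq c.Γ (w + m) := by
    rw [hwm, wsq_act_inv hΓ]
    exact wsq_nonlinear_part_le h z zb
  have h1 := two_inner_ge hΓ Constants.LM_nonneg h.LM_lt_one hb hε hκ δ w m hlip
  rw [← hvw, hwm, act_act_inv hΓ] at h1
  have h2 := hminty.minty zs hzs zb v hvT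
  have h3 := Constants.div_gbar_mul_wsq_le hΓ ρ v
  have e1 : inner ℝ v (z - zs) = inner ℝ v (z - zb) + inner ℝ v (zb - zs) := by
    rw [← inner_add_right]
    congr 1
    abel
  have e2 : wsq c.Γ⁻¹ (z - zs - a • act c.Γ v)
      = wsq c.Γ⁻¹ (z - zs) - 2 * (a * inner ℝ v (z - zs)) + a ^ 2 * wsq c.Γ v := by
    rw [wsq_sub hΓ.inv.1, wsq_smul, wsq_inv_act hΓ, act_smul, act_inv_act hΓ, inner_smul_right,
      real_inner_comm]
  have h4 : a * (1 / (1 + b) * (1 - 1 / (ε * (1 - c.LM) ^ 2)) * wsq c.Γ v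
      - (ε + 1 / b * (1 - 1 / (ε * (1 - c.LM) ^ 2))) * wsq c.Γ δ + 2 * (ρ / c.gbar ρ * wsq c.Γ v))
      ≤ a * (2 * inner ℝ v (z - zs)) := by
    refine mul_le_mul_of_nonneg_left ?_ ha
    rw [e1]
    linarith
  rw [e2, mul_div_assoc 2 ρ]
  nlinarith

end Descent

/-! ### Noise of the oracle at fixed points -/

section OracleNoise

variable {n r : ℕ} {Ξ : Type*} [MeasurableSpace Ξ]

/-- The noise `∇_x φ̂(z, ξ) - ∇_x φ(z)`. -/
def noiseX (P : Measure Ξ) (φh : Vec (Fin n ⊕ Fin r) → Ξ → ℝ) (z : Vec (Fin n ⊕ Fin r)) (s : Ξ) :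
    Vec (Fin n) := gradX (fun w => φh w s) z - gradX (meanFn P φh) z

/-- The noise `∇_y φ̂(z, ξ) - ∇_y φ(z)`. -/
def noiseY (P : Measure Ξ) (φh : Vec (Fin n ⊕ Fin r) → Ξ → ℝ) (z : Vec (Fin n ⊕ Fin r)) (s : Ξ) :
    Vec (Fin r) := gradY (fun w => φh w s) z - gradY (meanFn P φh) z

variable {P : Measure Ξ} {f : Vec (Fin n) → EReal}
  {g : Vec (Fin r) → EReal} {φh : Vec (Fin n ⊕ Fin r) → Ξ → ℝ} {c : Constants n r}

lemma opF_sub_opF (z : Vec (Fin n ⊕ Fin r)) (s : Ξ) :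
    opF (fun w => φh w s) z - opF (meanFn P φh) z = pair (noiseX P φh z s) (-noiseY P φh z s) := by
  simp only [opF, pair_sub, noiseX, noiseY]
  congr 1
  abel

lemma ofReal_mul_wsq_le {m : ℕ} {G D : Matrix (Fin m) (Fin m) ℝ} (hG : G.PosDef)
    (hD : D.IsHermitian) {t : ℝ} (ht : 0 ≤ t) (u : Vec (Fin m)) :
    ENNReal.ofReal (t * wsq D u) ≤ ENNReal.ofReal (t * specNorm (G * D)) * nsq G⁻¹ u := by
  have := specNorm_nonneg (G * D)
  rw [nsq, ← ENNReal.ofReal_mul (by positivity), mul_assoc]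
  exact ENNReal.ofReal_le_ofReal (mul_le_mul_of_nonneg_left (wsq_le_specNorm_mul hG hD u) ht)

lemma lintegral_nsq_gradX_sub_le (h : Assumptions P f g φh c) (z z₀ : Vec (Fin n ⊕ Fin r)) :
    ∫⁻ s, nsq c.Γ₁ (gradX (fun w => φh w s) z - gradX (fun w => φh w s) z₀) ∂P
      ≤ ENNReal.ofReal c.c3 * nsq c.Γ⁻¹ (z - z₀) := by
  refine (h.mean_lip_x z₀ z).trans ?_
  have := specNorm_nonneg (c.Γ * c.Dhxz)
  rw [nsq, ← ENNReal.ofReal_mul Constants.c3_nonneg, Constants.c3, mul_assoc]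
  exact ENNReal.ofReal_le_ofReal
    (mul_le_mul_of_nonneg_left (wsq_le_specNorm_mul h.Γ_pos h.Dh_pos.1.1 _) (sq_nonneg _))

variable [IsProbabilityMeasure P]

lemma integrable_noiseX (ho : Oracle P φh) (z : Vec (Fin n ⊕ Fin r)) :
    Integrable (noiseX P φh z) P := (ho.integrable_gradX z).sub (integrable_const _)

lemma integrable_noiseY (ho : Oracle P φh) (z : Vec (Fin n ⊕ Fin r)) :
    Integrable (noiseY P φh z) P := (ho.integrable_gradY z).sub (integrable_const _)

lemma integral_noiseX (ho : Oracle P φh) (z : Vec (Fin n ⊕ Fin r)) :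
    ∫ s, noiseX P φh z s ∂P = 0 := by
  simp only [noiseX]
  rw [integral_sub (ho.integrable_gradX z) (integrable_const _), ho.integral_gradX]
  simp

lemma integral_noiseY (ho : Oracle P φh) (z : Vec (Fin n ⊕ Fin r)) :
    ∫ s, noiseY P φh z s ∂P = 0 := by
  simp only [noiseY]
  rw [integral_sub (ho.integrable_gradY z) (integrable_const _), ho.integral_gradY]
  simp

lemma lintegral_nsq_noise_le (h : Assumptions P f g φh c) (ho : Oracle P φh)
    (z : Vec (Fin n ⊕ Fin r)) :
    ∫⁻ s, nsq c.Γ₁ (noiseX P φh z s) ∂P + ∫⁻ s, nsq c.Γ₂ (noiseY P φh z s) ∂P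
      ≤ ENNReal.ofReal (c.σ ^ 2) := by
  have hv := h.variance z
  rw [← lintegral_add_left' (aemeasurable_nsq (integrable_noiseX ho z) _)]
  refine le_trans (le_of_eq (lintegral_congr fun s => ?_)) hv
  rw [opF_sub_opF, Constants.wsq_Γ_pair, wsq_neg,
    ENNReal.ofReal_add (wsq_nonneg h.Γ₁_pos.posSemidef _) (wsq_nonneg h.Γ₂_pos.posSemidef _)]
  rfl

lemma lintegral_nsq_correctionX_le (h : Assumptions P f g φh c) (ho : Oracle P φh) (a : ℝ)
    (z z₀ : Vec (Fin n ⊕ Fin r)) :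
    ∫⁻ s, nsq c.Γ₁ (noiseX P φh z s - (1 - a) • noiseX P φh z₀ s) ∂P
      ≤ ENNReal.ofReal (4 / 3 * a ^ 2) * ∫⁻ s, nsq c.Γ₁ (noiseX P φh z s) ∂P
        + ENNReal.ofReal (4 * (1 - a) ^ 2 * c.c3) * nsq c.Γ⁻¹ (z - z₀) := by
  refine (lintegral_nsq_correction_le h.Γ₁_pos.posSemidef (ho.integrable_gradX z)
    (ho.integrable_gradX z₀) (ho.integral_gradX z) (ho.integral_gradX z₀) a).trans ?_
  rw [ENNReal.ofReal_mul (by positivity : 0 ≤ 4 * (1 - a) ^ 2), mul_assoc]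
  exact add_le_add le_rfl (mul_le_mul_right (lintegral_nsq_gradX_sub_le h z z₀) _)

/-- For `θ = 1` the factor `(1 - θ)²` vanishes, and no Lipschitz bound is needed. -/
lemma lintegral_nsq_correctionY_le (h : Assumptions P f g φh c) (ho : Oracle P φh) (a : ℝ)
    (z z₀ : Vec (Fin n ⊕ Fin r)) :
    ENNReal.ofReal ((1 - c.θ) ^ 2) *
        ∫⁻ s, nsq c.Γ₂ (noiseY P φh z s - (1 - a) • noiseY P φh z₀ s) ∂P
      ≤ ENNReal.ofReal (4 / 3 * a ^ 2 * (1 - c.θ) ^ 2) * ∫⁻ s, nsq c.Γ₂ (noiseY P φh z s) ∂P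
        + ENNReal.ofReal (4 * (1 - a) ^ 2 * ((1 - c.θ) ^ 2 * c.Lhyz ^ 2
          * specNorm (c.Γ * c.Dhyz))) * nsq c.Γ⁻¹ (z - z₀) := by
  by_cases hθ : c.θ = 1
  · simp [hθ]
  have h1 : ∫⁻ s, nsq c.Γ₂ (gradY (fun w => φh w s) z - gradY (fun w => φh w s) z₀) ∂P
      ≤ ENNReal.ofReal (c.Lhyz ^ 2 * specNorm (c.Γ * c.Dhyz)) * nsq c.Γ⁻¹ (z - z₀) := by
    refine (h.mean_lip_y hθ z₀ z).trans ?_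
    have := specNorm_nonneg (c.Γ * c.Dhyz)
    rw [nsq, ← ENNReal.ofReal_mul (by positivity), mul_assoc]
    exact ENNReal.ofReal_le_ofReal
      (mul_le_mul_of_nonneg_left (wsq_le_specNorm_mul h.Γ_pos h.Dh_pos.2.1.1 _) (sq_nonneg _))
  have h2 := lintegral_nsq_correction_le h.Γ₂_pos.posSemidef (ho.integrable_gradY z)
    (ho.integrable_gradY z₀) (ho.integral_gradY z) (ho.integral_gradY z₀) a
  have h3 := specNorm_nonneg (c.Γ * c.Dhyz)
  calc _ ≤ ENNReal.ofReal ((1 - c.θ) ^ 2) *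
      (ENNReal.ofReal (4 / 3 * a ^ 2) * ∫⁻ s, nsq c.Γ₂ (noiseY P φh z s) ∂P
        + ENNReal.ofReal (4 * (1 - a) ^ 2) *
          (ENNReal.ofReal (c.Lhyz ^ 2 * specNorm (c.Γ * c.Dhyz)) * nsq c.Γ⁻¹ (z - z₀))) :=
        mul_le_mul_right (h2.trans (add_le_add le_rfl (mul_le_mul_right h1 _))) _
    _ = _ := by
        rw [mul_add, ← mul_assoc, ← mul_assoc, ← mul_assoc, ← ENNReal.ofReal_mul (by positivity),
          ← ENNReal.ofReal_mul (by positivity), ← ENNReal.ofReal_mul (by positivity)]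
        congr 3 <;> ring_nf

/-- The part of the recursion driven by `ξ'`, queried at the points `(x̄, y)` and `(x̄₀, y₀)`. For
`θ = 0` it vanishes, and no Lipschitz bound is needed. -/
lemma lintegral_nsq_correctionY'_le (h : Assumptions P f g φh c) (ho : Oracle P φh) (a : ℝ)
    (d : Vec (Fin r)) (xb xb₀ : Vec (Fin n)) (y y₀ : Vec (Fin r)) :
    ∫⁻ s, nsq c.Γ₂ (d + c.θ • (noiseY P φh (pair xb y) s
        - (1 - a) • noiseY P φh (pair xb₀ y₀) s)) ∂P
      ≤ nsq c.Γ₂ d + (ENNReal.ofReal (4 / 3 * a ^ 2 * c.θ ^ 2 * c.σ ^ 2)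
        + ENNReal.ofReal (2 * (1 - a) ^ 2 * c.c2) * nsq c.Γ₁⁻¹ (xb - xb₀)
        + ENNReal.ofReal (4 * (1 - a) ^ 2 * (c.θ ^ 2 * c.Lhyy ^ 2
          * specNorm (c.Γ₂ * c.Dhyy))) * nsq c.Γ₂⁻¹ (y - y₀)) := by
  have hi1 := integrable_noiseY ho (pair xb y)
  have hi0 := integrable_noiseY ho (pair xb₀ y₀)
  have hi0' : Integrable (fun s => (1 - a) • noiseY P φh (pair xb₀ y₀) s) P := hi0.smul (1 - a)
  have hi : Integrable (fun s => noiseY P φh (pair xb y) s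
        - (1 - a) • noiseY P φh (pair xb₀ y₀) s) P := hi1.sub hi0'
  have hi' : Integrable (fun s => c.θ • (noiseY P φh (pair xb y) s
        - (1 - a) • noiseY P φh (pair xb₀ y₀) s)) P := hi.smul c.θ
  have h0 : ∫ s, c.θ • (noiseY P φh (pair xb y) s
        - (1 - a) • noiseY P φh (pair xb₀ y₀) s) ∂P = 0 := by
    rw [integral_smul, integral_sub hi1 hi0', integral_smul,
      integral_noiseY ho, integral_noiseY ho]
    simp
  refine (lintegral_nsq_add_le h.Γ₂_pos.posSemidef hi' h0 d).trans
    (add_le_add le_rfl ?_)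
  simp only [nsq_smul]
  rw [lintegral_const_mul'' _ (aemeasurable_nsq hi _)]
  by_cases hθ : c.θ = 0
  · simp [hθ]
  have h2 := lintegral_nsq_correction_le h.Γ₂_pos.posSemidef (ho.integrable_gradY (pair xb y))
    (ho.integrable_gradY (pair xb₀ y₀)) (ho.integral_gradY _) (ho.integral_gradY _) a
  have hl : ∫⁻ s, nsq c.Γ₂ (gradY (fun w => φh w s) (pair xb y)
      - gradY (fun w => φh w s) (pair xb₀ y₀)) ∂P
      ≤ ENNReal.ofReal (c.Lhyx ^ 2 * specNorm (c.Γ₁ * c.Dhyx)) * nsq c.Γ₁⁻¹ (xb - xb₀)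
        + ENNReal.ofReal (c.Lhyy ^ 2 * specNorm (c.Γ₂ * c.Dhyy)) * nsq c.Γ₂⁻¹ (y - y₀) := by
    refine (h.mean_lip_y' hθ xb₀ y₀ xb y).trans ?_
    refine ENNReal.ofReal_add_le.trans (add_le_add ?_ ?_)
    · exact ofReal_mul_wsq_le h.Γ₁_pos h.Dh_pos.2.2.1.1 (sq_nonneg _) _
    · exact ofReal_mul_wsq_le h.Γ₂_pos h.Dh_pos.2.2.2.1 (sq_nonneg _) _
  have hσ : ∫⁻ s, nsq c.Γ₂ (noiseY P φh (pair xb y) s) ∂P ≤ ENNReal.ofReal (c.σ ^ 2) :=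
    le_add_self.trans (lintegral_nsq_noise_le h ho _)
  have n1 := specNorm_nonneg (c.Γ₁ * c.Dhyx)
  have n2 := specNorm_nonneg (c.Γ₂ * c.Dhyy)
  calc _ ≤ ENNReal.ofReal (c.θ ^ 2) * (ENNReal.ofReal (4 / 3 * a ^ 2) * ENNReal.ofReal (c.σ ^ 2)
        + ENNReal.ofReal (4 * (1 - a) ^ 2) *
          (ENNReal.ofReal (c.Lhyx ^ 2 * specNorm (c.Γ₁ * c.Dhyx)) * nsq c.Γ₁⁻¹ (xb - xb₀)
          + ENNReal.ofReal (c.Lhyy ^ 2 * specNorm (c.Γ₂ * c.Dhyy)) * nsq c.Γ₂⁻¹ (y - y₀))) :=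
        mul_le_mul_right (h2.trans
          (add_le_add (mul_le_mul_right hσ _) (mul_le_mul_right hl _))) _
    _ = _ := by
        rw [mul_add, mul_add, mul_add, ← add_assoc]
        simp only [← mul_assoc]
        simp only [← ENNReal.ofReal_mul (sq_nonneg c.θ)]
        rw [← ENNReal.ofReal_mul (by positivity), ← ENNReal.ofReal_mul (by positivity),
          ← ENNReal.ofReal_mul (by positivity), Constants.c2]
        congr 3
        · ring_nf
        · ring_nf
        · ring_nf

/-- The displacement of `x̂` in one step, which by nonexpansiveness of the proximal map bounds that
of `x̄`. -/
lemma lintegral_nsq_displacement_le (h : Assumptions P f g φh c) (ho : Oracle P φh) (a : ℝ)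
    (δ : Vec (Fin n)) (z z₀ : Vec (Fin n ⊕ Fin r)) :
    ∫⁻ s, nsq c.Γ₁⁻¹ ((fstV z - fstV z₀)
        - act c.Γ₁ (gradX (fun w => φh w s) z - gradX (fun w => φh w s) z₀)
        - a • act c.Γ₁ (δ + noiseX P φh z₀ s)) ∂P
      ≤ ENNReal.ofReal (4 * (1 + c.c3)) * nsq c.Γ⁻¹ (z - z₀)
        + ENNReal.ofReal (2 * a ^ 2) * (nsq c.Γ₁ δ + ENNReal.ofReal (c.σ ^ 2)) := by
  have hV := h.Γ₁_pos.inv.posSemidef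
  have nact : ∀ v, nsq c.Γ₁⁻¹ (act c.Γ₁ v) = nsq c.Γ₁ v := fun v => by
    rw [nsq, wsq_inv_act h.Γ₁_pos, nsq]
  have hd : nsq c.Γ₁⁻¹ (fstV z - fstV z₀) ≤ nsq c.Γ⁻¹ (z - z₀) := by
    refine ENNReal.ofReal_le_ofReal ?_
    have e : z - z₀ = pair (fstV z - fstV z₀) (sndV z - sndV z₀) := by
      rw [← pair_sub, pair_fstV_sndV, pair_fstV_sndV]
    rw [e, Constants.wsq_Γ_inv_pair h.Γ₁_pos h.Γ₂_pos]
    exact le_add_of_nonneg_right (wsq_nonneg h.Γ₂_pos.inv.posSemidef _)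
  have hiG : Integrable (fun s => gradX (fun w => φh w s) z - gradX (fun w => φh w s) z₀) P :=
    (ho.integrable_gradX z).sub (ho.integrable_gradX z₀)
  have hiN : Integrable (fun s => δ + noiseX P φh z₀ s) P :=
    (integrable_const _).add (integrable_noiseX ho z₀)
  have hσ : ∫⁻ s, nsq c.Γ₁ (noiseX P φh z₀ s) ∂P ≤ ENNReal.ofReal (c.σ ^ 2) :=
    le_self_add.trans (lintegral_nsq_noise_le h ho z₀)
  have hc3 := Constants.c3_nonneg (c := c)
  have two : ∀ u v : Vec (Fin n), nsq c.Γ₁⁻¹ (u - v) ≤ 2 * nsq c.Γ₁⁻¹ u + 2 * nsq c.Γ₁⁻¹ v := by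
    intro u v
    have := nsq_add_le hV u (-v) one_pos
    rw [← sub_eq_add_neg] at this
    simpa only [nsq, wsq_neg, div_one, one_add_one_eq_two, ENNReal.ofReal_ofNat] using this
  calc _ ≤ ∫⁻ s, (4 * nsq c.Γ⁻¹ (z - z₀)
        + 4 * nsq c.Γ₁ (gradX (fun w => φh w s) z - gradX (fun w => φh w s) z₀)
        + ENNReal.ofReal (2 * a ^ 2) * nsq c.Γ₁ (δ + noiseX P φh z₀ s)) ∂P := by
        refine lintegral_mono fun s => (two _ _).trans (add_le_add ?_ (le_of_eq ?_))
        · refine (mul_le_mul_right (two _ _) 2).trans ?_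
          rw [nact, mul_add, ← mul_assoc, ← mul_assoc]
          norm_num only
          exact add_le_add (mul_le_mul_right hd 4) le_rfl
        · rw [nsq_smul, nact, ← mul_assoc, ENNReal.ofReal_mul two_pos.le, ENNReal.ofReal_ofNat]
    _ = 4 * nsq c.Γ⁻¹ (z - z₀)
        + 4 * ∫⁻ s, nsq c.Γ₁ (gradX (fun w => φh w s) z - gradX (fun w => φh w s) z₀) ∂P
        + ENNReal.ofReal (2 * a ^ 2) * ∫⁻ s, nsq c.Γ₁ (δ + noiseX P φh z₀ s) ∂P := by
        rw [lintegral_add_left' (((aemeasurable_nsq hiG _).const_mul _).const_add _),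
          lintegral_add_left' aemeasurable_const, lintegral_const_mul'' _ (aemeasurable_nsq hiG _),
          lintegral_const_mul'' _ (aemeasurable_nsq hiN _)]
        simp
    _ ≤ 4 * nsq c.Γ⁻¹ (z - z₀) + 4 * (ENNReal.ofReal c.c3 * nsq c.Γ⁻¹ (z - z₀))
        + ENNReal.ofReal (2 * a ^ 2) * (nsq c.Γ₁ δ + ENNReal.ofReal (c.σ ^ 2)) := by
        refine add_le_add (add_le_add le_rfl (mul_le_mul_right
          (lintegral_nsq_gradX_sub_le h z z₀) _)) (mul_le_mul_right ?_ _)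
        exact (lintegral_nsq_add_le h.Γ₁_pos.posSemidef (integrable_noiseX ho z₀)
          (integral_noiseX ho z₀) δ).trans (add_le_add le_rfl hσ)
    _ = _ := by
        rw [ENNReal.ofReal_mul (by norm_num : (0 : ℝ) ≤ 4), ENNReal.ofReal_add zero_le_one hc3]
        simp only [ENNReal.ofReal_ofNat, ENNReal.ofReal_one]
        ring

end OracleNoise

/-! ### Independence of fresh samples from the past -/

section Independence

/-- Regrouping of independent variables: if `X` is independent of `(Y, Z)` and `Y` of `Z`, then
`(X, Y)` is independent of `Z`. -/
lemma indepFun_prodMk_left {Ω A B C : Type*} [MeasurableSpace Ω] [MeasurableSpace A]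
    [MeasurableSpace B] [MeasurableSpace C] {μ : Measure Ω} [IsProbabilityMeasure μ]
    {X : Ω → A} {Y : Ω → B} {Z : Ω → C} (hX : Measurable X) (hY : Measurable Y)
    (hZ : Measurable Z) (h : IndepFun X (fun ω => (Y ω, Z ω)) μ) (h' : IndepFun Y Z μ) :
    IndepFun (fun ω => (X ω, Y ω)) Z μ := by
  have hXY : IndepFun X Y μ := h.comp measurable_id measurable_fst
  have iX : IsProbabilityMeasure (μ.map X) := Measure.isProbabilityMeasure_map hX.aemeasurable
  have iY : IsProbabilityMeasure (μ.map Y) := Measure.isProbabilityMeasure_map hY.aemeasurable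
  have iZ : IsProbabilityMeasure (μ.map Z) := Measure.isProbabilityMeasure_map hZ.aemeasurable
  rw [indepFun_iff_map_prod_eq_prod_map_map hX.aemeasurable (hY.prodMk hZ).aemeasurable] at h
  rw [indepFun_iff_map_prod_eq_prod_map_map hY.aemeasurable hZ.aemeasurable] at h'
  rw [indepFun_iff_map_prod_eq_prod_map_map hX.aemeasurable hY.aemeasurable] at hXY
  rw [indepFun_iff_map_prod_eq_prod_map_map (hX.prodMk hY).aemeasurable hZ.aemeasurable, hXY]
  have h1 := (measurePreserving_prodAssoc (μ.map X) (μ.map Y) (μ.map Z)).symm.map_eq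
  rw [← h1, ← h', ← h, Measure.map_map (MeasurableEquiv.measurable _) (hX.prodMk (hY.prodMk hZ))]
  rfl

/-- Integration against an independent sample of law `P`. -/
lemma lintegral_indepFun {Ω E Ξ : Type*} [MeasurableSpace Ω] [MeasurableSpace E]
    [MeasurableSpace Ξ] {μ : Measure Ω} [IsProbabilityMeasure μ] {P : Measure Ξ}
    [IsProbabilityMeasure P] {X : Ω → E} {Y : Ω → Ξ} (hX : Measurable X) (hY : Measurable Y)
    (h : IndepFun X Y μ) (hP : μ.map Y = P) {Φ : E × Ξ → ℝ≥0∞} (hΦ : Measurable Φ) :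
    ∫⁻ ω, Φ (X ω, Y ω) ∂μ = ∫⁻ ω, ∫⁻ s, Φ (X ω, s) ∂P ∂μ := by
  rw [indepFun_iff_map_prod_eq_prod_map_map hX.aemeasurable hY.aemeasurable, hP] at h
  rw [← lintegral_map (f := Φ) (g := fun ω => (X ω, Y ω)) hΦ (hX.prodMk hY), h,
    lintegral_prod _ hΦ.aemeasurable, lintegral_map hΦ.lintegral_prod_right' hX]

variable {Ω Ξ I : Type*}

/-- The information carried by the initial data and the samples with index in `S`. -/
@[reducible] def hist [MeasurableSpace Ξ] [MeasurableSpace I] (ξ : Fin 3 → ℕ → Ω → Ξ) (init : Ω → I)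
    (S : Finset (Fin 3 × ℕ)) : MeasurableSpace Ω :=
  MeasurableSpace.comap (fun ω => (init ω, fun p : S => ξ p.1.1 p.1.2 ω)) inferInstance

/-- The indices of the samples drawn before the sample `ξ i k`. -/
def past (i k : ℕ) : Finset (Fin 3 × ℕ) :=
  (Finset.univ ×ˢ Finset.range (k + 1)).filter fun p => p.2 < k ∨ p.1.val < i

lemma mem_past {i k : ℕ} {p : Fin 3 × ℕ} : p ∈ past i k ↔ p.2 < k ∨ p.2 = k ∧ p.1.val < i := by
  simp only [past, Finset.mem_filter, Finset.mem_product, Finset.mem_univ, true_and,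
    Finset.mem_range]
  omega

lemma past_mono {i j k : ℕ} (h : i ≤ j) : past i k ⊆ past j k := by
  intro p hp
  rw [mem_past] at *
  omega

lemma past_subset_succ (k : ℕ) : past 3 k ⊆ past 0 (k + 1) := by
  intro p hp
  rw [mem_past] at *
  omega

variable [MeasurableSpace Ξ] [MeasurableSpace I] {ξ : Fin 3 → ℕ → Ω → Ξ} {init : Ω → I}

lemma measurable_hist_init (S : Finset (Fin 3 × ℕ)) : Measurable[hist ξ init S] init :=
  measurable_fst.comp (comap_measurable _)

lemma measurable_hist_sample {S : Finset (Fin 3 × ℕ)} {i : Fin 3} {k : ℕ} (h : (i, k) ∈ S) :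
    Measurable[hist ξ init S] (ξ i k) := by
  have hc := comap_measurable (m := inferInstance)
    (fun ω => (init ω, fun p : S => ξ p.1.1 p.1.2 ω))
  exact (measurable_pi_apply (⟨(i, k), h⟩ : S)).comp (measurable_snd.comp hc)

lemma hist_le {S : Finset (Fin 3 × ℕ)} {m : MeasurableSpace Ω} (hi : Measurable[m] init)
    (hs : ∀ p ∈ S, Measurable[m] (ξ p.1 p.2)) : hist ξ init S ≤ m :=
  (hi.prodMk (measurable_pi_lambda _ fun p : S => hs p.1 p.2)).comap_le

lemma hist_mono {S T : Finset (Fin 3 × ℕ)} (h : S ⊆ T) : hist ξ init S ≤ hist ξ init T :=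
  hist_le (measurable_hist_init T) fun _ hp => measurable_hist_sample (h hp)

variable [MeasurableSpace Ω] {μ : Measure Ω} {P : Measure Ξ} {κ : Ω → ℕ}

lemma Sampling.hist_le (hs : Sampling μ P ξ init κ) (S : Finset (Fin 3 × ℕ)) :
    hist ξ init S ≤ ‹MeasurableSpace Ω› :=
  NPPDEG.hist_le hs.measurable_init fun p _ => hs.measurable_sample p.1 p.2

lemma Sampling.indepFun_of_measurable_hist [IsProbabilityMeasure μ]
    (hs : Sampling μ P ξ init κ) {E : Type*} [MeasurableSpace E] {X : Ω → E}
    {S : Finset (Fin 3 × ℕ)} (hX : Measurable[hist ξ init S] X)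
    {i : Fin 3} {k : ℕ} (hik : (i, k) ∉ S) : IndepFun X (ξ i k) μ := by
  have hξ : ∀ p : Fin 3 × ℕ, Measurable (ξ p.1 p.2) := fun p => hs.measurable_sample p.1 p.2
  have h1 : IndepFun (fun ω (p : S) => ξ p.1.1 p.1.2 ω) (ξ i k) μ := by
    have := hs.iIndep.indepFun_finset S {(i, k)} (Finset.disjoint_singleton_right.2 hik) hξ
    exact this.comp measurable_id
      (measurable_pi_apply (⟨(i, k), Finset.mem_singleton_self _⟩ : ({(i, k)} : Finset _)))
  have h2 : IndepFun init (fun ω => ((fun p : S => ξ p.1.1 p.1.2 ω), ξ i k ω)) μ := by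
    refine hs.indep_init.comp (ψ := fun s : Fin 3 × ℕ → Ξ => ((fun p : S => s p.1), s (i, k)))
      measurable_id ?_
    exact (measurable_pi_lambda _ fun p => measurable_pi_apply _).prodMk (measurable_pi_apply _)
  have h3 := indepFun_prodMk_left hs.measurable_init
    (measurable_pi_lambda _ fun p : S => hξ p.1) (hs.measurable_sample i k) h2 h1
  rw [IndepFun_iff_Indep] at h3 ⊢
  exact indep_of_indep_of_le_left h3 hX.comap_le

/-- Averaging over a sample that is drawn after everything `X` depends on. -/
lemma Sampling.lintegral_fresh [IsProbabilityMeasure μ] [IsProbabilityMeasure P]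
    (hs : Sampling μ P ξ init κ) {E : Type*} [MeasurableSpace E] {X : Ω → E}
    {S : Finset (Fin 3 × ℕ)} (hX : Measurable[hist ξ init S] X)
    {i : Fin 3} {k : ℕ} (hik : (i, k) ∉ S) {Φ : E × Ξ → ℝ≥0∞} (hΦ : Measurable Φ) :
    ∫⁻ ω, Φ (X ω, ξ i k ω) ∂μ = ∫⁻ ω, ∫⁻ s, Φ (X ω, s) ∂P ∂μ :=
  lintegral_indepFun (hX.mono (hs.hist_le S) le_rfl) (hs.measurable_sample i k)
    (hs.indepFun_of_measurable_hist hX hik) (hs.law i k) hΦ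

/-- The random index is independent of every variable that depends on the initial data and
finitely many samples. -/
lemma Sampling.setLIntegral_index (hs : Sampling μ P ξ init κ) {S : Finset (Fin 3 × ℕ)}
    {G : Ω → ℝ≥0∞} (hG : Measurable[hist ξ init S] G) (k : ℕ) :
    ∫⁻ ω in {ω | κ ω = k}, G ω ∂μ = μ {ω | κ ω = k} * ∫⁻ ω, G ω ∂μ := by
  have hset : MeasurableSet {ω | κ ω = k} := hs.measurable_index (measurableSet_singleton k)
  have h1 : IndepFun κ G μ := by
    have h2 := hs.indep_index
    rw [IndepFun_iff_Indep] at h2 ⊢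
    refine indep_of_indep_of_le_right h2 (hG.comap_le.trans ?_)
    have hc := comap_measurable (m := inferInstance)
      (fun ω => (init ω, fun p : Fin 3 × ℕ => ξ p.1 p.2 ω))
    exact NPPDEG.hist_le (measurable_fst.comp hc)
      fun p _ => (measurable_pi_apply p).comp (measurable_snd.comp hc)
  have h3 : IndepFun (fun ω => ({k} : Set ℕ).indicator (fun _ => (1 : ℝ≥0∞)) (κ ω)) G μ :=
    h1.comp (measurable_one.indicator (measurableSet_singleton k)) measurable_id
  have h4 := lintegral_mul_eq_lintegral_mul_lintegral_of_indepFun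
    ((measurable_one.indicator (measurableSet_singleton k)).comp hs.measurable_index)
    (hG.mono (hs.hist_le S) le_rfl) h3
  have e1 : ∫⁻ ω, ({k} : Set ℕ).indicator (fun _ => (1 : ℝ≥0∞)) (κ ω) ∂μ = μ {ω | κ ω = k} := by
    rw [← lintegral_indicator_one hset]
    rfl
  have e2 : ∫⁻ ω in {ω | κ ω = k}, G ω ∂μ
      = ∫⁻ ω, ({k} : Set ℕ).indicator (fun _ => (1 : ℝ≥0∞)) (κ ω) * G ω ∂μ := by
    rw [← lintegral_indicator hset]
    refine lintegral_congr fun ω => ?_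
    by_cases h : κ ω = k <;> simp [Set.indicator, h]
  rw [e2, ← e1]
  exact h4

end Independence

/-! ### Estimation errors and the vector form of one step -/

section ErrorVectors

variable {n r : ℕ} {Ξ : Type*} [MeasurableSpace Ξ]

/-- The `x`-component of the estimation error `Γ⁻¹ ẑ - S_z(z; z̄)`. -/
def errX (P : Measure Ξ) (φh : Vec (Fin n ⊕ Fin r) → Ξ → ℝ) (c : Constants n r)
    (x xh : Vec (Fin n)) (y : Vec (Fin r)) : Vec (Fin n) :=
  act c.Γ₁⁻¹ (xh - x) + gradX (meanFn P φh) (pair x y)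

/-- The `y`-component of the estimation error `Γ⁻¹ ẑ - S_z(z; z̄)`. -/
def errY (P : Measure Ξ) (φh : Vec (Fin n ⊕ Fin r) → Ξ → ℝ) (c : Constants n r)
    (x xb : Vec (Fin n)) (y yh : Vec (Fin r)) : Vec (Fin r) :=
  act c.Γ₂⁻¹ (yh - y) - c.θ • gradY (meanFn P φh) (pair xb y)
    - (1 - c.θ) • gradY (meanFn P φh) (pair x y)

/-- The residual `Γ⁻¹ ẑ - S_z(z̄; z̄) = Γ⁻¹ (ẑ - z̄) + F(z̄)`. -/
def resid (P : Measure Ξ) (φh : Vec (Fin n ⊕ Fin r) → Ξ → ℝ) (c : Constants n r)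
    (xh xb : Vec (Fin n)) (yh yb : Vec (Fin r)) : Vec (Fin n ⊕ Fin r) :=
  pair (act c.Γ₁⁻¹ (xh - xb)) (act c.Γ₂⁻¹ (yh - yb)) + opF (meanFn P φh) (pair xb yb)

variable {P : Measure Ξ} {f : Vec (Fin n) → EReal} {g : Vec (Fin r) → EReal}
  {φh : Vec (Fin n ⊕ Fin r) → Ξ → ℝ} {c : Constants n r}

lemma sub_opS_eq_pair_err (h₁ : c.Γ₁.PosDef) (h₂ : c.Γ₂.PosDef) (x xh xb : Vec (Fin n))
    (y yh yb : Vec (Fin r)) :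
    act c.Γ⁻¹ (pair xh yh) - c.opS (meanFn P φh) (pair x y) (pair x y) (pair xb yb)
      = pair (errX P φh c x xh y) (errY P φh c x xb y yh) := by
  simp only [Constants.opS, Constants.opH, Constants.opQ, opF, Constants.act_Γ_inv_pair h₁ h₂,
    fstV_pair, sndV_pair, pair_add, pair_sub, errX, errY, act_sub]
  congr 1 <;> module

lemma sub_opS_eq_resid (h₁ : c.Γ₁.PosDef) (h₂ : c.Γ₂.PosDef) (z : Vec (Fin n ⊕ Fin r))
    (xh xb : Vec (Fin n)) (yh yb : Vec (Fin r)) :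
    act c.Γ⁻¹ (pair xh yh) - c.opS (meanFn P φh) z (pair xb yb) (pair xb yb)
      = resid P φh c xh xb yh yb := by
  simp only [Constants.opS, Constants.opH, Constants.opQ, opF, Constants.act_Γ_inv_pair h₁ h₂,
    fstV_pair, pair_add, pair_sub, resid, act_sub]
  congr 1 <;> module

lemma resid_mem_opT (h : Assumptions P f g φh c) {xh xb : Vec (Fin n)} {yh yb : Vec (Fin r)}
    (hx : IsProx f c.Γ₁⁻¹ xh xb) (hy : IsProx g c.Γ₂⁻¹ yh yb) :
    resid P φh c xh xb yh yb ∈ opT f g (meanFn P φh) (pair xb yb) :=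
  ⟨_, hx.mem_subdiff h.f_conv h.Γ₁_pos.inv, _, hy.mem_subdiff h.g_conv h.Γ₂_pos.inv, rfl⟩

lemma nsq_Γ_pair (h : Assumptions P f g φh c) (u : Vec (Fin n)) (v : Vec (Fin r)) :
    nsq c.Γ (pair u v) = nsq c.Γ₁ u + nsq c.Γ₂ v := by
  rw [nsq, Constants.wsq_Γ_pair,
    ENNReal.ofReal_add (wsq_nonneg h.Γ₁_pos.posSemidef _) (wsq_nonneg h.Γ₂_pos.posSemidef _)]
  rfl

/-- The recursion for the error of `x̂`. -/
lemma errX_step (h₁ : c.Γ₁.PosDef) {a : ℝ} {s : Ξ} {x xh x₀ xh₀ : Vec (Fin n)}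
    {y y₀ : Vec (Fin r)}
    (h : xh = x - act c.Γ₁ (gradX (fun w => φh w s) (pair x y))
      + (1 - a) • (xh₀ - x₀ + act c.Γ₁ (gradX (fun w => φh w s) (pair x₀ y₀)))) :
    errX P φh c x xh y = (1 - a) • errX P φh c x₀ xh₀ y₀
      + -(noiseX P φh (pair x y) s - (1 - a) • noiseX P φh (pair x₀ y₀) s) := by
  subst h
  simp only [errX, noiseX, act_sub, act_add, act_smul, act_inv_act h₁]
  module

/-- The displacement of `x̂` in terms of the previous error. -/
lemma xh_sub_eq (h₁ : c.Γ₁.PosDef) {a : ℝ} {s : Ξ} {x xh x₀ xh₀ : Vec (Fin n)}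
    {y y₀ : Vec (Fin r)}
    (h : xh = x - act c.Γ₁ (gradX (fun w => φh w s) (pair x y))
      + (1 - a) • (xh₀ - x₀ + act c.Γ₁ (gradX (fun w => φh w s) (pair x₀ y₀)))) :
    xh - xh₀ = (fstV (pair x y) - fstV (pair x₀ y₀))
        - act c.Γ₁ (gradX (fun w => φh w s) (pair x y) - gradX (fun w => φh w s) (pair x₀ y₀))
        - a • act c.Γ₁ (errX P φh c x₀ xh₀ y₀ + noiseX P φh (pair x₀ y₀) s) := by
  subst h
  simp only [errX, noiseX, act_sub, act_add, act_act_inv h₁, fstV_pair]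
  module

/-- The recursion for the error of `ŷ`, with the contributions of `s = ξ` and `s' = ξ'`
separated. -/
lemma errY_step (h₂ : c.Γ₂.PosDef) {a : ℝ} {s s' : Ξ} {x xb x₀ xb₀ : Vec (Fin n)}
    {y yh y₀ yh₀ : Vec (Fin r)}
    (h : yh = y + act c.Γ₂ (c.θ • gradY (fun w => φh w s') (pair xb y)
        + (1 - c.θ) • gradY (fun w => φh w s) (pair x y))
      + (1 - a) • (yh₀ - y₀ - act c.Γ₂ (c.θ • gradY (fun w => φh w s') (pair xb₀ y₀)
        + (1 - c.θ) • gradY (fun w => φh w s) (pair x₀ y₀)))) :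
    errY P φh c x xb y yh = ((1 - a) • errY P φh c x₀ xb₀ y₀ yh₀
        + (1 - c.θ) • (noiseY P φh (pair x y) s - (1 - a) • noiseY P φh (pair x₀ y₀) s))
      + c.θ • (noiseY P φh (pair xb y) s' - (1 - a) • noiseY P φh (pair xb₀ y₀) s') := by
  subst h
  simp only [errY, noiseY, act_sub, act_add, act_smul, act_inv_act h₂]
  module

/-- One step moves `z` by `-a Γ (v + N)`, with the residual `v` and the noise `N` of `F̂` at
`z̄`. -/
lemma pair_step (h₁ : c.Γ₁.PosDef) (h₂ : c.Γ₂.PosDef) {a : ℝ} {s : Ξ}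
    {x x' xh xb : Vec (Fin n)} {y y' yh yb : Vec (Fin r)}
    (hx : x' = x + a • (xb - xh - act c.Γ₁ (gradX (fun w => φh w s) (pair xb yb))))
    (hy : y' = y + a • (yb - yh + act c.Γ₂ (gradY (fun w => φh w s) (pair xb yb)))) :
    pair x' y' = pair x y - a • act c.Γ (resid P φh c xh xb yh yb)
      + (-a) • act c.Γ (opF (fun w => φh w s) (pair xb yb)
        - opF (meanFn P φh) (pair xb yb)) := by
  subst hx hy
  simp only [resid, opF, pair_add, pair_sub, Constants.act_Γ_pair, smul_pair, act_add, act_sub,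
    act_neg, act_act_inv h₁, act_act_inv h₂]
  congr 1 <;> module

variable [IsProbabilityMeasure P]

lemma lintegral_nsq_step_le (h : Assumptions P f g φh c) (ho : Oracle P φh) (a : ℝ)
    (u z : Vec (Fin n ⊕ Fin r)) :
    ∫⁻ s, nsq c.Γ⁻¹ (u + (-a) • act c.Γ (opF (fun w => φh w s) z - opF (meanFn P φh) z)) ∂P
      ≤ nsq c.Γ⁻¹ u + ENNReal.ofReal (a ^ 2 * c.σ ^ 2) := by
  have hi : Integrable (fun s => opF (fun w => φh w s) z - opF (meanFn P φh) z) P :=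
    (ho.unbiased z).1.sub (integrable_const _)
  have h0 : ∫ s, (opF (fun w => φh w s) z - opF (meanFn P φh) z) ∂P = 0 := by
    rw [integral_sub (ho.unbiased z).1 (integrable_const _), (ho.unbiased z).2]
    simp
  set L : Vec (Fin n ⊕ Fin r) →L[ℝ] Vec (Fin n ⊕ Fin r) :=
    (-a) • Matrix.toEuclideanCLM (𝕜 := ℝ) c.Γ
  have hL : ∀ v, L v = (-a) • act c.Γ v := fun v => rfl
  simp only [← hL]
  refine (lintegral_nsq_add_le h.Γ_pos.inv.posSemidef (L.integrable_comp hi)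
    (by rw [L.integral_comp_comm hi, h0, map_zero]) u).trans (add_le_add le_rfl ?_)
  simp only [hL, nsq_smul]
  have e : ∀ v, nsq c.Γ⁻¹ (act c.Γ v) = nsq c.Γ v := fun v => by
    rw [nsq, wsq_inv_act h.Γ_pos, nsq]
  simp only [e]
  rw [lintegral_const_mul'' _ (aemeasurable_nsq hi _), neg_sq, ENNReal.ofReal_mul (sq_nonneg a)]
  exact mul_le_mul_right (h.variance z) _

/-- The noise of the part of the estimator driven by `ξ`: its two components share the variance
budget `σ²` at the point `z`. -/
lemma noise_budget_le (h : Assumptions P f g φh c) (ho : Oracle P φh) (a : ℝ)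
    (z : Vec (Fin n ⊕ Fin r)) :
    ENNReal.ofReal (4 / 3 * a ^ 2) * ∫⁻ s, nsq c.Γ₁ (noiseX P φh z s) ∂P
      + ENNReal.ofReal (4 / 3 * a ^ 2 * (1 - c.θ) ^ 2) * ∫⁻ s, nsq c.Γ₂ (noiseY P φh z s) ∂P
      ≤ ENNReal.ofReal (4 / 3 * a ^ 2 * (2 * c.Theta - c.θ ^ 2) * c.σ ^ 2) := by
  -- `2Θ - θ² = 5θ² - 4θ + 2` dominates both `1` and `(1 - θ)²`; the `θ²` that is left out pays for
  -- the noise of the part driven by `ξ'`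
  have h1 : 4 / 3 * a ^ 2 * 1 ≤ 4 / 3 * a ^ 2 * (2 * c.Theta - c.θ ^ 2) := by
    refine mul_le_mul_of_nonneg_left ?_ (by positivity)
    rw [Constants.Theta]
    nlinarith [sq_nonneg (5 * c.θ - 2)]
  have h2 : 4 / 3 * a ^ 2 * (1 - c.θ) ^ 2 ≤ 4 / 3 * a ^ 2 * (2 * c.Theta - c.θ ^ 2) := by
    refine mul_le_mul_of_nonneg_left ?_ (by positivity)
    rw [Constants.Theta]
    nlinarith [sq_nonneg (1 - c.θ), sq_nonneg c.θ]
  rw [mul_one] at h1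
  calc _ ≤ ENNReal.ofReal (4 / 3 * a ^ 2 * (2 * c.Theta - c.θ ^ 2))
          * ∫⁻ s, nsq c.Γ₁ (noiseX P φh z s) ∂P
        + ENNReal.ofReal (4 / 3 * a ^ 2 * (2 * c.Theta - c.θ ^ 2))
          * ∫⁻ s, nsq c.Γ₂ (noiseY P φh z s) ∂P :=
        add_le_add (mul_le_mul_left (ENNReal.ofReal_le_ofReal h1) _)
          (mul_le_mul_left (ENNReal.ofReal_le_ofReal h2) _)
    _ ≤ _ := by
        rw [← mul_add, ENNReal.ofReal_mul' (sq_nonneg c.σ)]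
        exact mul_le_mul_right (lintegral_nsq_noise_le h ho z) _

end ErrorVectors

/-! ### Random iterates -/

/-- The standing data: the assumptions, the oracle, the stepsizes, a random run and its sampling. -/
structure Context {n r : ℕ} {Ω Ξ : Type*} [MeasurableSpace Ω] [MeasurableSpace Ξ]
    (μ : Measure Ω) (P : Measure Ξ) (f : Vec (Fin n) → EReal) (g : Vec (Fin r) → EReal)
    (φh : Vec (Fin n ⊕ Fin r) → Ξ → ℝ) (c : Constants n r) (α : ℕ → ℝ) (ξ : Fin 3 → ℕ → Ω → Ξ)
    (x xh xb : ℤ → Ω → Vec (Fin n)) (y yh yb : ℤ → Ω → Vec (Fin r)) (κ : Ω → ℕ) : Prop where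
  assump : Assumptions P f g φh c
  oracle : Oracle P φh
  alpha : ∀ k, 0 < α k ∧ α k < 1
  run : ∀ ω, IsRun f g φh c α (fun i k => ξ i k ω) (fun k => x k ω) (fun k => xh k ω)
    (fun k => xb k ω) (fun k => y k ω) (fun k => yh k ω) (fun k => yb k ω)
  sampling : Sampling μ P ξ (fun ω => (x 0 ω, y 0 ω, xh (-1) ω, yh (-1) ω)) κ

/-- Measurability, for a given `σ`-algebra, of the variables from which step `k` is computed. -/
structure MeasurableState {n r : ℕ} {Ω : Type*} [MeasurableSpace Ω]
    (x xh xb : ℤ → Ω → Vec (Fin n)) (y yh : ℤ → Ω → Vec (Fin r)) (k : ℤ) : Prop where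
  cur_x : Measurable (x k)
  cur_y : Measurable (y k)
  prev_x : Measurable (x (k - 1))
  prev_y : Measurable (y (k - 1))
  prev_xh : Measurable (xh (k - 1))
  prev_yh : Measurable (yh (k - 1))
  prev_xb : Measurable (xb (k - 1))

lemma MeasurableState.mono {n r : ℕ} {Ω : Type*} {m m' : MeasurableSpace Ω} (hm : m ≤ m')
    {x xh xb : ℤ → Ω → Vec (Fin n)} {y yh : ℤ → Ω → Vec (Fin r)} {k : ℤ}
    (h : @MeasurableState n r Ω m x xh xb y yh k) : @MeasurableState n r Ω m' x xh xb y yh k := by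
  obtain ⟨h₁, h₂, h₃, h₄, h₅, h₆, h₇⟩ := h
  exact @MeasurableState.mk _ _ _ m' _ _ _ _ _ _ (h₁.mono hm le_rfl) (h₂.mono hm le_rfl)
    (h₃.mono hm le_rfl) (h₄.mono hm le_rfl) (h₅.mono hm le_rfl) (h₆.mono hm le_rfl)
    (h₇.mono hm le_rfl)

lemma measurable_sampled_gradX {n r : ℕ} {Ω Ξ : Type*} {mΩ : MeasurableSpace Ω} [MeasurableSpace Ξ]
    {P : Measure Ξ} {f : Vec (Fin n) → EReal} {g : Vec (Fin r) → EReal}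
    {φh : Vec (Fin n ⊕ Fin r) → Ξ → ℝ} {c : Constants n r} (h : Assumptions P f g φh c)
    (ho : Oracle P φh) {z : Ω → Vec (Fin n ⊕ Fin r)} (hz : Measurable z) {s : Ω → Ξ}
    (hs : Measurable s) : Measurable fun ω => gradX (fun w => φh w (s ω)) (z ω) :=
  (measurable_gradX_uncurry ho.measurable h.phih_C1).comp (hz.prodMk hs)

lemma measurable_sampled_gradY {n r : ℕ} {Ω Ξ : Type*} {mΩ : MeasurableSpace Ω} [MeasurableSpace Ξ]
    {P : Measure Ξ} {f : Vec (Fin n) → EReal} {g : Vec (Fin r) → EReal}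
    {φh : Vec (Fin n ⊕ Fin r) → Ξ → ℝ} {c : Constants n r} (h : Assumptions P f g φh c)
    (ho : Oracle P φh) {z : Ω → Vec (Fin n ⊕ Fin r)} (hz : Measurable z) {s : Ω → Ξ}
    (hs : Measurable s) : Measurable fun ω => gradY (fun w => φh w (s ω)) (z ω) :=
  (measurable_gradY_uncurry ho.measurable h.phih_C1).comp (hz.prodMk hs)

namespace Assumptions

variable {n r : ℕ} {Ω Ξ : Type*} {mΩ : MeasurableSpace Ω} [MeasurableSpace Ξ]
  {P : Measure Ξ} {f : Vec (Fin n) → EReal} {g : Vec (Fin r) → EReal}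
  {φh : Vec (Fin n ⊕ Fin r) → Ξ → ℝ} {c : Constants n r}

lemma measurable_gradX (h : Assumptions P f g φh c) : Measurable (gradX (meanFn P φh)) :=
  (continuous_gradX h.phi_C1).measurable

lemma measurable_gradY (h : Assumptions P f g φh c) : Measurable (gradY (meanFn P φh)) :=
  (continuous_gradY h.phi_C1).measurable

lemma measurable_noiseX (h : Assumptions P f g φh c) (ho : Oracle P φh)
    {z : Ω → Vec (Fin n ⊕ Fin r)} (hz : Measurable z) {s : Ω → Ξ} (hs : Measurable s) :
    Measurable fun ω => noiseX P φh (z ω) (s ω) :=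
  (measurable_sampled_gradX h ho hz hs).sub (h.measurable_gradX.comp hz)

lemma measurable_noiseY (h : Assumptions P f g φh c) (ho : Oracle P φh)
    {z : Ω → Vec (Fin n ⊕ Fin r)} (hz : Measurable z) {s : Ω → Ξ} (hs : Measurable s) :
    Measurable fun ω => noiseY P φh (z ω) (s ω) :=
  (measurable_sampled_gradY h ho hz hs).sub (h.measurable_gradY.comp hz)

lemma measurable_errX (h : Assumptions P f g φh c) {x xh : Ω → Vec (Fin n)} {y : Ω → Vec (Fin r)}
    (hx : Measurable x) (hxh : Measurable xh) (hy : Measurable y) :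
    Measurable fun ω => errX P φh c (x ω) (xh ω) (y ω) := by
  have h1 : Measurable fun ω => gradX (meanFn P φh) (pair (x ω) (y ω)) :=
    h.measurable_gradX.comp (hx.vecPair hy)
  simp only [errX]
  fun_prop

lemma measurable_errY (h : Assumptions P f g φh c) {x xb : Ω → Vec (Fin n)}
    {y yh : Ω → Vec (Fin r)} (hx : Measurable x) (hxb : Measurable xb) (hy : Measurable y)
    (hyh : Measurable yh) : Measurable fun ω => errY P φh c (x ω) (xb ω) (y ω) (yh ω) := by
  have h1 : Measurable fun ω => gradY (meanFn P φh) (pair (x ω) (y ω)) :=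
    h.measurable_gradY.comp (hx.vecPair hy)
  have h2 : Measurable fun ω => gradY (meanFn P φh) (pair (xb ω) (y ω)) :=
    h.measurable_gradY.comp (hxb.vecPair hy)
  simp only [errY]
  fun_prop

lemma measurable_resid (h : Assumptions P f g φh c) {xh xb : Ω → Vec (Fin n)}
    {yh yb : Ω → Vec (Fin r)} (hxh : Measurable xh) (hxb : Measurable xb) (hyh : Measurable yh)
    (hyb : Measurable yb) : Measurable fun ω => resid P φh c (xh ω) (xb ω) (yh ω) (yb ω) := by
  have h1 : Measurable fun ω => gradX (meanFn P φh) (pair (xb ω) (yb ω)) :=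
    h.measurable_gradX.comp (hxb.vecPair hyb)
  have h2 : Measurable fun ω => gradY (meanFn P φh) (pair (xb ω) (yb ω)) :=
    h.measurable_gradY.comp (hxb.vecPair hyb)
  simp only [resid, opF]
  fun_prop

end Assumptions

section MeasurableRun

variable {n r : ℕ} {Ω Ξ : Type*} [MeasurableSpace Ω] [MeasurableSpace Ξ]
  {P : Measure Ξ} {f : Vec (Fin n) → EReal} {g : Vec (Fin r) → EReal}
  {φh : Vec (Fin n ⊕ Fin r) → Ξ → ℝ} {c : Constants n r} {α : ℕ → ℝ} {ξ : Fin 3 → ℕ → Ω → Ξ}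
  {x xh xb : ℤ → Ω → Vec (Fin n)} {y yh yb : ℤ → Ω → Vec (Fin r)}

lemma measurable_xb (h : Assumptions P f g φh c) {k : ℤ}
    (hp : ∀ ω, IsProx f c.Γ₁⁻¹ (xh k ω) (xb k ω)) (hxh : Measurable (xh k)) :
    Measurable (xb k) := by
  obtain ⟨G, hG, hG'⟩ := exists_measurable_prox h.f_conv h.Γ₁_pos.inv
  have : xb k = fun ω => G (xh k ω) := funext fun ω => hG' _ _ (hp ω)
  rw [this]
  exact hG.comp hxh

lemma measurable_yb (h : Assumptions P f g φh c) {k : ℤ}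
    (hp : ∀ ω, IsProx g c.Γ₂⁻¹ (yh k ω) (yb k ω)) (hyh : Measurable (yh k)) :
    Measurable (yb k) := by
  obtain ⟨G, hG, hG'⟩ := exists_measurable_prox h.g_conv h.Γ₂_pos.inv
  have : yb k = fun ω => G (yh k ω) := funext fun ω => hG' _ _ (hp ω)
  rw [this]
  exact hG.comp hyh

lemma measurable_xh_step (h : Assumptions P f g φh c) (ho : Oracle P φh)
    (hrun : ∀ ω, IsRun f g φh c α (fun i k => ξ i k ω)
      (fun k => x k ω) (fun k => xh k ω) (fun k => xb k ω)
      (fun k => y k ω) (fun k => yh k ω) (fun k => yb k ω))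
    {k : ℕ} (hs : MeasurableState x xh xb y yh k) (hξ : Measurable (ξ 0 k)) :
    Measurable (xh k) := by
  have h1 := measurable_sampled_gradX h ho (hs.cur_x.vecPair hs.cur_y) hξ
  have h2 := measurable_sampled_gradX h ho (hs.prev_x.vecPair hs.prev_y) hξ
  have h3 := hs.cur_x
  have h4 := hs.prev_x
  have h5 := hs.prev_xh
  rw [show xh k = _ from funext fun ω => (hrun ω).step_xh k]
  fun_prop

lemma measurable_yh_step (h : Assumptions P f g φh c) (ho : Oracle P φh)
    (hrun : ∀ ω, IsRun f g φh c α (fun i k => ξ i k ω)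
      (fun k => x k ω) (fun k => xh k ω) (fun k => xb k ω)
      (fun k => y k ω) (fun k => yh k ω) (fun k => yb k ω))
    {k : ℕ} (hs : MeasurableState x xh xb y yh k) (hξ : Measurable (ξ 0 k))
    (hξ' : Measurable (ξ 1 k)) : Measurable (yh k) := by
  have h0 := measurable_xb h (fun ω => (hrun ω).step_xb k) (measurable_xh_step h ho hrun hs hξ)
  have h1 := measurable_sampled_gradY h ho (hs.cur_x.vecPair hs.cur_y) hξ
  have h2 := measurable_sampled_gradY h ho (hs.prev_x.vecPair hs.prev_y) hξ
  have h3 := measurable_sampled_gradY h ho (h0.vecPair hs.cur_y) hξ'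
  have h4 := measurable_sampled_gradY h ho (hs.prev_xb.vecPair hs.prev_y) hξ'
  have h5 := hs.cur_y
  have h6 := hs.prev_y
  have h7 := hs.prev_yh
  rw [show yh k = _ from funext fun ω => (hrun ω).step_yh k]
  fun_prop

lemma measurableState_zero (h : Assumptions P f g φh c)
    (hrun : ∀ ω, IsRun f g φh c α (fun i k => ξ i k ω)
      (fun k => x k ω) (fun k => xh k ω) (fun k => xb k ω)
      (fun k => y k ω) (fun k => yh k ω) (fun k => yb k ω))
    (hi : Measurable fun ω => (x 0 ω, y 0 ω, xh (-1) ω, yh (-1) ω)) :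
    MeasurableState x xh xb y yh 0 := by
  have hx : Measurable (x 0) := measurable_fst.comp hi
  have hy : Measurable (y 0) := measurable_fst.comp (measurable_snd.comp hi)
  have hxh : Measurable (xh (-1)) :=
    measurable_fst.comp (measurable_snd.comp (measurable_snd.comp hi))
  have hyh : Measurable (yh (-1)) :=
    measurable_snd.comp (measurable_snd.comp (measurable_snd.comp hi))
  have ex : x (-1) = x 0 := funext fun ω => (hrun ω).init_x
  have ey : y (-1) = y 0 := funext fun ω => (hrun ω).init_y
  refine ⟨hx, hy, ?_, ?_, ?_, ?_, ?_⟩ <;> rw [zero_sub]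
  · rwa [ex]
  · rwa [ey]
  · exact hxh
  · exact hyh
  · exact measurable_xb h (fun ω => (hrun ω).init_xb) hxh

lemma measurableState_succ (h : Assumptions P f g φh c) (ho : Oracle P φh)
    (hrun : ∀ ω, IsRun f g φh c α (fun i k => ξ i k ω)
      (fun k => x k ω) (fun k => xh k ω) (fun k => xb k ω)
      (fun k => y k ω) (fun k => yh k ω) (fun k => yb k ω))
    {k : ℕ} (hs : MeasurableState x xh xb y yh k) (h0 : Measurable (ξ 0 k))
    (h1 : Measurable (ξ 1 k)) (h2 : Measurable (ξ 2 k)) :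
    MeasurableState x xh xb y yh (k + 1) := by
  have hxh := measurable_xh_step h ho hrun hs h0
  have hyh := measurable_yh_step h ho hrun hs h0 h1
  have hxb := measurable_xb h (fun ω => (hrun ω).step_xb k) hxh
  have hyb := measurable_yb h (fun ω => (hrun ω).step_yb k) hyh
  have g1 := measurable_sampled_gradX h ho (hxb.vecPair hyb) h2
  have g2 := measurable_sampled_gradY h ho (hxb.vecPair hyb) h2
  have hx := hs.cur_x
  have hy := hs.cur_y
  refine ⟨?_, ?_, ?_, ?_, ?_, ?_, ?_⟩
  · rw [show x (k + 1) = _ from funext fun ω => (hrun ω).step_x k]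
    fun_prop
  · rw [show y (k + 1) = _ from funext fun ω => (hrun ω).step_y k]
    fun_prop
  all_goals rw [add_sub_cancel_right]; assumption

end MeasurableRun

namespace Context

variable {n r : ℕ} {Ω Ξ : Type*} {mΩ : MeasurableSpace Ω} [MeasurableSpace Ξ]
  {μ : Measure Ω} {P : Measure Ξ} {f : Vec (Fin n) → EReal} {g : Vec (Fin r) → EReal}
  {φh : Vec (Fin n ⊕ Fin r) → Ξ → ℝ} {c : Constants n r} {α : ℕ → ℝ} {ξ : Fin 3 → ℕ → Ω → Ξ}
  {x xh xb : ℤ → Ω → Vec (Fin n)} {y yh yb : ℤ → Ω → Vec (Fin r)} {κ : Ω → ℕ}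

/-- The history of the run before the sample `ξ i k` is drawn. -/
abbrev before (ξ : Fin 3 → ℕ → Ω → Ξ) (x xh : ℤ → Ω → Vec (Fin n)) (y yh : ℤ → Ω → Vec (Fin r))
    (i k : ℕ) : MeasurableSpace Ω :=
  hist ξ (fun ω => (x 0 ω, y 0 ω, xh (-1) ω, yh (-1) ω)) (past i k)

lemma measurable_before_sample (ξ : Fin 3 → ℕ → Ω → Ξ) (x xh : ℤ → Ω → Vec (Fin n))
    (y yh : ℤ → Ω → Vec (Fin r)) {i : Fin 3} {j : ℕ} (h : i.val < j) (k : ℕ) :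
    Measurable[before ξ x xh y yh j k] (ξ i k) :=
  measurable_hist_sample (mem_past.2 (Or.inr ⟨rfl, h⟩))

lemma before_mono (ξ : Fin 3 → ℕ → Ω → Ξ) (x xh : ℤ → Ω → Vec (Fin n))
    (y yh : ℤ → Ω → Vec (Fin r)) {i j : ℕ} (h : i ≤ j) (k : ℕ) :
    before ξ x xh y yh i k ≤ before ξ x xh y yh j k := hist_mono (past_mono h)

/-- The variables entering step `k` are functions of the initial data and of earlier samples. -/
lemma measurableState (H : Context μ P f g φh c α ξ x xh xb y yh yb κ) (k : ℕ) :
    @MeasurableState n r Ω (before ξ x xh y yh 0 k) x xh xb y yh k := by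
  induction k with
  | zero =>
    exact @measurableState_zero n r Ω Ξ (before ξ x xh y yh 0 0) _ P f g φh c α ξ x xh xb
      y yh yb H.assump H.run (measurable_hist_init _)
  | succ k ih =>
    have key := @measurableState_succ n r Ω Ξ (before ξ x xh y yh 3 k) _ P f g φh c α ξ x xh xb
      y yh yb H.assump H.oracle H.run k (ih.mono (before_mono ξ x xh y yh (by norm_num) k))
      (measurable_before_sample ξ x xh y yh (by decide) k)
      (measurable_before_sample ξ x xh y yh (by decide) k)
      (measurable_before_sample ξ x xh y yh (by decide) k)
    have := key.mono (hist_mono (past_subset_succ k))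
    exact_mod_cast this

lemma measurableState_one (H : Context μ P f g φh c α ξ x xh xb y yh yb κ) (k : ℕ) :
    @MeasurableState n r Ω (before ξ x xh y yh 1 k) x xh xb y yh k :=
  (H.measurableState k).mono (before_mono ξ x xh y yh zero_le_one k)

lemma measurableState_two (H : Context μ P f g φh c α ξ x xh xb y yh yb κ) (k : ℕ) :
    @MeasurableState n r Ω (before ξ x xh y yh 2 k) x xh xb y yh k :=
  (H.measurableState k).mono (before_mono ξ x xh y yh zero_le_two k)

lemma measurable_xh (H : Context μ P f g φh c α ξ x xh xb y yh yb κ) (k : ℕ) :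
    Measurable[before ξ x xh y yh 1 k] (xh k) :=
  @measurable_xh_step n r Ω Ξ (before ξ x xh y yh 1 k) _ P f g φh c α ξ x xh xb y yh yb
    H.assump H.oracle H.run k (H.measurableState_one k)
    (measurable_before_sample ξ x xh y yh (by decide) k)

lemma measurable_xb (H : Context μ P f g φh c α ξ x xh xb y yh yb κ) (k : ℕ) :
    Measurable[before ξ x xh y yh 1 k] (xb k) :=
  @NPPDEG.measurable_xb n r Ω Ξ (before ξ x xh y yh 1 k) _ P f g φh c xh xb
    H.assump k (fun ω => (H.run ω).step_xb k) (H.measurable_xh k)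

lemma measurable_yh (H : Context μ P f g φh c α ξ x xh xb y yh yb κ) (k : ℕ) :
    Measurable[before ξ x xh y yh 2 k] (yh k) :=
  @measurable_yh_step n r Ω Ξ (before ξ x xh y yh 2 k) _ P f g φh c α ξ x xh xb y yh yb
    H.assump H.oracle H.run k (H.measurableState_two k)
    (measurable_before_sample ξ x xh y yh (by decide) k)
    (measurable_before_sample ξ x xh y yh (by decide) k)

lemma measurable_yb (H : Context μ P f g φh c α ξ x xh xb y yh yb κ) (k : ℕ) :
    Measurable[before ξ x xh y yh 2 k] (yb k) :=
  @NPPDEG.measurable_yb n r Ω Ξ (before ξ x xh y yh 2 k) _ P f g φh c yh yb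
    H.assump k (fun ω => (H.run ω).step_yb k) (H.measurable_yh k)

lemma measurable_resid (H : Context μ P f g φh c α ξ x xh xb y yh yb κ) (k : ℕ) :
    Measurable[before ξ x xh y yh 2 k]
      (fun ω => resid P φh c (xh k ω) (xb k ω) (yh k ω) (yb k ω)) :=
  @Assumptions.measurable_resid n r Ω Ξ (before ξ x xh y yh 2 k) _ P f g φh c H.assump _ _ _ _
    ((H.measurable_xh k).mono (before_mono ξ x xh y yh one_le_two k) le_rfl)
    ((H.measurable_xb k).mono (before_mono ξ x xh y yh one_le_two k) le_rfl)
    (H.measurable_yh k) (H.measurable_yb k)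

lemma before_le (H : Context μ P f g φh c α ξ x xh xb y yh yb κ) (i k : ℕ) :
    before ξ x xh y yh i k ≤ mΩ := H.sampling.hist_le _

end Context

/-! ### Recursions in expectation -/

section Expectations

variable {n r : ℕ} {Ω Ξ : Type*} [MeasurableSpace Ω] [MeasurableSpace Ξ]

/-- `𝔼 ‖Γ⁻¹ ẑ^k - S_{z^k}(z^k; z̄^k)‖_Γ²`. -/
def meanErr (μ : Measure Ω) (P : Measure Ξ) (φh : Vec (Fin n ⊕ Fin r) → Ξ → ℝ) (c : Constants n r)
    (x xh xb : ℤ → Ω → Vec (Fin n)) (y yh : ℤ → Ω → Vec (Fin r)) (k : ℤ) : ℝ≥0∞ :=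
  ∫⁻ ω, (nsq c.Γ₁ (errX P φh c (x k ω) (xh k ω) (y k ω))
    + nsq c.Γ₂ (errY P φh c (x k ω) (xb k ω) (y k ω) (yh k ω))) ∂μ

/-- `𝔼 ‖z^k - z^{k-1}‖²` in the norm of `Γ⁻¹`. -/
def meanMove (μ : Measure Ω) (c : Constants n r) (x : ℤ → Ω → Vec (Fin n))
    (y : ℤ → Ω → Vec (Fin r)) (k : ℤ) : ℝ≥0∞ :=
  ∫⁻ ω, nsq c.Γ⁻¹ (pair (x k ω) (y k ω) - pair (x (k - 1) ω) (y (k - 1) ω)) ∂μ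

/-- `𝔼 ‖Γ⁻¹ ẑ^k - S_{z^k}(z̄^k; z̄^k)‖_Γ²`. -/
def meanResid (μ : Measure Ω) (P : Measure Ξ) (φh : Vec (Fin n ⊕ Fin r) → Ξ → ℝ)
    (c : Constants n r) (xh xb : ℤ → Ω → Vec (Fin n)) (yh yb : ℤ → Ω → Vec (Fin r)) (k : ℤ) :
    ℝ≥0∞ :=
  ∫⁻ ω, nsq c.Γ (resid P φh c (xh k ω) (xb k ω) (yh k ω) (yb k ω)) ∂μ

/-- `𝔼 ‖z^k - z⋆‖²` in the norm of `Γ⁻¹`. -/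
def meanDist (μ : Measure Ω) (c : Constants n r) (x : ℤ → Ω → Vec (Fin n))
    (y : ℤ → Ω → Vec (Fin r)) (zs : Vec (Fin n ⊕ Fin r)) (k : ℤ) : ℝ≥0∞ :=
  ∫⁻ ω, nsq c.Γ⁻¹ (pair (x k ω) (y k ω) - zs) ∂μ

end Expectations

namespace Context

variable {n r : ℕ} {Ω Ξ : Type*} {mΩ : MeasurableSpace Ω} [MeasurableSpace Ξ]
  {μ : Measure Ω} {P : Measure Ξ}
  {f : Vec (Fin n) → EReal} {g : Vec (Fin r) → EReal}
  {φh : Vec (Fin n ⊕ Fin r) → Ξ → ℝ} {c : Constants n r} {α : ℕ → ℝ} {ξ : Fin 3 → ℕ → Ω → Ξ}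
  {x xh xb : ℤ → Ω → Vec (Fin n)} {y yh yb : ℤ → Ω → Vec (Fin r)} {κ : Ω → ℕ}

lemma pair_next_eq (H : Context μ P f g φh c α ξ x xh xb y yh yb κ) (k : ℕ) (ω : Ω) :
    pair (x (k + 1) ω) (y (k + 1) ω) = pair (x k ω) (y k ω)
      - α k • act c.Γ (resid P φh c (xh k ω) (xb k ω) (yh k ω) (yb k ω))
      + (-α k) • act c.Γ (opF (fun w => φh w (ξ 2 k ω)) (pair (xb k ω) (yb k ω))
        - opF (meanFn P φh) (pair (xb k ω) (yb k ω))) :=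
  pair_step H.assump.Γ₁_pos H.assump.Γ₂_pos ((H.run ω).step_x k) ((H.run ω).step_y k)

variable [IsProbabilityMeasure μ] [IsProbabilityMeasure P]

/-- The contribution of the noise at `z̄^k` to the second moment of an affine function of
`z^{k+1}`. -/
lemma lintegral_nsq_next_le (H : Context μ P f g φh c α ξ x xh xb y yh yb κ) (k : ℕ)
    {U : Ω → Vec (Fin n ⊕ Fin r)} (hU : Measurable[before ξ x xh y yh 2 k] U) :
    ∫⁻ ω, nsq c.Γ⁻¹ (U ω - α k • act c.Γ (resid P φh c (xh k ω) (xb k ω) (yh k ω) (yb k ω))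
        + (-α k) • act c.Γ (opF (fun w => φh w (ξ 2 k ω)) (pair (xb k ω) (yb k ω))
          - opF (meanFn P φh) (pair (xb k ω) (yb k ω)))) ∂μ
      ≤ ∫⁻ ω, nsq c.Γ⁻¹ (U ω
          - α k • act c.Γ (resid P φh c (xh k ω) (xb k ω) (yh k ω) (yb k ω))) ∂μ
        + ENNReal.ofReal (α k ^ 2 * c.σ ^ 2) := by
  set X : Ω → Vec (Fin n ⊕ Fin r) × Vec (Fin n ⊕ Fin r) := fun ω =>
    (U ω - α k • act c.Γ (resid P φh c (xh k ω) (xb k ω) (yh k ω) (yb k ω)),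
      pair (xb k ω) (yb k ω)) with hX
  have hXm : Measurable[before ξ x xh y yh 2 k] X := by
    have h1 := H.measurable_resid k
    have h2 := (H.measurable_xb k).mono (before_mono ξ x xh y yh one_le_two k) le_rfl
    have h3 := H.measurable_yb k
    have h4 := ((measurable_act c.Γ).comp h1).const_smul (α k)
    exact Measurable.prodMk (hU.sub h4) (h2.vecPair h3)
  set Φ : (Vec (Fin n ⊕ Fin r) × Vec (Fin n ⊕ Fin r)) × Ξ → ℝ≥0∞ := fun p =>
    nsq c.Γ⁻¹ (p.1.1 + (-α k) • act c.Γ (opF (fun w => φh w p.2) p.1.2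
      - opF (meanFn P φh) p.1.2)) with hΦ
  have hΦm : Measurable Φ := by
    have h1 := H.assump.measurable_noiseX H.oracle
      (z := fun p : (Vec (Fin n ⊕ Fin r) × Vec (Fin n ⊕ Fin r)) × Ξ => p.1.2)
      (by fun_prop) measurable_snd
    have h2 := H.assump.measurable_noiseY H.oracle
      (z := fun p : (Vec (Fin n ⊕ Fin r) × Vec (Fin n ⊕ Fin r)) × Ξ => p.1.2)
      (by fun_prop) measurable_snd
    simp only [hΦ, opF_sub_opF]
    fun_prop
  have key := H.sampling.lintegral_fresh (P := P) hXm (i := 2) (k := k)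
    (by rw [mem_past]; simp) hΦm
  refine (le_of_eq key).trans ((lintegral_mono fun ω =>
    lintegral_nsq_step_le H.assump H.oracle (α k) (X ω).1 (X ω).2).trans ?_)
  rw [lintegral_add_right _ measurable_const]
  simp [hX]

/-- One step moves `z` by the residual and the noise. -/
lemma meanMove_succ_le (H : Context μ P f g φh c α ξ x xh xb y yh yb κ) (k : ℕ) :
    meanMove μ c x y (k + 1) ≤ ENNReal.ofReal (α k ^ 2) * meanResid μ P φh c xh xb yh yb k
      + ENNReal.ofReal (α k ^ 2 * c.σ ^ 2) := by
  have h1 := H.lintegral_nsq_next_le k (U := fun _ => 0) measurable_const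
  refine le_trans (le_of_eq (lintegral_congr fun ω => ?_)) (h1.trans (add_le_add ?_ le_rfl))
  · rw [add_sub_cancel_right, H.pair_next_eq k ω]
    congr 1
    abel
  · rw [meanResid, ← lintegral_const_mul' _ _ ENNReal.ofReal_ne_top]
    refine le_of_eq (lintegral_congr fun ω => ?_)
    rw [zero_sub, nsq, wsq_neg, ← nsq, nsq_smul, nsq, wsq_inv_act H.assump.Γ_pos, ← nsq]

/-- The descent inequality in expectation. -/
lemma meanDist_succ_le (H : Context μ P f g φh c α ξ x xh xb y yh yb κ)
    {S : Set (Vec (Fin n ⊕ Fin r))} {ρ : ℝ}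
    (hminty : WeakMVI (opT f g (meanFn P φh)) S ρ) {zs : Vec (Fin n ⊕ Fin r)} (hzs : zs ∈ S)
    {b ε e m : ℝ} (hb : 0 < b) (hε : 0 < ε) (hκ : 0 ≤ 1 - 1 / (ε * (1 - c.LM) ^ 2))
    (he : e = ε + 1 / b * (1 - 1 / (ε * (1 - c.LM) ^ 2)))
    (hm : m = 1 / (1 + b) * (1 - 1 / (ε * (1 - c.LM) ^ 2)) + 2 * ρ / c.gbar ρ) (k : ℕ)
    (hmk : 0 ≤ m - α k) :
    meanDist μ c x y zs (k + 1)
        + ENNReal.ofReal (α k * (m - α k)) * meanResid μ P φh c xh xb yh yb k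
      ≤ meanDist μ c x y zs k + ENNReal.ofReal (α k * e) * meanErr μ P φh c x xh xb y yh k
        + ENNReal.ofReal (α k ^ 2 * c.σ ^ 2) := by
  have hα := (H.alpha k).1
  have he0 : 0 ≤ e := by
    rw [he]
    positivity
  obtain ⟨hx, hy, -⟩ := H.measurableState_two k
  have hUm : Measurable[before ξ x xh y yh 2 k] (fun ω => pair (x k ω) (y k ω)) :=
    hx.vecPair hy
  have h1 := H.lintegral_nsq_next_le k (U := fun ω => pair (x k ω) (y k ω) - zs)
    (hUm.sub measurable_const)
  have h2 : meanDist μ c x y zs (k + 1) ≤ ∫⁻ ω, nsq c.Γ⁻¹ (pair (x k ω) (y k ω) - zs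
      - α k • act c.Γ (resid P φh c (xh k ω) (xb k ω) (yh k ω) (yb k ω))) ∂μ
      + ENNReal.ofReal (α k ^ 2 * c.σ ^ 2) := by
    refine le_trans (le_of_eq (lintegral_congr fun ω => ?_)) h1
    rw [H.pair_next_eq k ω]
    congr 1
    abel
  have hDm : Measurable (fun ω => nsq c.Γ⁻¹ (pair (x k ω) (y k ω) - zs)) :=
    (measurable_nsq _).comp ((hUm.sub measurable_const).mono (H.before_le 2 k) le_rfl)
  have hRm : Measurable
      (fun ω => nsq c.Γ (resid P φh c (xh k ω) (xb k ω) (yh k ω) (yb k ω))) :=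
    (measurable_nsq _).comp ((H.measurable_resid k).mono (H.before_le 2 k) le_rfl)
  have h3 : ∫⁻ ω, nsq c.Γ⁻¹ (pair (x k ω) (y k ω) - zs
      - α k • act c.Γ (resid P φh c (xh k ω) (xb k ω) (yh k ω) (yb k ω))) ∂μ
        + ENNReal.ofReal (α k * (m - α k)) * meanResid μ P φh c xh xb yh yb k
      ≤ meanDist μ c x y zs k + ENNReal.ofReal (α k * e) * meanErr μ P φh c x xh xb y yh k := by
    rw [meanResid, meanDist, meanErr, ← lintegral_const_mul' _ _ ENNReal.ofReal_ne_top,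
      ← lintegral_const_mul' _ _ ENNReal.ofReal_ne_top,
      ← lintegral_add_right _ (hRm.const_mul _), ← lintegral_add_left hDm]
    refine lintegral_mono fun ω => ?_
    have hstep := wsq_step_le H.assump hminty hzs hb hε hκ hα.le
      (z := pair (x k ω) (y k ω)) (sub_opS_eq_pair_err (P := P) (φh := φh) H.assump.Γ₁_pos
        H.assump.Γ₂_pos (x k ω) (xh k ω) (xb k ω) (y k ω) (yh k ω) (yb k ω)).symm
      (sub_opS_eq_resid (P := P) (φh := φh) H.assump.Γ₁_pos H.assump.Γ₂_pos _ _ _ _ _).symm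
      (resid_mem_opT H.assump ((H.run ω).step_xb k) ((H.run ω).step_yb k))
    rw [← hm, ← he] at hstep
    rw [← nsq_Γ_pair H.assump]
    have n1 : ∀ v, 0 ≤ wsq c.Γ v := wsq_nonneg H.assump.Γ_pos.posSemidef
    have n2 : ∀ v, 0 ≤ wsq c.Γ⁻¹ v := wsq_nonneg H.assump.Γ_pos.inv.posSemidef
    simp only [nsq]
    rw [← ENNReal.ofReal_mul (by positivity), ← ENNReal.ofReal_mul (by positivity),
      ← ENNReal.ofReal_add (n2 _) (mul_nonneg (by positivity) (n1 _)),
      ← ENNReal.ofReal_add (n2 _) (mul_nonneg (by positivity) (n1 _))]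
    exact ENNReal.ofReal_le_ofReal hstep
  calc _ ≤ (∫⁻ ω, nsq c.Γ⁻¹ (pair (x k ω) (y k ω) - zs
        - α k • act c.Γ (resid P φh c (xh k ω) (xb k ω) (yh k ω) (yb k ω))) ∂μ
        + ENNReal.ofReal (α k ^ 2 * c.σ ^ 2))
        + ENNReal.ofReal (α k * (m - α k)) * meanResid μ P φh c xh xb yh yb k :=
        add_le_add h2 le_rfl
    _ = _ := add_right_comm _ _ _
    _ ≤ _ := add_le_add h3 le_rfl

end Context

/-! ### The recursion for the estimation error -/

section StateBounds

variable {n r : ℕ} {Ξ : Type*} [MeasurableSpace Ξ] {P : Measure Ξ} [IsProbabilityMeasure P]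
  {f : Vec (Fin n) → EReal} {g : Vec (Fin r) → EReal} {φh : Vec (Fin n ⊕ Fin r) → Ξ → ℝ}
  {c : Constants n r}

lemma lintegral_nsq_errX_update_le (h : Assumptions P f g φh c) (ho : Oracle P φh) (a : ℝ)
    (d : Vec (Fin n)) (z z₀ : Vec (Fin n ⊕ Fin r)) :
    ∫⁻ s, nsq c.Γ₁ ((1 - a) • d + -(noiseX P φh z s - (1 - a) • noiseX P φh z₀ s)) ∂P
      ≤ ENNReal.ofReal ((1 - a) ^ 2) * nsq c.Γ₁ d
        + (ENNReal.ofReal (4 / 3 * a ^ 2) * ∫⁻ s, nsq c.Γ₁ (noiseX P φh z s) ∂P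
          + ENNReal.ofReal (4 * (1 - a) ^ 2 * c.c3) * nsq c.Γ⁻¹ (z - z₀)) := by
  have hi1 := integrable_noiseX ho z
  have hi0 : Integrable (fun s => (1 - a) • noiseX P φh z₀ s) P :=
    (integrable_noiseX ho z₀).smul (1 - a)
  have hi : Integrable (fun s => -(noiseX P φh z s - (1 - a) • noiseX P φh z₀ s)) P :=
    (hi1.sub hi0).neg
  have h0 : ∫ s, -(noiseX P φh z s - (1 - a) • noiseX P φh z₀ s) ∂P = 0 := by
    rw [integral_neg, integral_sub hi1 hi0, integral_smul, integral_noiseX ho, integral_noiseX ho]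
    simp
  have h1 := lintegral_nsq_add_le h.Γ₁_pos.posSemidef hi h0 ((1 - a) • d)
  rw [nsq_smul] at h1
  refine h1.trans (add_le_add le_rfl ?_)
  refine le_trans (le_of_eq (lintegral_congr fun s => ?_))
    (lintegral_nsq_correctionX_le h ho a z z₀)
  rw [nsq, wsq_neg, nsq]

lemma lintegral_nsq_errY_update_le (h : Assumptions P f g φh c) (ho : Oracle P φh) (a : ℝ)
    (d : Vec (Fin r)) (z z₀ : Vec (Fin n ⊕ Fin r)) :
    ∫⁻ s, nsq c.Γ₂ ((1 - a) • d
        + (1 - c.θ) • (noiseY P φh z s - (1 - a) • noiseY P φh z₀ s)) ∂P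
      ≤ ENNReal.ofReal ((1 - a) ^ 2) * nsq c.Γ₂ d
        + (ENNReal.ofReal (4 / 3 * a ^ 2 * (1 - c.θ) ^ 2)
            * ∫⁻ s, nsq c.Γ₂ (noiseY P φh z s) ∂P
          + ENNReal.ofReal (4 * (1 - a) ^ 2 * ((1 - c.θ) ^ 2 * c.Lhyz ^ 2
            * specNorm (c.Γ * c.Dhyz))) * nsq c.Γ⁻¹ (z - z₀)) := by
  have hi1 := integrable_noiseY ho z
  have hi0 : Integrable (fun s => (1 - a) • noiseY P φh z₀ s) P :=
    (integrable_noiseY ho z₀).smul (1 - a)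
  have hi2 : Integrable (fun s => noiseY P φh z s - (1 - a) • noiseY P φh z₀ s) P := hi1.sub hi0
  have hi : Integrable (fun s => (1 - c.θ) • (noiseY P φh z s - (1 - a) • noiseY P φh z₀ s)) P :=
    hi2.smul (1 - c.θ)
  have h0 : ∫ s, (1 - c.θ) • (noiseY P φh z s - (1 - a) • noiseY P φh z₀ s) ∂P = 0 := by
    rw [integral_smul, integral_sub hi1 hi0, integral_smul, integral_noiseY ho,
      integral_noiseY ho]
    simp
  have h1 := lintegral_nsq_add_le h.Γ₂_pos.posSemidef hi h0 ((1 - a) • d)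
  rw [nsq_smul] at h1
  refine h1.trans (add_le_add le_rfl ?_)
  simp only [nsq_smul]
  rw [lintegral_const_mul'' _ (aemeasurable_nsq hi2 _)]
  exact lintegral_nsq_correctionY_le h ho a z z₀

end StateBounds

namespace Context

variable {n r : ℕ} {Ω Ξ : Type*} {mΩ : MeasurableSpace Ω} [MeasurableSpace Ξ]
  {μ : Measure Ω} {P : Measure Ξ} {f : Vec (Fin n) → EReal} {g : Vec (Fin r) → EReal}
  {φh : Vec (Fin n ⊕ Fin r) → Ξ → ℝ} {c : Constants n r} {α : ℕ → ℝ} {ξ : Fin 3 → ℕ → Ω → Ξ}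
  {x xh xb : ℤ → Ω → Vec (Fin n)} {y yh yb : ℤ → Ω → Vec (Fin r)} {κ : Ω → ℕ}

lemma measurable_prev_errX (H : Context μ P f g φh c α ξ x xh xb y yh yb κ) (k : ℕ) :
    Measurable[before ξ x xh y yh 0 k]
      (fun ω => errX P φh c (x (k - 1) ω) (xh (k - 1) ω) (y (k - 1) ω)) := by
  obtain ⟨-, -, hx, hy, hxh, -, -⟩ := H.measurableState k
  exact H.assump.measurable_errX hx hxh hy

lemma measurable_prev_errY (H : Context μ P f g φh c α ξ x xh xb y yh yb κ) (k : ℕ) :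
    Measurable[before ξ x xh y yh 0 k]
      (fun ω => errY P φh c (x (k - 1) ω) (xb (k - 1) ω) (y (k - 1) ω) (yh (k - 1) ω)) := by
  obtain ⟨-, -, hx, hy, -, hyh, hxb⟩ := H.measurableState k
  exact H.assump.measurable_errY hx hxb hy hyh

lemma measurable_pair (H : Context μ P f g φh c α ξ x xh xb y yh yb κ) (k : ℕ) :
    Measurable[before ξ x xh y yh 0 k] (fun ω => pair (x k ω) (y k ω)) := by
  obtain ⟨hx, hy, -⟩ := H.measurableState k
  exact hx.vecPair hy

lemma measurable_prev_pair (H : Context μ P f g φh c α ξ x xh xb y yh yb κ) (k : ℕ) :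
    Measurable[before ξ x xh y yh 0 k] (fun ω => pair (x (k - 1) ω) (y (k - 1) ω)) := by
  obtain ⟨-, -, hx, hy, -⟩ := H.measurableState k
  exact hx.vecPair hy

variable [IsProbabilityMeasure μ] [IsProbabilityMeasure P]

lemma lintegral_nsq_errX_le (H : Context μ P f g φh c α ξ x xh xb y yh yb κ) (k : ℕ) :
    ∫⁻ ω, nsq c.Γ₁ (errX P φh c (x k ω) (xh k ω) (y k ω)) ∂μ
      ≤ ∫⁻ ω, (ENNReal.ofReal ((1 - α k) ^ 2)
          * nsq c.Γ₁ (errX P φh c (x (k - 1) ω) (xh (k - 1) ω) (y (k - 1) ω))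
        + (ENNReal.ofReal (4 / 3 * α k ^ 2)
            * ∫⁻ s, nsq c.Γ₁ (noiseX P φh (pair (x k ω) (y k ω)) s) ∂P
          + ENNReal.ofReal (4 * (1 - α k) ^ 2 * c.c3)
            * nsq c.Γ⁻¹ (pair (x k ω) (y k ω) - pair (x (k - 1) ω) (y (k - 1) ω)))) ∂μ := by
  set Φ : (Vec (Fin n) × Vec (Fin n ⊕ Fin r) × Vec (Fin n ⊕ Fin r)) × Ξ → ℝ≥0∞ := fun p =>
    nsq c.Γ₁ ((1 - α k) • p.1.1
      + -(noiseX P φh p.1.2.1 p.2 - (1 - α k) • noiseX P φh p.1.2.2 p.2)) with hΦ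
  have hΦm : Measurable Φ := by
    have h1 := H.assump.measurable_noiseX H.oracle
      (z := fun p : (Vec (Fin n) × Vec (Fin n ⊕ Fin r) × Vec (Fin n ⊕ Fin r)) × Ξ => p.1.2.1)
      (by fun_prop) measurable_snd
    have h2 := H.assump.measurable_noiseX H.oracle
      (z := fun p : (Vec (Fin n) × Vec (Fin n ⊕ Fin r) × Vec (Fin n ⊕ Fin r)) × Ξ => p.1.2.2)
      (by fun_prop) measurable_snd
    simp only [hΦ]
    fun_prop
  have key := H.sampling.lintegral_fresh (P := P) (i := 0) (k := k)
    ((H.measurable_prev_errX k).prodMk ((H.measurable_pair k).prodMk (H.measurable_prev_pair k)))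
    (by rw [mem_past]; simp) hΦm
  refine le_trans (le_of_eq (lintegral_congr fun ω => ?_)) ((le_of_eq key).trans
    (lintegral_mono fun ω => lintegral_nsq_errX_update_le H.assump H.oracle (α k) _ _ _))
  rw [errX_step H.assump.Γ₁_pos ((H.run ω).step_xh k)]

lemma lintegral_nsq_displacement_le (H : Context μ P f g φh c α ξ x xh xb y yh yb κ) (k : ℕ) :
    ∫⁻ ω, nsq c.Γ₁⁻¹ (xb k ω - xb (k - 1) ω) ∂μ
      ≤ ∫⁻ ω, (ENNReal.ofReal (4 * (1 + c.c3))
            * nsq c.Γ⁻¹ (pair (x k ω) (y k ω) - pair (x (k - 1) ω) (y (k - 1) ω))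
        + ENNReal.ofReal (2 * α k ^ 2)
          * (nsq c.Γ₁ (errX P φh c (x (k - 1) ω) (xh (k - 1) ω) (y (k - 1) ω))
            + ENNReal.ofReal (c.σ ^ 2))) ∂μ := by
  set Φ : (Vec (Fin n) × Vec (Fin n ⊕ Fin r) × Vec (Fin n ⊕ Fin r)) × Ξ → ℝ≥0∞ := fun p =>
    nsq c.Γ₁⁻¹ ((fstV p.1.2.1 - fstV p.1.2.2)
        - act c.Γ₁ (gradX (fun w => φh w p.2) p.1.2.1 - gradX (fun w => φh w p.2) p.1.2.2)
        - α k • act c.Γ₁ (p.1.1 + noiseX P φh p.1.2.2 p.2)) with hΦ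
  have hΦm : Measurable Φ := by
    have h0 := H.assump.measurable_noiseX H.oracle
      (z := fun p : (Vec (Fin n) × Vec (Fin n ⊕ Fin r) × Vec (Fin n ⊕ Fin r)) × Ξ => p.1.2.2)
      (by fun_prop) measurable_snd
    have h1 := measurable_sampled_gradX H.assump H.oracle
      (z := fun p : (Vec (Fin n) × Vec (Fin n ⊕ Fin r) × Vec (Fin n ⊕ Fin r)) × Ξ => p.1.2.1)
      (by fun_prop) measurable_snd
    have h2 := measurable_sampled_gradX H.assump H.oracle
      (z := fun p : (Vec (Fin n) × Vec (Fin n ⊕ Fin r) × Vec (Fin n ⊕ Fin r)) × Ξ => p.1.2.2)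
      (by fun_prop) measurable_snd
    simp only [hΦ]
    fun_prop
  have key := H.sampling.lintegral_fresh (P := P) (i := 0) (k := k)
    ((H.measurable_prev_errX k).prodMk ((H.measurable_pair k).prodMk (H.measurable_prev_pair k)))
    (by rw [mem_past]; simp) hΦm
  refine le_trans (lintegral_mono fun ω => ?_) ((le_of_eq key).trans
    (lintegral_mono fun ω => NPPDEG.lintegral_nsq_displacement_le H.assump H.oracle (α k) _ _ _))
  have hprev : IsProx f c.Γ₁⁻¹ (xh (k - 1) ω) (xb (k - 1) ω) := by
    cases k with
    | zero => simpa using (H.run ω).init_xb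
    | succ j => simpa using (H.run ω).step_xb j
  refine (ENNReal.ofReal_le_ofReal (((H.run ω).step_xb k).wsq_sub_le H.assump.f_conv
    H.assump.Γ₁_pos.inv hprev)).trans (le_of_eq ?_)
  rw [xh_sub_eq (P := P) H.assump.Γ₁_pos ((H.run ω).step_xh k)]
  rfl

/-- The part of the error of `ŷ` that does not involve the sample `ξ'_k`. -/
def partY (P : Measure Ξ) (φh : Vec (Fin n ⊕ Fin r) → Ξ → ℝ) (c : Constants n r) (α : ℕ → ℝ)
    (ξ : Fin 3 → ℕ → Ω → Ξ) (x xb : ℤ → Ω → Vec (Fin n)) (y yh : ℤ → Ω → Vec (Fin r)) (k : ℕ)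
    (ω : Ω) : Vec (Fin r) :=
  (1 - α k) • errY P φh c (x (k - 1) ω) (xb (k - 1) ω) (y (k - 1) ω) (yh (k - 1) ω)
    + (1 - c.θ) • (noiseY P φh (pair (x k ω) (y k ω)) (ξ 0 k ω)
      - (1 - α k) • noiseY P φh (pair (x (k - 1) ω) (y (k - 1) ω)) (ξ 0 k ω))

lemma lintegral_nsq_partY_le (H : Context μ P f g φh c α ξ x xh xb y yh yb κ) (k : ℕ) :
    ∫⁻ ω, nsq c.Γ₂ (partY P φh c α ξ x xb y yh k ω) ∂μ
      ≤ ∫⁻ ω, (ENNReal.ofReal ((1 - α k) ^ 2) * nsq c.Γ₂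
          (errY P φh c (x (k - 1) ω) (xb (k - 1) ω) (y (k - 1) ω) (yh (k - 1) ω))
        + (ENNReal.ofReal (4 / 3 * α k ^ 2 * (1 - c.θ) ^ 2)
            * ∫⁻ s, nsq c.Γ₂ (noiseY P φh (pair (x k ω) (y k ω)) s) ∂P
          + ENNReal.ofReal (4 * (1 - α k) ^ 2 * ((1 - c.θ) ^ 2 * c.Lhyz ^ 2
            * specNorm (c.Γ * c.Dhyz)))
            * nsq c.Γ⁻¹ (pair (x k ω) (y k ω) - pair (x (k - 1) ω) (y (k - 1) ω)))) ∂μ := by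
  set Φ : (Vec (Fin r) × Vec (Fin n ⊕ Fin r) × Vec (Fin n ⊕ Fin r)) × Ξ → ℝ≥0∞ := fun p =>
    nsq c.Γ₂ ((1 - α k) • p.1.1 + (1 - c.θ) •
      (noiseY P φh p.1.2.1 p.2 - (1 - α k) • noiseY P φh p.1.2.2 p.2)) with hΦ
  have hΦm : Measurable Φ := by
    have h1 := H.assump.measurable_noiseY H.oracle
      (z := fun p : (Vec (Fin r) × Vec (Fin n ⊕ Fin r) × Vec (Fin n ⊕ Fin r)) × Ξ => p.1.2.1)
      (by fun_prop) measurable_snd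
    have h2 := H.assump.measurable_noiseY H.oracle
      (z := fun p : (Vec (Fin r) × Vec (Fin n ⊕ Fin r) × Vec (Fin n ⊕ Fin r)) × Ξ => p.1.2.2)
      (by fun_prop) measurable_snd
    simp only [hΦ]
    fun_prop
  have key := H.sampling.lintegral_fresh (P := P) (i := 0) (k := k)
    ((H.measurable_prev_errY k).prodMk ((H.measurable_pair k).prodMk (H.measurable_prev_pair k)))
    (by rw [mem_past]; simp) hΦm
  exact (le_of_eq key).trans
    (lintegral_mono fun ω => lintegral_nsq_errY_update_le H.assump H.oracle (α k) _ _ _)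

lemma lintegral_nsq_errY_le (H : Context μ P f g φh c α ξ x xh xb y yh yb κ) (k : ℕ) :
    ∫⁻ ω, nsq c.Γ₂ (errY P φh c (x k ω) (xb k ω) (y k ω) (yh k ω)) ∂μ
      ≤ ∫⁻ ω, (nsq c.Γ₂ (partY P φh c α ξ x xb y yh k ω)
        + (ENNReal.ofReal (4 / 3 * α k ^ 2 * c.θ ^ 2 * c.σ ^ 2)
          + ENNReal.ofReal (2 * (1 - α k) ^ 2 * c.c2) * nsq c.Γ₁⁻¹ (xb k ω - xb (k - 1) ω)
          + ENNReal.ofReal (4 * (1 - α k) ^ 2 * (c.θ ^ 2 * c.Lhyy ^ 2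
            * specNorm (c.Γ₂ * c.Dhyy))) * nsq c.Γ₂⁻¹ (y k ω - y (k - 1) ω))) ∂μ := by
  set Φ : (Vec (Fin r) × (Vec (Fin n) × Vec (Fin r)) × (Vec (Fin n) × Vec (Fin r))) × Ξ → ℝ≥0∞ :=
    fun p => nsq c.Γ₂ (p.1.1 + c.θ • (noiseY P φh (pair p.1.2.1.1 p.1.2.1.2) p.2
      - (1 - α k) • noiseY P φh (pair p.1.2.2.1 p.1.2.2.2) p.2)) with hΦ
  have hΦm : Measurable Φ := by
    have h1 := H.assump.measurable_noiseY H.oracle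
      (z := fun p : (Vec (Fin r) × (Vec (Fin n) × Vec (Fin r)) × (Vec (Fin n) × Vec (Fin r))) × Ξ
        => pair p.1.2.1.1 p.1.2.1.2) (by fun_prop) measurable_snd
    have h2 := H.assump.measurable_noiseY H.oracle
      (z := fun p : (Vec (Fin r) × (Vec (Fin n) × Vec (Fin r)) × (Vec (Fin n) × Vec (Fin r))) × Ξ
        => pair p.1.2.2.1 p.1.2.2.2) (by fun_prop) measurable_snd
    simp only [hΦ]
    fun_prop
  obtain ⟨hx, hy, hx', hy', -, -, hxb'⟩ := H.measurableState_one k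
  have hpart : Measurable[before ξ x xh y yh 1 k] (partY P φh c α ξ x xb y yh k) := by
    have hs := measurable_before_sample ξ x xh y yh (i := 0) (j := 1) (by decide) k
    have h1 := (H.measurable_prev_errY k).mono (before_mono ξ x xh y yh zero_le_one k) le_rfl
    have h2 := H.assump.measurable_noiseY H.oracle (hx.vecPair hy) hs
    have h3 := H.assump.measurable_noiseY H.oracle (hx'.vecPair hy') hs
    exact (h1.const_smul (1 - α k)).add ((h2.sub (h3.const_smul (1 - α k))).const_smul (1 - c.θ))
  have key := H.sampling.lintegral_fresh (P := P) (i := 1) (k := k)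
    (hpart.prodMk (((H.measurable_xb k).prodMk hy).prodMk (hxb'.prodMk hy')))
    (by rw [mem_past]; simp) hΦm
  refine le_trans (le_of_eq (lintegral_congr fun ω => ?_)) ((le_of_eq key).trans
    (lintegral_mono fun ω =>
      lintegral_nsq_correctionY'_le H.assump H.oracle (α k) _ _ _ _ _))
  rw [errY_step H.assump.Γ₂_pos ((H.run ω).step_yh k)]
  rfl

end Context

namespace Context

variable {n r : ℕ} {Ω Ξ : Type*} {mΩ : MeasurableSpace Ω} [MeasurableSpace Ξ]
  {μ : Measure Ω} [IsProbabilityMeasure μ] {P : Measure Ξ} [IsProbabilityMeasure P]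
  {f : Vec (Fin n) → EReal} {g : Vec (Fin r) → EReal}
  {φh : Vec (Fin n ⊕ Fin r) → Ξ → ℝ} {c : Constants n r} {α : ℕ → ℝ} {ξ : Fin 3 → ℕ → Ω → Ξ}
  {x xh xb : ℤ → Ω → Vec (Fin n)} {y yh yb : ℤ → Ω → Vec (Fin r)} {κ : Ω → ℕ}

/-- The contributions of the sample `ξ_k` to both components of the error. -/
lemma lintegral_errX_add_partY_le (H : Context μ P f g φh c α ξ x xh xb y yh yb κ) (k : ℕ) :
    ∫⁻ ω, nsq c.Γ₁ (errX P φh c (x k ω) (xh k ω) (y k ω)) ∂μ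
        + ∫⁻ ω, nsq c.Γ₂ (partY P φh c α ξ x xb y yh k ω) ∂μ
      ≤ ENNReal.ofReal ((1 - α k) ^ 2) * meanErr μ P φh c x xh xb y yh (k - 1)
        + ENNReal.ofReal (4 / 3 * α k ^ 2 * (2 * c.Theta - c.θ ^ 2) * c.σ ^ 2)
        + ENNReal.ofReal (4 * (1 - α k) ^ 2 * c.c3 + 4 * (1 - α k) ^ 2 * ((1 - c.θ) ^ 2
          * c.Lhyz ^ 2 * specNorm (c.Γ * c.Dhyz))) * meanMove μ c x y k := by
  have hZ : Measurable fun ω =>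
      nsq c.Γ⁻¹ (pair (x k ω) (y k ω) - pair (x (k - 1) ω) (y (k - 1) ω)) :=
    (measurable_nsq _).comp (((H.measurable_pair k).sub (H.measurable_prev_pair k)).mono
      (H.before_le 0 k) le_rfl)
  have hc3 := Constants.c3_nonneg (c := c)
  have hsn := specNorm_nonneg (c.Γ * c.Dhyz)
  refine (add_le_add (H.lintegral_nsq_errX_le k) (H.lintegral_nsq_partY_le k)).trans
    ((le_lintegral_add _ _).trans ?_)
  rw [meanErr, meanMove, ← lintegral_const_mul' _ _ ENNReal.ofReal_ne_top,
    ← lintegral_const_mul' _ _ ENNReal.ofReal_ne_top]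
  have e1 : ∀ t : ℝ≥0∞, t = ∫⁻ _ : Ω, t ∂μ := fun t => by simp
  rw [e1 (ENNReal.ofReal (4 / 3 * α k ^ 2 * (2 * c.Theta - c.θ ^ 2) * c.σ ^ 2)),
    ← lintegral_add_right _ measurable_const, ← lintegral_add_right _ (hZ.const_mul _)]
  refine lintegral_mono fun ω => ?_
  have hb := noise_budget_le H.assump H.oracle (α k) (pair (x k ω) (y k ω))
  rw [ENNReal.ofReal_add (by positivity) (by positivity), add_mul, mul_add]
  calc _ = ENNReal.ofReal ((1 - α k) ^ 2)
            * nsq c.Γ₁ (errX P φh c (x (k - 1) ω) (xh (k - 1) ω) (y (k - 1) ω))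
          + ENNReal.ofReal ((1 - α k) ^ 2) * nsq c.Γ₂
            (errY P φh c (x (k - 1) ω) (xb (k - 1) ω) (y (k - 1) ω) (yh (k - 1) ω))
          + (ENNReal.ofReal (4 / 3 * α k ^ 2)
              * ∫⁻ s, nsq c.Γ₁ (noiseX P φh (pair (x k ω) (y k ω)) s) ∂P
            + ENNReal.ofReal (4 / 3 * α k ^ 2 * (1 - c.θ) ^ 2)
              * ∫⁻ s, nsq c.Γ₂ (noiseY P φh (pair (x k ω) (y k ω)) s) ∂P)
          + (ENNReal.ofReal (4 * (1 - α k) ^ 2 * c.c3)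
              * nsq c.Γ⁻¹ (pair (x k ω) (y k ω) - pair (x (k - 1) ω) (y (k - 1) ω))
            + ENNReal.ofReal (4 * (1 - α k) ^ 2 * ((1 - c.θ) ^ 2 * c.Lhyz ^ 2
              * specNorm (c.Γ * c.Dhyz)))
              * nsq c.Γ⁻¹ (pair (x k ω) (y k ω) - pair (x (k - 1) ω) (y (k - 1) ω))) := by
        ring
    _ ≤ _ := add_le_add (add_le_add le_rfl hb) le_rfl

/-- The recursion for the mean estimation error. -/
lemma meanErr_le (H : Context μ P f g φh c α ξ x xh xb y yh yb κ) (k : ℕ) :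
    meanErr μ P φh c x xh xb y yh k
      ≤ ENNReal.ofReal ((1 - α k) ^ 2 * (1 + 4 * c.c2 * α k ^ 2))
          * meanErr μ P φh c x xh xb y yh (k - 1)
        + ENNReal.ofReal (α k ^ 2 * (8 / 3 * c.Theta + 4 * (1 - α k) ^ 2 * c.c2) * c.σ ^ 2)
        + ENNReal.ofReal (4 * (1 - α k) ^ 2 * (c.c1 + 2 * c.c2 * (1 + c.c3)))
          * meanMove μ c x y k := by
  have hle := H.before_le 1 k
  have hle0 := H.before_le 0 k
  obtain ⟨hx, hy, hx', hy', -, -, hxb'⟩ := H.measurableState_one k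
  set a := α k with ha
  set E₁ := ∫⁻ ω, nsq c.Γ₁ (errX P φh c (x (k - 1) ω) (xh (k - 1) ω) (y (k - 1) ω)) ∂μ with hE₁
  set D := meanMove μ c x y k with hD
  have hErrX : Measurable fun ω => nsq c.Γ₁ (errX P φh c (x k ω) (xh k ω) (y k ω)) :=
    (measurable_nsq _).comp ((H.assump.measurable_errX hx (H.measurable_xh k) hy).mono hle le_rfl)
  have hXb : Measurable fun ω => nsq c.Γ₁⁻¹ (xb k ω - xb (k - 1) ω) :=
    (measurable_nsq _).comp (((H.measurable_xb k).sub hxb').mono hle le_rfl)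
  have hYm : Measurable fun ω => nsq c.Γ₂⁻¹ (y k ω - y (k - 1) ω) :=
    (measurable_nsq _).comp ((hy.sub hy').mono hle le_rfl)
  have hZ : Measurable fun ω =>
      nsq c.Γ⁻¹ (pair (x k ω) (y k ω) - pair (x (k - 1) ω) (y (k - 1) ω)) :=
    (measurable_nsq _).comp (((H.measurable_pair k).sub (H.measurable_prev_pair k)).mono
      hle0 le_rfl)
  have hE₁le : E₁ ≤ meanErr μ P φh c x xh xb y yh (k - 1) :=
    lintegral_mono fun ω => le_self_add
  have n1 := Constants.c1_nonneg (c := c)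
  have n2 := Constants.c2_nonneg (c := c)
  have n3 := Constants.c3_nonneg (c := c)
  have n4 := specNorm_nonneg (c.Γ * c.Dhyz)
  have n5 := specNorm_nonneg (c.Γ₂ * c.Dhyy)
  have nT := Constants.Theta_nonneg (c := c)
  set u := (1 - c.θ) ^ 2 * c.Lhyz ^ 2 * specNorm (c.Γ * c.Dhyz) with hu
  set w := c.θ ^ 2 * c.Lhyy ^ 2 * specNorm (c.Γ₂ * c.Dhyy) with hw
  have hu0 : 0 ≤ u := by positivity
  have hw0 : 0 ≤ w := by positivity
  have hc1 : c.c1 = c.c3 + 2 * u + 2 * w := by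
    rw [Constants.c1, Constants.c3, hu, hw]
    ring
  have hq : 0 ≤ (1 - a) ^ 2 := sq_nonneg _
  have hT4 : ∫⁻ ω, nsq c.Γ₁⁻¹ (xb k ω - xb (k - 1) ω) ∂μ
      ≤ ENNReal.ofReal (4 * (1 + c.c3)) * D
        + ENNReal.ofReal (2 * a ^ 2) * (E₁ + ENNReal.ofReal (c.σ ^ 2)) := by
    refine (H.lintegral_nsq_displacement_le k).trans (le_of_eq ?_)
    rw [lintegral_add_left (hZ.const_mul _), lintegral_const_mul' _ _ ENNReal.ofReal_ne_top,
      lintegral_const_mul' _ _ ENNReal.ofReal_ne_top, lintegral_add_right _ measurable_const]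
    simp [hD, meanMove, hE₁, ha]
  have hD' : ∫⁻ ω, nsq c.Γ₂⁻¹ (y k ω - y (k - 1) ω) ∂μ ≤ D := by
    refine lintegral_mono fun ω => ENNReal.ofReal_le_ofReal ?_
    rw [pair_sub, Constants.wsq_Γ_inv_pair H.assump.Γ₁_pos H.assump.Γ₂_pos]
    exact le_add_of_nonneg_left (wsq_nonneg H.assump.Γ₁_pos.inv.posSemidef _)
  have hT2 : ∫⁻ ω, nsq c.Γ₂ (errY P φh c (x k ω) (xb k ω) (y k ω) (yh k ω)) ∂μ
      ≤ ∫⁻ ω, nsq c.Γ₂ (partY P φh c α ξ x xb y yh k ω) ∂μ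
        + (ENNReal.ofReal (4 / 3 * a ^ 2 * c.θ ^ 2 * c.σ ^ 2)
          + ENNReal.ofReal (2 * (1 - a) ^ 2 * c.c2) * (ENNReal.ofReal (4 * (1 + c.c3)) * D
            + ENNReal.ofReal (2 * a ^ 2) * (E₁ + ENNReal.ofReal (c.σ ^ 2)))
          + ENNReal.ofReal (4 * (1 - a) ^ 2 * w) * D) := by
    have hM : ∀ t₁ t₂ t₃ : ℝ≥0∞, Measurable fun ω => t₁ + t₂ * nsq c.Γ₁⁻¹ (xb k ω - xb (k - 1) ω)
        + t₃ * nsq c.Γ₂⁻¹ (y k ω - y (k - 1) ω) := fun t₁ t₂ t₃ =>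
      (measurable_const.add (hXb.const_mul t₂)).add (hYm.const_mul t₃)
    refine (H.lintegral_nsq_errY_le k).trans ?_
    rw [lintegral_add_right _ (hM _ _ _),
      lintegral_add_right _ (hYm.const_mul _), lintegral_add_right _ (hXb.const_mul _),
      lintegral_const_mul' _ _ ENNReal.ofReal_ne_top,
      lintegral_const_mul' _ _ ENNReal.ofReal_ne_top]
    refine add_le_add le_rfl (add_le_add (add_le_add (le_of_eq (by simp [ha])) ?_) ?_)
    · exact mul_le_mul_right hT4 _
    · exact mul_le_mul_right hD' _
  have hX := H.lintegral_errX_add_partY_le k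
  rw [meanErr, lintegral_add_left hErrX]
  calc _ ≤ ∫⁻ ω, nsq c.Γ₁ (errX P φh c (x k ω) (xh k ω) (y k ω)) ∂μ
        + (∫⁻ ω, nsq c.Γ₂ (partY P φh c α ξ x xb y yh k ω) ∂μ
        + (ENNReal.ofReal (4 / 3 * a ^ 2 * c.θ ^ 2 * c.σ ^ 2)
          + ENNReal.ofReal (2 * (1 - a) ^ 2 * c.c2) * (ENNReal.ofReal (4 * (1 + c.c3)) * D
            + ENNReal.ofReal (2 * a ^ 2) * (E₁ + ENNReal.ofReal (c.σ ^ 2)))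
          + ENNReal.ofReal (4 * (1 - a) ^ 2 * w) * D)) := add_le_add le_rfl hT2
    _ ≤ (ENNReal.ofReal ((1 - a) ^ 2) * meanErr μ P φh c x xh xb y yh (k - 1)
        + ENNReal.ofReal (4 / 3 * a ^ 2 * (2 * c.Theta - c.θ ^ 2) * c.σ ^ 2)
        + ENNReal.ofReal (4 * (1 - a) ^ 2 * c.c3 + 4 * (1 - a) ^ 2 * u) * D)
        + (ENNReal.ofReal (4 / 3 * a ^ 2 * c.θ ^ 2 * c.σ ^ 2)
          + ENNReal.ofReal (2 * (1 - a) ^ 2 * c.c2) * (ENNReal.ofReal (4 * (1 + c.c3)) * D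
            + ENNReal.ofReal (2 * a ^ 2) * (meanErr μ P φh c x xh xb y yh (k - 1)
              + ENNReal.ofReal (c.σ ^ 2)))
          + ENNReal.ofReal (4 * (1 - a) ^ 2 * w) * D) := by
        rw [← add_assoc]
        gcongr
    _ = (ENNReal.ofReal ((1 - a) ^ 2)
            + ENNReal.ofReal (2 * (1 - a) ^ 2 * c.c2) * ENNReal.ofReal (2 * a ^ 2))
          * meanErr μ P φh c x xh xb y yh (k - 1)
        + (ENNReal.ofReal (4 / 3 * a ^ 2 * (2 * c.Theta - c.θ ^ 2) * c.σ ^ 2)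
          + ENNReal.ofReal (4 / 3 * a ^ 2 * c.θ ^ 2 * c.σ ^ 2)
          + ENNReal.ofReal (2 * (1 - a) ^ 2 * c.c2) * ENNReal.ofReal (2 * a ^ 2)
            * ENNReal.ofReal (c.σ ^ 2))
        + (ENNReal.ofReal (4 * (1 - a) ^ 2 * c.c3 + 4 * (1 - a) ^ 2 * u)
          + ENNReal.ofReal (2 * (1 - a) ^ 2 * c.c2) * ENNReal.ofReal (4 * (1 + c.c3))
          + ENNReal.ofReal (4 * (1 - a) ^ 2 * w)) * D := by ring
    _ ≤ _ := by
        have hTθ : 0 ≤ 2 * c.Theta - c.θ ^ 2 := by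
          rw [Constants.Theta]
          nlinarith [sq_nonneg (1 - c.θ), sq_nonneg c.θ]
        rw [← ENNReal.ofReal_mul (by positivity), ← ENNReal.ofReal_mul (by positivity),
          ← ENNReal.ofReal_mul (by positivity), ← ENNReal.ofReal_add (by positivity)
          (by positivity), ← ENNReal.ofReal_add (by positivity) (by positivity),
          ← ENNReal.ofReal_add (by positivity) (by positivity),
          ← ENNReal.ofReal_add (by positivity) (by positivity),
          ← ENNReal.ofReal_add (by positivity) (by positivity)]
        refine add_le_add (add_le_add (mul_le_mul_left (ENNReal.ofReal_le_ofReal ?_) _)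
          (ENNReal.ofReal_le_ofReal ?_)) (mul_le_mul_left (ENNReal.ofReal_le_ofReal ?_) _)
        · exact le_of_eq (by ring)
        · exact le_of_eq (by ring)
        · rw [hc1]
          have := mul_nonneg hq (add_nonneg hu0 hw0)
          linarith

end Context

/-! ### The Lyapunov function and the rate -/

section RealEstimates

variable {p a a₀ e η : ℝ}

lemma mul_le_of_step_ratio (hp : 0 ≤ p) (ha : 0 < a) (haa : a ≤ a₀) (h4 : 0 < 1 - 4 * p * a₀)
    (he : 0 ≤ e) (hη : (1 + 4 * p * a₀ ^ 2) * e / (1 - 4 * p * a₀) ≤ η) :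
    (1 + 4 * p * a ^ 2) * e ≤ (1 - 4 * p * a) * η := by
  rw [div_le_iff₀ h4] at hη
  have hη0 : 0 ≤ η := by
    by_contra hneg
    push Not at hneg
    have : 0 ≤ (1 + 4 * p * a₀ ^ 2) * e := by positivity
    nlinarith
  have h1 : (1 + 4 * p * a ^ 2) * e ≤ (1 + 4 * p * a₀ ^ 2) * e := by
    have : a ^ 2 ≤ a₀ ^ 2 := pow_le_pow_left₀ ha.le haa 2
    gcongr
  have h2 : η * (1 - 4 * p * a₀) ≤ η * (1 - 4 * p * a) := by
    have : 4 * p * a ≤ 4 * p * a₀ := by gcongr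
    exact mul_le_mul_of_nonneg_left (by linarith) hη0
  linarith

/-- The weight `η/2` of the estimation error is preserved by one step. -/
lemma half_weight_contraction (hp : 0 ≤ p) (ha : 0 < a) (ha1 : a < 1) (hη0 : 0 ≤ η)
    (h : (1 + 4 * p * a ^ 2) * e ≤ (1 - 4 * p * a) * η) :
    (η / 2 + a * e) * ((1 - a) ^ 2 * (1 + 4 * p * a ^ 2)) ≤ η / 2 := by
  have h1 : a * (1 - a) ^ 2 * ((1 + 4 * p * a ^ 2) * e)
      ≤ a * (1 - a) ^ 2 * ((1 - 4 * p * a) * η) :=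
    mul_le_mul_of_nonneg_left h (by positivity)
  -- `(1 - a)² (1 + 2a) = 1 - a² (3 - 2a)`
  have h2 : (1 - a) ^ 2 * (1 + 2 * a - 4 * p * a ^ 2) ≤ 1 := by
    have h3 : 0 ≤ (1 - a) ^ 2 * (4 * p * a ^ 2) := by positivity
    have h4 : 0 ≤ a ^ 2 * (3 - 2 * a) := mul_nonneg (sq_nonneg a) (by linarith)
    nlinarith
  have h5 := mul_le_mul_of_nonneg_left h2 (by linarith : 0 ≤ η / 2)
  nlinarith

end RealEstimates

namespace Context

variable {n r : ℕ} {Ω Ξ : Type*} {mΩ : MeasurableSpace Ω} [MeasurableSpace Ξ]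
  {μ : Measure Ω} {P : Measure Ξ}
  {f : Vec (Fin n) → EReal} {g : Vec (Fin r) → EReal}
  {φh : Vec (Fin n ⊕ Fin r) → Ξ → ℝ} {c : Constants n r} {α : ℕ → ℝ} {ξ : Fin 3 → ℕ → Ω → Ξ}
  {x xh xb : ℤ → Ω → Vec (Fin n)} {y yh yb : ℤ → Ω → Vec (Fin r)} {κ : Ω → ℕ}

lemma meanMove_zero (H : Context μ P f g φh c α ξ x xh xb y yh yb κ) :
    meanMove μ c x y 0 = 0 := by
  have : ∀ ω, pair (x 0 ω) (y 0 ω) - pair (x (-1) ω) (y (-1) ω) = 0 := fun ω => by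
    rw [(H.run ω).init_x, (H.run ω).init_y, sub_self]
  simp [meanMove, this, nsq]

variable [IsProbabilityMeasure μ]

/-- The squared distance at the random index is at most the averaged residual. -/
lemma lintegral_wdist_index_le (H : Context μ P f g φh c α ξ x xh xb y yh yb κ) (K : ℕ)
    (hκ : ∀ k ∈ Finset.range (K + 1),
      μ {ω | κ ω = k} = ENNReal.ofReal (α k / ∑ j ∈ Finset.range (K + 1), α j)) :
    ∫⁻ ω, wdist c.Γ 0 (opT f g (meanFn P φh) (pair (xb (κ ω) ω) (yb (κ ω) ω))) ^ 2 ∂μ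
      ≤ ∑ k ∈ Finset.range (K + 1), ENNReal.ofReal (α k / ∑ j ∈ Finset.range (K + 1), α j)
        * meanResid μ P φh c xh xb yh yb k := by
  have hs : 0 < ∑ j ∈ Finset.range (K + 1), α j :=
    Finset.sum_pos (fun k _ => (H.alpha k).1) Finset.nonempty_range_add_one
  set G : ℕ → Ω → ℝ≥0∞ := fun k ω =>
    nsq c.Γ (resid P φh c (xh k ω) (xb k ω) (yh k ω) (yb k ω)) with hG
  have hGm : ∀ k, Measurable[before ξ x xh y yh 2 k] (G k) := fun k =>
    (measurable_nsq _).comp (H.measurable_resid k)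
  have hset : ∀ k, MeasurableSet {ω | κ ω = k} := fun k =>
    H.sampling.measurable_index (measurableSet_singleton k)
  have hd : ∀ (k : ℕ) ω, wdist c.Γ 0 (opT f g (meanFn P φh) (pair (xb k ω) (yb k ω))) ^ 2
      ≤ G k ω := by
    intro k ω
    have hmem := resid_mem_opT H.assump ((H.run ω).step_xb k) ((H.run ω).step_yb k)
    have h1 : wdist c.Γ 0 (opT f g (meanFn P φh) (pair (xb k ω) (yb k ω)))
        ≤ ENNReal.ofReal (wnorm c.Γ (0 - resid P φh c (xh k ω) (xb k ω) (yh k ω) (yb k ω))) :=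
      iInf₂_le _ hmem
    refine (pow_le_pow_left' h1 2).trans (le_of_eq ?_)
    rw [zero_sub, wnorm, wsq_neg, ← ENNReal.ofReal_pow (Real.sqrt_nonneg _),
      Real.sq_sqrt (wsq_nonneg H.assump.Γ_pos.posSemidef _)]
    rfl
  have hunion : μ (⋃ k ∈ Finset.range (K + 1), {ω | κ ω = k}) = 1 := by
    rw [measure_biUnion_finset (fun i _ j _ hij => Set.disjoint_left.2 fun ω hi hj =>
      hij (hi.symm.trans hj)) fun k _ => hset k, Finset.sum_congr rfl hκ,
      ← ENNReal.ofReal_sum_of_nonneg fun k _ => div_nonneg (H.alpha k).1.le hs.le,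
      ← Finset.sum_div, div_self hs.ne', ENNReal.ofReal_one]
  have hae : ∀ᵐ ω ∂μ, κ ω ∈ Finset.range (K + 1) := by
    have := (prob_compl_eq_zero_iff
      (Finset.measurableSet_biUnion (Finset.range (K + 1)) fun k _ => hset k)).2 hunion
    filter_upwards [compl_mem_ae_iff.2 this] with ω hω
    simpa using hω
  calc _ ≤ ∫⁻ ω, ∑ k ∈ Finset.range (K + 1), {ω | κ ω = k}.indicator (G k) ω ∂μ := by
        refine lintegral_mono_ae ?_
        filter_upwards [hae] with ω hω
        refine (hd (κ ω) ω).trans ?_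
        refine le_trans (le_of_eq ?_) (Finset.single_le_sum (f := fun k =>
          {ω | κ ω = k}.indicator (G k) ω) (fun _ _ => zero_le) hω)
        simp [Set.indicator]
    _ = ∑ k ∈ Finset.range (K + 1), ∫⁻ ω in {ω | κ ω = k}, G k ω ∂μ := by
        rw [lintegral_finsetSum _ fun k _ =>
          ((hGm k).mono (H.before_le 2 k) le_rfl).indicator (hset k)]
        exact Finset.sum_congr rfl fun k _ => lintegral_indicator (hset k) _
    _ = _ := by
        refine Finset.sum_congr rfl fun k hk => ?_
        rw [H.sampling.setLIntegral_index (hGm k) k, hκ k hk]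
        rfl

variable [IsProbabilityMeasure P]

/-- One step of the Lyapunov function `𝔼‖z^k - z⋆‖² + (η/2) 𝔼‖error‖² + 2ηc' 𝔼‖z^k - z^{k-1}‖²`,
`c' = ĉ₁ + 2ĉ₂(1 + ĉ₃)`. -/
lemma lyapunov_step (H : Context μ P f g φh c α ξ x xh xb y yh yb κ) (hα0 : ∀ k, α k ≤ α 0)
    (hc2 : 0 < 1 - 4 * c.c2 * α 0) {S : Set (Vec (Fin n ⊕ Fin r))} {ρ : ℝ}
    (hminty : WeakMVI (opT f g (meanFn P φh)) S ρ) {zs : Vec (Fin n ⊕ Fin r)} (hzs : zs ∈ S)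
    {b ε η m e C : ℝ} (hb : 0 < b) (hε : 0 < ε) (hκ : 0 ≤ 1 - 1 / (ε * (1 - c.LM) ^ 2))
    (he : e = ε + 1 / b * (1 - 1 / (ε * (1 - c.LM) ^ 2)))
    (hη : (1 + 4 * c.c2 * α 0 ^ 2) * e / (1 - 4 * c.c2 * α 0) ≤ η)
    (hm : m = 1 / (1 + b) * (1 - 1 / (ε * (1 - c.LM) ^ 2)) + 2 * ρ / c.gbar ρ - α 0
        - 2 * α 0 * (c.c1 + 2 * c.c2 * (1 + c.c3)) * η) (hm0 : 0 < m)
    (hC : C = 2 * (η + α 0 * e) * (c.Theta + 2 * c.c2) + 1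
        + 2 * (c.c1 + 2 * c.c2 * (1 + c.c3)) * η) (k : ℕ) :
    meanDist μ c x y zs (k + 1) + ENNReal.ofReal (η / 2) * meanErr μ P φh c x xh xb y yh k
        + ENNReal.ofReal (2 * η * (c.c1 + 2 * c.c2 * (1 + c.c3))) * meanMove μ c x y (k + 1)
        + ENNReal.ofReal (m * α k) * meanResid μ P φh c xh xb yh yb k
      ≤ meanDist μ c x y zs k + ENNReal.ofReal (η / 2) * meanErr μ P φh c x xh xb y yh (k - 1)
        + ENNReal.ofReal (2 * η * (c.c1 + 2 * c.c2 * (1 + c.c3))) * meanMove μ c x y k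
        + ENNReal.ofReal (C * c.σ ^ 2 * α k ^ 2) := by
  obtain ⟨ha, ha1⟩ := H.alpha k
  have haa := hα0 k
  have he0 : 0 ≤ e := by
    rw [he]
    positivity
  have n1 := Constants.c1_nonneg (c := c)
  have n2 := Constants.c2_nonneg (c := c)
  have n3 := Constants.c3_nonneg (c := c)
  have nT := Constants.Theta_nonneg (c := c)
  have hratio := mul_le_of_step_ratio n2 ha haa hc2 he0 hη
  have heη : e ≤ η := by
    have hη' := hη
    rw [div_le_iff₀ hc2] at hη'
    have h1 : 0 ≤ 4 * c.c2 * α 0 ^ 2 * e := by positivity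
    have h2 : 0 ≤ 4 * c.c2 * α 0 := mul_nonneg (by positivity) (ha.le.trans haa)
    by_contra hlt
    push Not at hlt
    nlinarith
  have hη0 : 0 ≤ η := he0.trans heη
  set a := α k with hak
  set c' := c.c1 + 2 * c.c2 * (1 + c.c3) with hc'
  have nc' : 0 ≤ c' := by positivity
  set R := meanResid μ P φh c xh xb yh yb k with hR
  set D := meanMove μ c x y k with hD
  set E := meanErr μ P φh c x xh xb y yh k with hE
  set E₀ := meanErr μ P φh c x xh xb y yh (k - 1) with hE₀
  set U := meanDist μ c x y zs k with hU
  set U' := meanDist μ c x y zs (k + 1) with hU'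
  have F1 := half_weight_contraction n2 ha ha1 hη0 hratio
  have hpos : 0 ≤ η / 2 + a * e := by positivity
  have F1' : (η / 2 + a * e) * (1 - a) ^ 2 ≤ η / 2 := by
    refine le_trans ?_ F1
    have : (1 - a) ^ 2 ≤ (1 - a) ^ 2 * (1 + 4 * c.c2 * a ^ 2) := by
      have : 0 ≤ (1 - a) ^ 2 * (4 * c.c2 * a ^ 2) := by positivity
      linarith
    gcongr
  have hae : a * e ≤ η := (mul_le_of_le_one_left he0 ha1.le).trans heη
  have hae' : a * e ≤ α 0 * e := by gcongr
  have F3 : (η / 2 + a * e) * (8 / 3 * c.Theta + 4 * (1 - a) ^ 2 * c.c2)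
      ≤ 2 * (η + α 0 * e) * (c.Theta + 2 * c.c2) := by
    have h1 : (η / 2 + a * e) * (8 / 3) * c.Theta ≤ 2 * (η + α 0 * e) * c.Theta := by
      refine mul_le_mul_of_nonneg_right ?_ nT
      linarith
    have h2 : (η / 2 + a * e) * (1 - a) ^ 2 * (4 * c.c2) ≤ η / 2 * (4 * c.c2) :=
      mul_le_mul_of_nonneg_right F1' (by positivity)
    have h3 : 0 ≤ (η + 2 * (α 0 * e)) * c.c2 :=
      mul_nonneg (by linarith [mul_nonneg ha.le he0]) n2
    nlinarith
  set m₀ := 1 / (1 + b) * (1 - 1 / (ε * (1 - c.LM) ^ 2)) + 2 * ρ / c.gbar ρ with hm₀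
  have hmm : m + 2 * η * c' * a ≤ m₀ - a := by
    have : 2 * η * c' * a ≤ 2 * η * c' * α 0 := by gcongr
    linarith
  have hB : 0 ≤ 2 * η * c' := by positivity
  have hI := H.meanDist_succ_le hminty hzs hb hε hκ he hm₀ k
    (by linarith [mul_nonneg hB ha.le])
  have hII := H.meanErr_le k
  have hIII := H.meanMove_succ_le k
  rw [← hak, ← hE, ← hE₀, ← hD] at hII
  rw [← hak, ← hR] at hIII
  rw [← hak, ← hU, ← hU', ← hR, ← hE] at hI
  have hσ := sq_nonneg c.σ
  calc U' + ENNReal.ofReal (η / 2) * E + ENNReal.ofReal (2 * η * c') * meanMove μ c x y (k + 1)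
        + ENNReal.ofReal (m * a) * R
      ≤ U' + ENNReal.ofReal (η / 2) * E + ENNReal.ofReal (2 * η * c')
        * (ENNReal.ofReal (a ^ 2) * R + ENNReal.ofReal (a ^ 2 * c.σ ^ 2))
        + ENNReal.ofReal (m * a) * R := by gcongr
    _ = (U' + (ENNReal.ofReal (2 * η * c') * ENNReal.ofReal (a ^ 2)
          + ENNReal.ofReal (m * a)) * R) + ENNReal.ofReal (η / 2) * E
        + ENNReal.ofReal (2 * η * c') * ENNReal.ofReal (a ^ 2 * c.σ ^ 2) := by ring
    _ ≤ (U' + ENNReal.ofReal (a * (m₀ - a)) * R) + ENNReal.ofReal (η / 2) * E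
        + ENNReal.ofReal (2 * η * c') * ENNReal.ofReal (a ^ 2 * c.σ ^ 2) := by
        gcongr
        rw [← ENNReal.ofReal_mul hB, ← ENNReal.ofReal_add (by positivity) (by positivity)]
        refine ENNReal.ofReal_le_ofReal ?_
        have := mul_le_mul_of_nonneg_left hmm ha.le
        linarith
    _ ≤ (U + ENNReal.ofReal (a * e) * E + ENNReal.ofReal (a ^ 2 * c.σ ^ 2))
        + ENNReal.ofReal (η / 2) * E
        + ENNReal.ofReal (2 * η * c') * ENNReal.ofReal (a ^ 2 * c.σ ^ 2) := by gcongr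
    _ = U + (ENNReal.ofReal (η / 2) + ENNReal.ofReal (a * e)) * E
        + (ENNReal.ofReal (a ^ 2 * c.σ ^ 2)
          + ENNReal.ofReal (2 * η * c') * ENNReal.ofReal (a ^ 2 * c.σ ^ 2)) := by ring
    _ ≤ U + ENNReal.ofReal (η / 2 + a * e)
          * (ENNReal.ofReal ((1 - a) ^ 2 * (1 + 4 * c.c2 * a ^ 2)) * E₀
            + ENNReal.ofReal (a ^ 2 * (8 / 3 * c.Theta + 4 * (1 - a) ^ 2 * c.c2) * c.σ ^ 2)
            + ENNReal.ofReal (4 * (1 - a) ^ 2 * c') * D)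
        + (ENNReal.ofReal (a ^ 2 * c.σ ^ 2)
          + ENNReal.ofReal (2 * η * c') * ENNReal.ofReal (a ^ 2 * c.σ ^ 2)) := by
        rw [← ENNReal.ofReal_add (by positivity) (by positivity)]
        gcongr
    _ = U + (ENNReal.ofReal (η / 2 + a * e)
            * ENNReal.ofReal ((1 - a) ^ 2 * (1 + 4 * c.c2 * a ^ 2))) * E₀
        + (ENNReal.ofReal (η / 2 + a * e) * ENNReal.ofReal (4 * (1 - a) ^ 2 * c')) * D
        + (ENNReal.ofReal (η / 2 + a * e)
            * ENNReal.ofReal (a ^ 2 * (8 / 3 * c.Theta + 4 * (1 - a) ^ 2 * c.c2) * c.σ ^ 2)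
          + ENNReal.ofReal (a ^ 2 * c.σ ^ 2)
          + ENNReal.ofReal (2 * η * c') * ENNReal.ofReal (a ^ 2 * c.σ ^ 2)) := by ring
    _ ≤ _ := by
        rw [← ENNReal.ofReal_mul hpos, ← ENNReal.ofReal_mul hpos, ← ENNReal.ofReal_mul hpos,
          ← ENNReal.ofReal_mul hB, ← ENNReal.ofReal_add (by positivity) (by positivity),
          ← ENNReal.ofReal_add (by positivity) (by positivity)]
        refine add_le_add (add_le_add (add_le_add le_rfl
          (mul_le_mul_left (ENNReal.ofReal_le_ofReal F1) _))
          (mul_le_mul_left (ENNReal.ofReal_le_ofReal ?_) _)) (ENNReal.ofReal_le_ofReal ?_)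
        · have := mul_le_mul_of_nonneg_right F1' (by positivity : 0 ≤ 4 * c')
          linarith
        · have := mul_le_mul_of_nonneg_right F3 (by positivity : 0 ≤ a ^ 2 * c.σ ^ 2)
          rw [hC]
          linarith

/-- The summed Lyapunov inequality. -/
lemma sum_meanResid_le (H : Context μ P f g φh c α ξ x xh xb y yh yb κ) (hα0 : ∀ k, α k ≤ α 0)
    (hc2 : 0 < 1 - 4 * c.c2 * α 0) {S : Set (Vec (Fin n ⊕ Fin r))} {ρ : ℝ}
    (hminty : WeakMVI (opT f g (meanFn P φh)) S ρ) {zs : Vec (Fin n ⊕ Fin r)} (hzs : zs ∈ S)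
    {b ε η m e C : ℝ} (hb : 0 < b) (hε : 0 < ε) (hκ : 0 ≤ 1 - 1 / (ε * (1 - c.LM) ^ 2))
    (he : e = ε + 1 / b * (1 - 1 / (ε * (1 - c.LM) ^ 2)))
    (hη : (1 + 4 * c.c2 * α 0 ^ 2) * e / (1 - 4 * c.c2 * α 0) ≤ η)
    (hm : m = 1 / (1 + b) * (1 - 1 / (ε * (1 - c.LM) ^ 2)) + 2 * ρ / c.gbar ρ - α 0
        - 2 * α 0 * (c.c1 + 2 * c.c2 * (1 + c.c3)) * η) (hm0 : 0 < m)
    (hC : C = 2 * (η + α 0 * e) * (c.Theta + 2 * c.c2) + 1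
        + 2 * (c.c1 + 2 * c.c2 * (1 + c.c3)) * η) (K : ℕ) :
    ∑ k ∈ Finset.range K, ENNReal.ofReal (m * α k) * meanResid μ P φh c xh xb yh yb k
      ≤ meanDist μ c x y zs 0 + ENNReal.ofReal η * meanErr μ P φh c x xh xb y yh (-1)
        + ∑ k ∈ Finset.range K, ENNReal.ofReal (C * c.σ ^ 2 * α k ^ 2) := by
  have key : ∀ K : ℕ, meanDist μ c x y zs K
        + ENNReal.ofReal (η / 2) * meanErr μ P φh c x xh xb y yh (K - 1)
        + ENNReal.ofReal (2 * η * (c.c1 + 2 * c.c2 * (1 + c.c3))) * meanMove μ c x y K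
        + ∑ k ∈ Finset.range K, ENNReal.ofReal (m * α k) * meanResid μ P φh c xh xb yh yb k
      ≤ meanDist μ c x y zs 0 + ENNReal.ofReal (η / 2) * meanErr μ P φh c x xh xb y yh (-1)
        + ∑ k ∈ Finset.range K, ENNReal.ofReal (C * c.σ ^ 2 * α k ^ 2) := by
    intro K
    induction K with
    | zero => simp [H.meanMove_zero]
    | succ K ih =>
      have hs := H.lyapunov_step hα0 hc2 hminty hzs hb hε hκ he hη hm hm0 hC K
      rw [Finset.sum_range_succ, Finset.sum_range_succ, Nat.cast_add_one, add_sub_cancel_right]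
      rw [← add_assoc (meanDist μ c x y zs 0 + _)]
      refine le_trans ?_ (add_le_add ih le_rfl)
      calc _ = (meanDist μ c x y zs (K + 1)
              + ENNReal.ofReal (η / 2) * meanErr μ P φh c x xh xb y yh K
              + ENNReal.ofReal (2 * η * (c.c1 + 2 * c.c2 * (1 + c.c3)))
                * meanMove μ c x y (K + 1)
              + ENNReal.ofReal (m * α K) * meanResid μ P φh c xh xb yh yb K)
            + ∑ k ∈ Finset.range K,
              ENNReal.ofReal (m * α k) * meanResid μ P φh c xh xb yh yb k := by ring
        _ ≤ _ := add_le_add hs le_rfl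
        _ = _ := by ring
  have he0 : 0 ≤ e := by
    rw [he]
    positivity
  have hη0 : 0 ≤ η := le_trans (div_nonneg (mul_nonneg (by
    have := Constants.c2_nonneg (c := c)
    positivity) he0) hc2.le) hη
  refine le_add_self.trans ((key K).trans ?_)
  gcongr
  linarith

/-- The bound on the averaged residuals. -/
lemma average_meanResid_le (H : Context μ P f g φh c α ξ x xh xb y yh yb κ)
    (hα0 : ∀ k, α k ≤ α 0)
    (hc2 : 0 < 1 - 4 * c.c2 * α 0) {S : Set (Vec (Fin n ⊕ Fin r))} {ρ : ℝ}
    (hminty : WeakMVI (opT f g (meanFn P φh)) S ρ) {zs : Vec (Fin n ⊕ Fin r)} (hzs : zs ∈ S)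
    {b ε η m e C : ℝ} (hb : 0 < b) (hε : 0 < ε) (hκ : 0 ≤ 1 - 1 / (ε * (1 - c.LM) ^ 2))
    (he : e = ε + 1 / b * (1 - 1 / (ε * (1 - c.LM) ^ 2)))
    (hη : (1 + 4 * c.c2 * α 0 ^ 2) * e / (1 - 4 * c.c2 * α 0) ≤ η)
    (hm : m = 1 / (1 + b) * (1 - 1 / (ε * (1 - c.LM) ^ 2)) + 2 * ρ / c.gbar ρ - α 0
        - 2 * α 0 * (c.c1 + 2 * c.c2 * (1 + c.c3)) * η) (hm0 : 0 < m)
    (hC : C = 2 * (η + α 0 * e) * (c.Theta + 2 * c.c2) + 1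
        + 2 * (c.c1 + 2 * c.c2 * (1 + c.c3)) * η) (K : ℕ) :
    ∑ k ∈ Finset.range (K + 1), ENNReal.ofReal (α k / ∑ j ∈ Finset.range (K + 1), α j)
        * meanResid μ P φh c xh xb yh yb k
      ≤ (meanDist μ c x y zs 0 + ENNReal.ofReal η * meanErr μ P φh c x xh xb y yh (-1)
        + ENNReal.ofReal (C * c.σ ^ 2 * ∑ j ∈ Finset.range (K + 1), α j ^ 2))
        / ENNReal.ofReal (m * ∑ j ∈ Finset.range (K + 1), α j) := by
  have hs : 0 < ∑ j ∈ Finset.range (K + 1), α j :=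
    Finset.sum_pos (fun k _ => (H.alpha k).1) Finset.nonempty_range_add_one
  have he0 : 0 ≤ e := by
    rw [he]
    positivity
  have hη0 : 0 ≤ η := le_trans (div_nonneg (mul_nonneg (by
    have := Constants.c2_nonneg (c := c)
    positivity) he0) hc2.le) hη
  have hC0 : 0 ≤ C := by
    have := Constants.c1_nonneg (c := c)
    have := Constants.c2_nonneg (c := c)
    have := Constants.c3_nonneg (c := c)
    have := Constants.Theta_nonneg (c := c)
    have := (H.alpha 0).1
    rw [hC]
    positivity
  have hpos : 0 < m * ∑ j ∈ Finset.range (K + 1), α j := mul_pos hm0 hs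
  rw [ENNReal.le_div_iff_mul_le (Or.inl (ENNReal.ofReal_pos.2 hpos).ne')
    (Or.inl ENNReal.ofReal_ne_top)]
  refine le_trans (le_of_eq ?_)
    ((H.sum_meanResid_le hα0 hc2 hminty hzs hb hε hκ he hη hm hm0 hC (K + 1)).trans
      (le_of_eq ?_))
  · rw [Finset.sum_mul]
    refine Finset.sum_congr rfl fun k _ => ?_
    rw [mul_right_comm, ← ENNReal.ofReal_mul (div_nonneg (H.alpha k).1.le hs.le)]
    congr 2
    field_simp
  · rw [Finset.mul_sum, ENNReal.ofReal_sum_of_nonneg fun k _ => by positivity]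

end Context

end NPPDEG

end

theorem mainTheorem4 {n r : ℕ} {Ω Ξ : Type*} [MeasurableSpace Ω] [MeasurableSpace Ξ]
    (μ : Measure Ω) [IsProbabilityMeasure μ] (P : Measure Ξ) [IsProbabilityMeasure P]
    (f : NPPDEG.Vec (Fin n) → EReal) (g : NPPDEG.Vec (Fin r) → EReal)
    (φh : NPPDEG.Vec (Fin n ⊕ Fin r) → Ξ → ℝ) (c : NPPDEG.Constants n r)
    (S : Set (NPPDEG.Vec (Fin n ⊕ Fin r))) (ρ : ℝ)
    (hminty : NPPDEG.WeakMVI (NPPDEG.opT f g (NPPDEG.meanFn P φh)) S ρ)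
    (horacle : NPPDEG.Oracle P φh)
    (hassump : NPPDEG.Assumptions P f g φh c)
    (α : ℕ → ℝ) (hα : ∀ k, 0 < α k ∧ α k < 1) (hα0 : ∀ k, α k ≤ α 0)
    (ξ : Fin 3 → ℕ → Ω → Ξ)
    (x xh xb : ℤ → Ω → NPPDEG.Vec (Fin n)) (y yh yb : ℤ → Ω → NPPDEG.Vec (Fin r))
    (hrun : ∀ ω, NPPDEG.IsRun f g φh c α (fun i k => ξ i k ω)
      (fun k => x k ω) (fun k => xh k ω) (fun k => xb k ω)
      (fun k => y k ω) (fun k => yh k ω) (fun k => yb k ω))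
    (K : ℕ) (κ : Ω → ℕ)
    (hκ : ∀ k ∈ Finset.range (K + 1),
      μ {ω | κ ω = k} = ENNReal.ofReal (α k / ∑ j ∈ Finset.range (K + 1), α j))
    (hsampling : NPPDEG.Sampling μ P ξ
      (fun ω => (x 0 ω, y 0 ω, xh (-1) ω, yh (-1) ω)) κ)
    (zs : NPPDEG.Vec (Fin n ⊕ Fin r)) (hzs : zs ∈ S)
    (hc2 : 0 < 1 - 4 * c.c2 * α 0) :
    -- the bound with free parameters `b` and `ε`
    (∀ b ε η m e C : ℝ, 0 < b → 0 < ε → 0 ≤ 1 - 1 / (ε * (1 - c.LM) ^ 2) →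
      e = ε + 1 / b * (1 - 1 / (ε * (1 - c.LM) ^ 2)) →
      (1 + 4 * c.c2 * α 0 ^ 2) * e / (1 - 4 * c.c2 * α 0) ≤ η →
      m = 1 / (1 + b) * (1 - 1 / (ε * (1 - c.LM) ^ 2)) + 2 * ρ / c.gbar ρ - α 0
        - 2 * α 0 * (c.c1 + 2 * c.c2 * (1 + c.c3)) * η →
      0 < m →
      C = 2 * (η + α 0 * e) * (c.Theta + 2 * c.c2) + 1
        + 2 * (c.c1 + 2 * c.c2 * (1 + c.c3)) * η →
      ∑ k ∈ Finset.range (K + 1),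
          ENNReal.ofReal (α k / ∑ j ∈ Finset.range (K + 1), α j) *
          ∫⁻ ω, ENNReal.ofReal (NPPDEG.wsq c.Γ
            (NPPDEG.act c.Γ⁻¹ (NPPDEG.pair (xh k ω) (yh k ω))
              - c.opS (NPPDEG.meanFn P φh) (NPPDEG.pair (x k ω) (y k ω))
                (NPPDEG.pair (xb k ω) (yb k ω)) (NPPDEG.pair (xb k ω) (yb k ω)))) ∂μ
        ≤ (∫⁻ ω, ENNReal.ofReal (NPPDEG.wsq c.Γ⁻¹ (NPPDEG.pair (x 0 ω) (y 0 ω) - zs)) ∂μ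
            + ENNReal.ofReal η * ∫⁻ ω, ENNReal.ofReal (NPPDEG.wsq c.Γ
              (NPPDEG.act c.Γ⁻¹ (NPPDEG.pair (xh (-1) ω) (yh (-1) ω))
                - c.opS (NPPDEG.meanFn P φh) (NPPDEG.pair (x (-1) ω) (y (-1) ω))
                  (NPPDEG.pair (x (-1) ω) (y (-1) ω))
                  (NPPDEG.pair (xb (-1) ω) (yb (-1) ω)))) ∂μ
            + ENNReal.ofReal (C * c.σ ^ 2 * ∑ j ∈ Finset.range (K + 1), α j ^ 2))
          / ENNReal.ofReal (m * ∑ j ∈ Finset.range (K + 1), α j)) ∧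
    -- the bound at the random index
    (∀ η m e C : ℝ,
      e = 1 / (√(α 0) * (1 - c.LM) ^ 2) + (1 - √(α 0)) / √(α 0) →
      (1 + 4 * c.c2 * α 0 ^ 2) * e / (1 - 4 * c.c2 * α 0) ≤ η →
      m = (1 - √(α 0)) / (1 + √(α 0)) + 2 * ρ / c.gbar ρ - α 0
        - 2 * α 0 * (c.c1 + 2 * c.c2 * (1 + c.c3)) * η →
      0 < m →
      C = 2 * (η + α 0 * e) * (c.Theta + 2 * c.c2) + 1
        + 2 * (c.c1 + 2 * c.c2 * (1 + c.c3)) * η →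
      ∫⁻ ω, NPPDEG.wdist c.Γ 0 (NPPDEG.opT f g (NPPDEG.meanFn P φh)
          (NPPDEG.pair (xb (κ ω) ω) (yb (κ ω) ω))) ^ 2 ∂μ
        ≤ (∫⁻ ω, ENNReal.ofReal (NPPDEG.wsq c.Γ⁻¹ (NPPDEG.pair (x 0 ω) (y 0 ω) - zs)) ∂μ
            + ENNReal.ofReal η * ∫⁻ ω, ENNReal.ofReal (NPPDEG.wsq c.Γ
              (NPPDEG.act c.Γ⁻¹ (NPPDEG.pair (xh (-1) ω) (yh (-1) ω))
                - c.opS (NPPDEG.meanFn P φh) (NPPDEG.pair (x (-1) ω) (y (-1) ω))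
                  (NPPDEG.pair (x (-1) ω) (y (-1) ω))
                  (NPPDEG.pair (xb (-1) ω) (yb (-1) ω)))) ∂μ
            + ENNReal.ofReal (C * c.σ ^ 2 * ∑ j ∈ Finset.range (K + 1), α j ^ 2))
          / ENNReal.ofReal (m * ∑ j ∈ Finset.range (K + 1), α j)) := by
  have H : NPPDEG.Context μ P f g φh c α ξ x xh xb y yh yb κ :=
    ⟨hassump, horacle, hα, hrun, hsampling⟩
  have hinit : ∫⁻ ω, ENNReal.ofReal (NPPDEG.wsq c.Γ
      (NPPDEG.act c.Γ⁻¹ (NPPDEG.pair (xh (-1) ω) (yh (-1) ω))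
        - c.opS (NPPDEG.meanFn P φh) (NPPDEG.pair (x (-1) ω) (y (-1) ω))
          (NPPDEG.pair (x (-1) ω) (y (-1) ω))
          (NPPDEG.pair (xb (-1) ω) (yb (-1) ω)))) ∂μ
      = NPPDEG.meanErr μ P φh c x xh xb y yh (-1) := by
    refine lintegral_congr fun ω => ?_
    rw [NPPDEG.sub_opS_eq_pair_err hassump.Γ₁_pos hassump.Γ₂_pos]
    exact NPPDEG.nsq_Γ_pair hassump _ _
  rw [hinit]
  constructor
  · intro b ε η m e C hb hε hbε he hη hm hm0 hC
    refine le_of_eq_of_le ?_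
      (H.average_meanResid_le hα0 hc2 hminty hzs hb hε hbε he hη hm hm0 hC K)
    refine Finset.sum_congr rfl fun k _ => congrArg _ (lintegral_congr fun ω => ?_)
    rw [NPPDEG.sub_opS_eq_resid hassump.Γ₁_pos hassump.Γ₂_pos]
    rfl
  · intro η m e C he hη hm hm0 hC
    have hs : 0 < √(α 0) := Real.sqrt_pos.2 (hα 0).1
    have hs1 : √(α 0) ≤ 1 := Real.sqrt_le_one.2 (hα 0).2.le
    have hL : 0 < (1 - c.LM) ^ 2 := pow_pos (sub_pos.2 hassump.LM_lt_one) 2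
    -- the bound holds with `b = √α₀` and `ε = 1 / (√α₀ (1 - L_M)²)`
    have hε : 1 / (1 / (√(α 0) * (1 - c.LM) ^ 2) * (1 - c.LM) ^ 2) = √(α 0) := by
      rw [one_div_mul_eq_div, one_div_div, mul_div_cancel_right₀ _ hL.ne']
    refine (H.lintegral_wdist_index_le K hκ).trans
      (H.average_meanResid_le hα0 hc2 hminty hzs hs
        (one_div_pos.2 (mul_pos hs hL)) ?_ ?_ hη ?_ hm0 hC K)
    · rw [hε]
      exact sub_nonneg.2 hs1
    · rw [hε, he]
      ring
    · rw [hε, hm]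
      ring
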